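/- Let $p\ge 0$ be an integer, $\beta=(\beta_1,\dots,\beta_p)\in\mathbb R^p$ such that all complex roots of $w^p=\beta_1w^{p-1}+\dots+\beta_p$ satisfy $|w|<1$, let $\mu\in\mathbb R$, $\nu=(1-\beta_1-\dots-\beta_p)\mu$, let $\Pi$ be a probability distribution on $\mathbb R$, and let $0\le\Gamma<\infty$. For $n\ge1$ and $0\le\gamma\le\Gamma$ put $\gamma_n=\min(1,\gamma n^{-1/2})$ and consider the observations $$y_t=v_t+z_t^{\gamma_n}\xi_t,\quad t=1-p,\dots,n,\qquad v_t=\beta_1v_{t-1}+\dots+\beta_pv_{t-p}+\nu+\varepsilon_t\quad(t\in\mathbb Z),$$ where $\{\varepsilon_t\}$ are i.i.d. with distribution function (d.f.) $G$, $\{v_t\}$ is a stationary solution of the autoregression, $\{z_t^{\gamma_n}\}$ are i.i.d. Bernoulli variables with values $1$ and $0$ and $P(z_t^{\gamma_n}=1)=\gamma_n$, $\{\xi_t\}$ are i.i.d. with distribution $\Pi$, and the sequences $\{v_t\}$, $\{z_t^{\gamma_n}\}$, $\{\xi_t\}$ are mutually independent. Let $\hat\mu_n\in\mathbb R$ and $\hat\beta_n=(\hat\beta_{1n},\dots,\hat\beta_{pn})\in\mathbb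 R^p$ be any estimators (random variables) with $n^{1/2}(\hat\mu_n-\mu)=O_P(1)$ and $n^{1/2}(\hat\beta_n-\beta)=O_P(1)$ as $n\to\infty$, uniformly in $\gamma\le\Gamma$. Put $\hat u_t=y_t-\hat\mu_n$, $\hat\varepsilon_t=\hat u_t-\hat\beta_{1n}\hat u_{t-1}-\dots-\hat\beta_{pn}\hat u_{t-p}$ for $t=1,\dots,n$, and $$\hat G_n(x)=\frac1n\sum_{t=1}^nI(\hat\varepsilon_t\le x),\quad G_n(x)=\frac1n\sum_{t=1}^nI(\varepsilon_t\le x),$$ $$\hat S_n(x)=\frac{\hat G_n(x)+1-\hat G_n(-x)}2,\quad S_n(x)=\frac{G_n(x)+1-G_n(-x)}2 .$$ For a d.f. $F$ let $\Delta_F(x,\Pi)=\sum_{j=0}^p\bigl[\mathsf E F(x+\beta_j\xi_1)-F(x)\bigr]$ with $\beta_0=-1$. Call a d.f. *admissible* if it has mean zero and finite variance and is twice differentiable with bounded second derivative; call it symmetric if $F(-x)=1-F(x)$ for all $x$. Assume one of the following two situations. 1. $G$ does not depend on $n$ and is admissible and symmetric; put $G_0=G$. 2. $G=A_n$ depends on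 $n$, $A_n(x)=(1-n^{-1/2})G_0(x)+n^{-1/2}H(x)$, where the d.f.s $G_0$ and $H$ are admissible and $G_0$ is symmetric ($H$ need not be symmetric). Then in either situation, with $\Delta_S(x,\Pi)=\bigl(\Delta_{G_0}(x,\Pi)-\Delta_{G_0}(-x,\Pi)\bigr)/2$, for every $x\in\mathbb R$ and every $\delta>0$, $$\sup_{0\le\gamma\le\Gamma}\mathsf P\Bigl(\bigl|n^{1/2}[\hat S_n(x)-S_n(x)]-\gamma\Delta_S(x,\Pi)\bigr|>\delta\Bigr)\to0,\qquad n\to\infty .$$ -/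

import Mathlib

open MeasureTheory ProbabilityTheory Filter Topology

noncomputable section

namespace ResidualAR

/-- All complex roots of `w ^ p = β₁ w ^ (p - 1) + ⋯ + β_p` lie in the open unit disc.
The coefficient `β_{j+1}` is `β j`, `j : Fin p`. -/
def RootsInUnitDisc {p : ℕ} (β : Fin p → ℝ) : Prop :=
  ∀ w : ℂ, w ^ p = ∑ j : Fin p, (β j : ℂ) * w ^ (p - 1 - (j : ℕ)) → ‖w‖ < 1

/-- A law on `ℝ` with mean zero and finite variance whose distribution function is twice
differentiable with a bounded second derivative.  (Such a law has no atoms, so that its variance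
is positive.) -/
structure IsSmoothCenteredLaw (Q : Measure ℝ) : Prop where
  finite_variance : MemLp (fun x : ℝ => x) 2 Q
  mean_zero : ∫ x, x ∂Q = 0
  differentiable_cdf : Differentiable ℝ (fun x => cdf Q x)
  differentiable_density : Differentiable ℝ (deriv fun x => cdf Q x)
  bounded_second_deriv : ∃ C : ℝ, ∀ x, |deriv (deriv fun x => cdf Q x) x| ≤ C

/-- The distribution function of `Q` is symmetric about zero. -/
def IsSymmetricCdf (Q : Measure ℝ) : Prop :=
  ∀ x : ℝ, cdf Q (-x) = 1 - cdf Q x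

/-- The distribution function `A_n = (1 - n^{-1/2}) G₀ + n^{-1/2} H`. -/
def mixtureCdf (Q₀ QH : Measure ℝ) (n : ℕ) (x : ℝ) : ℝ :=
  (1 - 1 / √(n : ℝ)) * cdf Q₀ x + 1 / √(n : ℝ) * cdf QH x

/-- The contamination level `γ_n = min (1, γ / √n)`. -/
def contaminationLevel (γ : ℝ) (n : ℕ) : ℝ := min 1 (γ / √(n : ℝ))

section Model

variable {Ω : Type*} [MeasurableSpace Ω]

/-- `v` is a (strictly) stationary solution of the autoregression
`v_t = β₁ v_{t-1} + ⋯ + β_p v_{t-p} + ν + ε_t`, `t ∈ ℤ`. -/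
structure IsStationarySolution (P : Measure Ω) {p : ℕ} (β : Fin p → ℝ) (ν : ℝ)
    (ε v : ℤ → Ω → ℝ) : Prop where
  measurable : ∀ t, Measurable (v t)
  stationary : ∀ h : ℤ,
    P.map (fun ω (t : ℤ) => v (t + h) ω) = P.map (fun ω (t : ℤ) => v t ω)
  equation : ∀ t : ℤ, ∀ᵐ ω ∂P,
    v t ω = ∑ j : Fin p, β j * v (t - ((j : ℕ) + 1)) ω + ν + ε t ω

/-- The autoregression with outliers: `ε` are i.i.d. with distribution function `F`, `v` is a
stationary solution of the autoregression with innovations `ε`, `z` are i.i.d. Bernoulli variables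
with success probability `q`, `ξ` are i.i.d. with law `Q`, and the three sequences `v`, `z`, `ξ`
are mutually independent. -/
structure IsContaminatedAR (P : Measure Ω) {p : ℕ} (β : Fin p → ℝ) (ν : ℝ)
    (F : ℝ → ℝ) (q : ℝ) (Q : Measure ℝ) (ε v z ξ : ℤ → Ω → ℝ) : Prop where
  innov_measurable : ∀ t, Measurable (ε t)
  innov_indep : iIndepFun ε P
  innov_cdf : ∀ t x, cdf (P.map (ε t)) x = F x
  solution : IsStationarySolution P β ν ε v
  bern_measurable : ∀ t, Measurable (z t)
  bern_indep : iIndepFun z P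
  bern_one : ∀ t, P {ω | z t ω = 1} = ENNReal.ofReal q
  bern_zero : ∀ t, P {ω | z t ω = 0} = ENNReal.ofReal (1 - q)
  outlier_measurable : ∀ t, Measurable (ξ t)
  outlier_indep : iIndepFun ξ P
  outlier_law : ∀ t, P.map (ξ t) = Q
  sequences_indep : iIndepFun (β := fun _ : Fin 3 => ℤ → ℝ)
    ![fun ω t => v t ω, fun ω t => z t ω, fun ω t => ξ t ω] P

end Model

/-- The residual `ε̂_t = û_t - β̂₁ û_{t-1} - ⋯ - β̂_p û_{t-p}`, with `û_t = y_t - m`, computed from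
the observations `y`, the estimated mean `m` and the estimated coefficients `b`. -/
def arResidual {p : ℕ} (y : ℤ → ℝ) (m : ℝ) (b : Fin p → ℝ) (t : ℤ) : ℝ :=
  (y t - m) - ∑ j : Fin p, b j * (y (t - ((j : ℕ) + 1)) - m)

/-- The empirical distribution function of `r 1, …, r n`. -/
def edf (n : ℕ) (r : ℤ → ℝ) (x : ℝ) : ℝ :=
  (n : ℝ)⁻¹ * ∑ t ∈ Finset.Icc (1 : ℤ) n, (Set.Iic x).indicator (fun _ => (1 : ℝ)) (r t)

/-- The symmetrization `(F(x) + 1 - F(-x)) / 2`. -/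
def symmetrize (F : ℝ → ℝ) (x : ℝ) : ℝ := (F x + 1 - F (-x)) / 2

/-- The shift `Δ(x, Q) = ∑_{j=0}^p (E F(x + β_j ξ) - F(x))`, where `β₀ = -1` and `ξ` has
law `Q`. -/
def shift {p : ℕ} (β : Fin p → ℝ) (F : ℝ → ℝ) (Q : Measure ℝ) (x : ℝ) : ℝ :=
  ∑ j : Fin (p + 1), (∫ s, F (x + Matrix.vecCons (-1) β j * s) ∂Q - F x)

/-- The symmetrized shift `(Δ(x, Q) - Δ(-x, Q)) / 2`. -/
def symmShift {p : ℕ} (β : Fin p → ℝ) (F : ℝ → ℝ) (Q : Measure ℝ) (x : ℝ) : ℝ :=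
  (shift β F Q x - shift β F Q (-x)) / 2

section Uniform

variable {Ω : ℕ → ℝ → Type*} [∀ n γ, MeasurableSpace (Ω n γ)]

/-- `X_n = O_P(1)` as `n → ∞`, uniformly in `0 ≤ γ ≤ Γ`; `X n γ` lives on its own probability
space `Ω n γ`. -/
def UniformlyBoundedInProb {E : Type*} [Norm E] (P : ∀ n γ, Measure (Ω n γ)) (Γ : ℝ)
    (X : ∀ n γ, Ω n γ → E) : Prop :=
  ∀ η : ENNReal, 0 < η → ∃ C : ℝ, ∀ᶠ n in atTop,
    ⨆ γ ∈ Set.Icc 0 Γ, P n γ {ω | C < ‖X n γ ω‖} ≤ η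

/-- `X_n = o_P(1)` as `n → ∞`, uniformly in `0 ≤ γ ≤ Γ`: for each `δ > 0`,
`sup_{γ ≤ Γ} P(|X_n| > δ) → 0`. -/
def UniformlyTendstoZeroInProb (P : ∀ n γ, Measure (Ω n γ)) (Γ : ℝ)
    (X : ∀ n γ, Ω n γ → ℝ) : Prop :=
  ∀ δ : ℝ, 0 < δ →
    Tendsto (fun n => ⨆ γ ∈ Set.Icc 0 Γ, P n γ {ω | δ < |X n γ ω|}) atTop (𝓝 0)

end Uniform

end ResidualAR

end

/-! Subtracting the autoregression equation from the definition of the residual gives the exact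
identity ε̂_t = ε_t - a_t. Here a_t is the sum over the lags 0,…,p of β_i z_{t-i} ξ_{t-i} (with β_0
= -1) plus n^{-1/2} times an affine function of y_{t-1},…,y_{t-p}. The coefficients of that function
form the normalized estimation error ϑ, with first coordinate √n(μ̂-μ)(1-Σβ̂_j) and remaining
coordinates √n(β̂-β). Hence √n(Ĝ_n - G_n)(x) is n^{-1/2} times the sum over t of I(ε_t ≤ x + a_t) -
I(ε_t ≤ x).

For a deterministic ϑ, a_t depends only on innovations before t and on the outliers, so it is
independent of ε_t. Centring each increment by F(x + a_t) - F(x) leaves orthogonal terms whose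
variance is of the order of E|F(x + a_t) - F(x)| = O(n^{-1/2}); their normalized sum vanishes
(`bounded_sum_centredStep`). The remaining drift is split by the number of outliers among the p+1
lags (`HasExpansion.abs_increment_sub_le`): none gives a Taylor expansion, exactly one gives F(x +
β_i ξ) - F(x), and two or more occur with probability O(1/n). Since averages of the centred solution
tend to zero (`bounded_sum_sol`), the linear term keeps only F'(x)ϑ_1, and the outliers contribute
γΔ(x, Π). The result is `bounded_changeSum_sub`.

The actual ϑ is random and may depend on everything, but it is tight. A finite η-net of a ball
suffices: the sum is monotone in its thresholds, and the thresholds for ϑ lie between those of the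
nearest net point widened by ±η n^{-1/2}(1 + Σ|y_{t-j}|) (`threshold_sandwich`). All error bounds
are in mean and depend on γ only through Γ, hence uniformity.

Finally, symmetry of G_0 makes its density even, so the term with μ̂ is the same at x and -x and
cancels in the symmetrization; only the contamination shift survives. Passing from A_n to G_0
changes slope and shift by O(n^{-1/2}), which is why H need not be symmetric. -/

noncomputable section

namespace ResidualAR

/-! ### Deterministic causality: the companion operator and its powers -/

/-- The companion operator of the autoregression on `ℂ ^ p`. -/
def companion {p : ℕ} (β : Fin p → ℝ) : (Fin p → ℂ) →ₗ[ℂ] (Fin p → ℂ) where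
  toFun x i := if (i : ℕ) = 0 then ∑ j, (β j : ℂ) * x j
    else x ⟨(i : ℕ) - 1, lt_of_le_of_lt (Nat.sub_le _ _) i.2⟩
  map_add' x y := by
    funext i
    by_cases h : (i : ℕ) = 0 <;> simp [h, mul_add, Finset.sum_add_distrib]
  map_smul' c x := by
    funext i
    by_cases h : (i : ℕ) = 0
    · simp only [h, if_true, Pi.smul_apply, smul_eq_mul, RingHom.id_apply, Finset.mul_sum]
      exact Finset.sum_congr rfl fun j _ => by ring
    · simp [h]

lemma companion_zero {p : ℕ} (β : Fin p → ℝ) (x : Fin p → ℂ) (i : Fin p) (h : (i : ℕ) = 0) :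
    companion β x i = ∑ j, (β j : ℂ) * x j := by
  simp [companion, h]

lemma companion_succ {p : ℕ} (β : Fin p → ℝ) (x : Fin p → ℂ) (i : ℕ) (h : i + 1 < p) :
    companion β x ⟨i + 1, h⟩ = x ⟨i, by omega⟩ := by
  simp [companion]

/-- The shift rows force x_j = l^(p-1-j) x_{p-1} for an eigenvector; the last coordinate is
therefore nonzero, and the first row becomes the characteristic equation for l. -/
lemma norm_lt_one_of_companion_eigen {p : ℕ} {β : Fin p → ℝ} (hβ : RootsInUnitDisc β)
    {l : ℂ} {x : Fin p → ℂ} (hx : x ≠ 0) (h : companion β x = l • x) : ‖l‖ < 1 := by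
  rcases Nat.eq_zero_or_pos p with rfl | hp
  · exact absurd (Subsingleton.elim x 0) hx
  have key : ∀ k (hk : k < p), x ⟨p - 1 - k, by omega⟩ = l ^ k * x ⟨p - 1, by omega⟩ := by
    intro k
    induction k with
    | zero => intro hk; simp
    | succ k ih =>
      intro hk
      have h1 := congrFun h ⟨p - 1 - (k + 1) + 1, by omega⟩
      rw [companion_succ] at h1
      have h2 : (⟨p - 1 - (k + 1) + 1, by omega⟩ : Fin p) = ⟨p - 1 - k, by omega⟩ := by
        ext; simp; omega
      rw [h1, h2, Pi.smul_apply, smul_eq_mul, ih (by omega)]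
      ring
  have key' : ∀ j : Fin p, x j = l ^ (p - 1 - (j : ℕ)) * x ⟨p - 1, by omega⟩ := by
    intro j
    rw [← key (p - 1 - j) (by omega)]
    congr 1
    ext
    simp
    omega
  have hlast : x ⟨p - 1, by omega⟩ ≠ 0 := by
    intro h0
    apply hx
    funext j
    rw [key' j, h0]
    simp
  have h0 := congrFun h ⟨0, hp⟩
  rw [companion_zero _ _ _ rfl, Pi.smul_apply, smul_eq_mul, key' ⟨0, hp⟩] at h0
  apply hβ
  apply mul_right_cancel₀ hlast
  rw [Finset.sum_mul]
  calc l ^ p * x ⟨p - 1, by omega⟩ = l * (l ^ (p - 1 - 0) * x ⟨p - 1, by omega⟩) := by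
        rw [← mul_assoc, ← pow_succ']
        congr 2
        omega
    _ = ∑ j, (β j : ℂ) * x j := h0.symm
    _ = _ := Finset.sum_congr rfl fun j _ => by rw [key' j, mul_assoc]

/-- In a complex Banach algebra the powers of an element of spectral radius less than one are
summable in norm. -/
lemma summable_norm_pow_of_spectralRadius_lt_one {A : Type*} [NormedRing A] [NormedAlgebra ℂ A]
    [CompleteSpace A] (a : A) (h : spectralRadius ℂ a < 1) : Summable fun k : ℕ => ‖a ^ k‖ := by
  obtain ⟨r, hr1, hr2⟩ := ENNReal.lt_iff_exists_nnreal_btwn.1 h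
  have hr2' : r < 1 := by exact_mod_cast hr2
  -- Gelfand's formula gives eventually ‖a^k‖ ≤ r^k for an r strictly between the spectral radius
  -- and 1.
  have hlim := spectrum.pow_nnnorm_pow_one_div_tendsto_nhds_spectralRadius a
  have hev : ∀ᶠ k : ℕ in atTop, ‖a ^ k‖ ≤ (r : ℝ) ^ k := by
    filter_upwards [hlim.eventually_lt_const hr1, eventually_gt_atTop 0] with k hk hk0
    have h1 := ENNReal.rpow_le_rpow hk.le (Nat.cast_nonneg k : (0 : ℝ) ≤ k)
    have hk0' : (k : ℝ) ≠ 0 := by positivity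
    rw [← ENNReal.rpow_mul, one_div_mul_cancel hk0', ENNReal.rpow_one, ENNReal.rpow_natCast] at h1
    exact_mod_cast h1
  refine Summable.of_norm_bounded_eventually_nat
    (summable_geometric_of_lt_one r.2 (by exact_mod_cast hr2')) ?_
  filter_upwards [hev] with k hk
  simpa using hk

/-- In finite dimension the spectrum consists of eigenvalues, and its compactness turns the
pointwise bound ‖l‖ < 1 into a spectral radius below 1. Positivity of p keeps the algebra
nontrivial. -/
lemma summable_norm_companion_pow {p : ℕ} {β : Fin p → ℝ} (hβ : RootsInUnitDisc β) (hp : 0 < p) :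
    Summable fun k : ℕ => ‖(LinearMap.toContinuousLinearMap (companion β)) ^ k‖ := by
  have : Nonempty (Fin p) := ⟨⟨0, hp⟩⟩
  apply summable_norm_pow_of_spectralRadius_lt_one
  have := spectrum.spectralRadius_lt_of_forall_lt
    (LinearMap.toContinuousLinearMap (companion β)) (r := 1) ?_
  · simpa using this
  intro l hl
  have h1 : Module.End.HasEigenvalue (companion β) l := by
    rw [Module.End.hasEigenvalue_iff_mem_spectrum]
    rw [← AlgEquiv.spectrum_eq (Module.End.toContinuousLinearMap (Fin p → ℂ))]
    exact hl
  obtain ⟨x, hx⟩ := h1.exists_hasEigenvector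
  have := norm_lt_one_of_companion_eigen hβ hx.2 hx.apply_eq_smul
  exact_mod_cast this

/-- Causality: a solution of the autoregression is approximated by moving averages of its
innovations. -/
lemma exists_movingAverage_approx {p : ℕ} {β : Fin p → ℝ} (hβ : RootsInUnitDisc β) :
    ∃ ψ ρ : ℕ → ℝ, Summable (fun i => |ψ i|) ∧ Tendsto ρ atTop (𝓝 0) ∧ ∀ u e : ℤ → ℝ,
      (∀ t, u t = ∑ j : Fin p, β j * u (t - ((j : ℕ) + 1)) + e t) →
      ∀ t : ℤ, ∀ k : ℕ, 1 ≤ k →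
        |u t - ∑ i ∈ Finset.range k, ψ i * e (t - i)| ≤ ρ k * ∑ j : Fin p, |u (t - k - (j : ℕ))| := by
  rcases Nat.eq_zero_or_pos p with rfl | hp
  -- For p = 0 the solution is the innovation itself and the error bound is an empty sum, so the
  -- moving average must already contain its term i = 0: hence the restriction 1 ≤ k.
  · refine ⟨fun i => if i = 0 then 1 else 0, fun _ => 0, ?_, tendsto_const_nhds, ?_⟩
    · apply summable_of_ne_finset_zero (s := {0})
      intro i hi
      simp at hi
      simp [hi]
    · intro u e h t k hk
      have : 0 ∈ Finset.range k := by simp; omega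
      simp [h t, ite_mul, Finset.sum_ite_eq', this]
  set B := LinearMap.toContinuousLinearMap (companion β) with hB
  set e₀ : Fin p → ℂ := fun i => if (i : ℕ) = 0 then 1 else 0 with he₀
  have hsum := summable_norm_companion_pow hβ hp
  refine ⟨fun i => ((B ^ i) e₀ ⟨0, hp⟩).re, fun k => ‖B ^ k‖, ?_, hsum.tendsto_atTop_zero, ?_⟩
  · refine Summable.of_nonneg_of_le (fun _ => abs_nonneg _) (fun i => ?_) (hsum.mul_right ‖e₀‖)
    calc |((B ^ i) e₀ ⟨0, hp⟩).re| ≤ ‖(B ^ i) e₀ ⟨0, hp⟩‖ := Complex.abs_re_le_norm _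
      _ ≤ ‖(B ^ i) e₀‖ := norm_le_pi_norm _ _
      _ ≤ _ := ContinuousLinearMap.le_opNorm _ _
  · intro u e h t k _
    set V : ℤ → Fin p → ℂ := fun s i => (u (s - (i : ℕ)) : ℂ) with hV
    have step : ∀ s, V s = B (V (s - 1)) + (e s : ℂ) • e₀ := by
      intro s
      funext i
      obtain ⟨i, hi⟩ := i
      rcases i with _ | i
      · rw [Pi.add_apply, hB, LinearMap.coe_toContinuousLinearMap', companion_zero _ _ _ rfl]
        simp only [hV, he₀]
        simp
        have := h s
        rw [this]
        push_cast
        congr 1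
        refine Finset.sum_congr rfl fun j _ => ?_
        rw [show s - 1 - (j : ℕ) = s - ((j : ℕ) + 1) by ring]
      · rw [Pi.add_apply, hB, LinearMap.coe_toContinuousLinearMap', companion_succ]
        simp only [hV, he₀]
        simp
        congr 1
        ring
    -- With V_t the vector of the last p values, the recursion V_t = B V_{t-1} + e_t e₀ is unrolled
    -- m times; the first coordinate yields ψ_i from B^i e₀ and the error from ‖B^m‖.
    have iter : ∀ m : ℕ, V t = (B ^ m) (V (t - m))
        + ∑ i ∈ Finset.range m, (e (t - i) : ℂ) • (B ^ i) e₀ := by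
      intro m
      induction m with
      | zero => simp
      | succ m ih =>
        rw [ih, step (t - m), Finset.sum_range_succ, map_add, map_smul, pow_succ]
        simp only [mul_apply_eq_comp]
        rw [show t - (m : ℤ) - 1 = t - ((m + 1 : ℕ) : ℤ) by push_cast; ring]
        abel
    have h0 := congrFun (iter k) ⟨0, hp⟩
    have h1 := congrArg Complex.re h0
    simp only [Pi.add_apply, Finset.sum_apply, Pi.smul_apply, smul_eq_mul, Complex.add_re,
      Complex.re_sum, Complex.re_ofReal_mul] at h1
    have h2 : (V t ⟨0, hp⟩).re = u t := by simp [hV]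
    rw [h2] at h1
    rw [h1]
    have h3 : ∑ i ∈ Finset.range k, ((B ^ i) e₀ ⟨0, hp⟩).re * e (t - i)
        = ∑ i ∈ Finset.range k, e (t - i) * ((B ^ i) e₀ ⟨0, hp⟩).re :=
      Finset.sum_congr rfl fun _ _ => mul_comm _ _
    rw [h3, add_sub_cancel_right]
    calc |((B ^ k) (V (t - k)) ⟨0, hp⟩).re| ≤ ‖(B ^ k) (V (t - k)) ⟨0, hp⟩‖ :=
          Complex.abs_re_le_norm _
      _ ≤ ‖(B ^ k) (V (t - k))‖ := norm_le_pi_norm _ _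
      _ ≤ ‖B ^ k‖ * ‖V (t - k)‖ := ContinuousLinearMap.le_opNorm _ _
      _ ≤ ‖B ^ k‖ * ∑ j : Fin p, |u (t - k - (j : ℕ))| := by
        refine mul_le_mul_of_nonneg_left ?_ (norm_nonneg _)
        rw [pi_norm_le_iff_of_nonneg (Finset.sum_nonneg fun _ _ => abs_nonneg _)]
        intro i
        have : ‖V (t - k) i‖ = |u (t - k - (i : ℕ))| := by simp [hV]
        rw [this]
        exact Finset.single_le_sum (f := fun j : Fin p => |u (t - k - (j : ℕ))|)
          (fun _ _ => abs_nonneg _) (Finset.mem_univ i)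

/-- Otherwise w = 1 would be a root of the characteristic equation. -/
lemma one_sub_sum_ne_zero {p : ℕ} {β : Fin p → ℝ} (hβ : RootsInUnitDisc β) :
    1 - ∑ j, β j ≠ 0 := by
  intro h
  have h1 : ((1 : ℂ)) ^ p = ∑ j : Fin p, (β j : ℂ) * (1 : ℂ) ^ (p - 1 - (j : ℕ)) := by
    simp only [one_pow, mul_one]
    have : ∑ j, β j = 1 := by linarith
    exact_mod_cast this.symm
  have := hβ 1 h1
  simp at this

/-! ### Stationary solutions as limits of moving averages -/

section Causality

variable {Ω : Type*} [MeasurableSpace Ω] {P : Measure Ω}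

/-- The time index may move with k because only the law matters: ρ_k u_{s(k)} has the law of ρ_k
u_0, which tends to zero pointwise. -/
lemma tendsto_measure_scaled_of_same_law [IsProbabilityMeasure P] {u : ℤ → Ω → ℝ}
    (hu : ∀ t, Measurable (u t)) (hlaw : ∀ t, P.map (u t) = P.map (u 0)) {ρ : ℕ → ℝ}
    (hρ : Tendsto ρ atTop (𝓝 0)) (s : ℕ → ℤ) {δ : ℝ} (hδ : 0 < δ) :
    Tendsto (fun k => P {ω | δ ≤ |ρ k * u (s k) ω|}) atTop (𝓝 0) := by
  have h1 : TendstoInMeasure P (fun k ω => ρ k * u 0 ω) atTop (fun _ => (0 : ℝ)) := by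
    apply tendstoInMeasure_of_tendsto_ae
    · intro k
      exact ((hu 0).const_mul _).aestronglyMeasurable
    · refine Eventually.of_forall fun ω => ?_
      simpa using hρ.mul_const (u 0 ω)
  have h2 := tendstoInMeasure_iff_norm.1 h1 δ hδ
  refine h2.congr fun k => ?_
  have hS : MeasurableSet {x : ℝ | δ ≤ |ρ k * x|} :=
    measurableSet_le measurable_const (measurable_const.mul measurable_id).abs
  have h3 := congrArg (fun m : Measure ℝ => m {x : ℝ | δ ≤ |ρ k * x|}) (hlaw (s k))
  simp only [Measure.map_apply (hu _) hS] at h3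
  simpa using h3.symm

/-- A common marginal law is enough to make the remainder negligible; no moment of the solution is
used here. -/
lemma tendstoInMeasure_movingAverage [IsProbabilityMeasure P] {p : ℕ} {β : Fin p → ℝ}
    {ψ ρ : ℕ → ℝ} (hρ : Tendsto ρ atTop (𝓝 0))
    (hψ : ∀ u e : ℤ → ℝ, (∀ t, u t = ∑ j : Fin p, β j * u (t - ((j : ℕ) + 1)) + e t) →
      ∀ t : ℤ, ∀ k : ℕ, 1 ≤ k →
        |u t - ∑ i ∈ Finset.range k, ψ i * e (t - i)| ≤ ρ k * ∑ j : Fin p, |u (t - k - (j : ℕ))|)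
    {u ε : ℤ → Ω → ℝ} (hu : ∀ t, Measurable (u t)) (hlaw : ∀ t, P.map (u t) = P.map (u 0))
    (heq : ∀ t, ∀ᵐ ω ∂P, u t ω = ∑ j : Fin p, β j * u (t - ((j : ℕ) + 1)) ω + ε t ω) (t : ℤ) :
    TendstoInMeasure P (fun (k : ℕ) ω => ∑ i ∈ Finset.range k, ψ i * ε (t - i) ω) atTop (u t) := by
  rw [tendstoInMeasure_iff_norm]
  intro δ hδ
  have hall := ae_all_iff.2 heq
  -- Dividing by p + 1 instead of p makes the p small terms sum to strictly less than δ, and also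
  -- covers p = 0.
  have hδ' : 0 < δ / (p + 1) := by positivity
  have hlim : Tendsto (fun k : ℕ => ∑ j : Fin p,
      P {ω | δ / (p + 1) ≤ |ρ k * u (t - k - (j : ℕ)) ω|}) atTop (𝓝 0) := by
    have := tendsto_finsetSum (Finset.univ : Finset (Fin p)) fun j _ =>
      tendsto_measure_scaled_of_same_law hu hlaw hρ (fun k : ℕ => t - k - (j : ℕ)) hδ'
    simpa using this
  refine tendsto_of_tendsto_of_tendsto_of_le_of_le' tendsto_const_nhds hlim
    (Eventually.of_forall fun _ => zero_le) ?_
  filter_upwards [eventually_ge_atTop 1] with k hk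
  refine le_trans (measure_mono_ae ?_) (measure_iUnion_fintype_le P
    fun j : Fin p => {ω | δ / (p + 1) ≤ |ρ k * u (t - k - (j : ℕ)) ω|})
  filter_upwards [hall] with ω hω hmem
  have h1 := hψ (fun s => u s ω) (fun s => ε s ω) hω t k hk
  change δ ≤ ‖_‖ at hmem
  rw [norm_sub_rev, Real.norm_eq_abs] at hmem
  have h2 := hmem.trans h1
  change ω ∈ ⋃ j, _
  rw [Set.mem_iUnion]
  by_contra hno
  push Not at hno
  have h3 : ρ k * ∑ j : Fin p, |u (t - k - (j : ℕ)) ω| ≤ ∑ _j : Fin p, δ / (p + 1) := by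
    rw [Finset.mul_sum]
    refine Finset.sum_le_sum fun j _ => ?_
    have h4 := hno j
    simp only [Set.mem_ofPred_eq, not_le] at h4
    calc ρ k * |u (t - k - (j : ℕ)) ω| ≤ |ρ k| * |u (t - k - (j : ℕ)) ω| :=
          mul_le_mul_of_nonneg_right (le_abs_self _) (abs_nonneg _)
      _ ≤ _ := by rw [← abs_mul]; exact h4.le
  have h5 : ∑ _j : Fin p, δ / ((p : ℝ) + 1) < δ := by
    simp only [Finset.sum_const, Finset.card_univ, Fintype.card_fin, nsmul_eq_mul]
    rw [mul_div_assoc', div_lt_iff₀ (by positivity)]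
    nlinarith
  linarith

/-- The given solution is a function of past innovations only up to null sets. The pointwise limit
of an almost surely convergent subsequence of moving averages repairs this: one function f is
measurable for every σ-algebra carrying the innovations up to t. -/
lemma exists_measurable_modification [IsProbabilityMeasure P] {ψ : ℕ → ℝ} {u ε : ℤ → Ω → ℝ} {t : ℤ}
    (hlim : TendstoInMeasure P (fun (k : ℕ) ω => ∑ i ∈ Finset.range k, ψ i * ε (t - i) ω)
      atTop (u t)) :
    ∃ f : Ω → ℝ, (∀ m : MeasurableSpace Ω, (∀ s ≤ t, Measurable[m] (ε s)) → Measurable[m] f) ∧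
      f =ᵐ[P] u t := by
  obtain ⟨ns, -, hns⟩ := hlim.exists_seq_tendsto_ae
  refine ⟨fun ω => limUnder atTop fun i =>
    ∑ i ∈ Finset.range (ns i), ψ i * ε (t - i) ω, fun m hm => ?_, ?_⟩
  · refine (StronglyMeasurable.limUnder fun i => ?_).measurable
    refine Measurable.stronglyMeasurable ?_
    refine Finset.measurable_sum _ fun j _ => ?_
    exact (hm _ (by omega)).const_mul _
  · filter_upwards [hns] with ω hω
    exact hω.limUnder_eq

/-- Minkowski's inequality bounds all moving averages alike, and Fatou's lemma along an almost
surely convergent subsequence passes the bound to the limit. It involves only ψ and σ, hence is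
uniform over the family of models. -/
lemma eLpNorm_movingAverage_limit_le [IsProbabilityMeasure P] {ψ : ℕ → ℝ}
    (hψ : Summable fun i => |ψ i|) {u ε : ℤ → Ω → ℝ} {t : ℤ} (hε : ∀ t, Measurable (ε t))
    {σ : ℝ} (hσ0 : 0 ≤ σ) (hσ : ∀ t, eLpNorm (ε t) 2 P ≤ ENNReal.ofReal σ)
    (hlim : TendstoInMeasure P (fun (k : ℕ) ω => ∑ i ∈ Finset.range k, ψ i * ε (t - i) ω)
      atTop (u t)) :
    eLpNorm (u t) 2 P ≤ ENNReal.ofReal ((∑' i, |ψ i|) * σ) := by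
  obtain ⟨ns, -, hns⟩ := hlim.exists_seq_tendsto_ae
  refine Lp.eLpNorm_le_of_ae_tendsto (Eventually.of_forall fun i => ?_) (fun i => ?_) hns
  · have h1 : (fun ω => ∑ j ∈ Finset.range (ns i), ψ j * ε (t - j) ω)
        = ∑ j ∈ Finset.range (ns i), ψ j • ε (t - j) := by
      funext ω; simp
    change eLpNorm (fun ω => ∑ j ∈ Finset.range (ns i), ψ j * ε (t - j) ω) 2 P ≤ _
    rw [h1]
    refine (eLpNorm_sum_le (fun j _ => ((hε _).const_smul _).aestronglyMeasurable)
      (by norm_num)).trans ?_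
    calc ∑ j ∈ Finset.range (ns i), eLpNorm (ψ j • ε (t - j)) 2 P
        ≤ ∑ j ∈ Finset.range (ns i), ENNReal.ofReal (|ψ j| * σ) := by
          refine Finset.sum_le_sum fun j _ => ?_
          rw [eLpNorm_const_smul, ENNReal.ofReal_mul (abs_nonneg _), ← Real.norm_eq_abs,
            ofReal_norm]
          exact mul_le_mul_right (hσ _) _
      _ = ENNReal.ofReal (∑ j ∈ Finset.range (ns i), |ψ j| * σ) :=
          (ENNReal.ofReal_sum_of_nonneg fun _ _ => mul_nonneg (abs_nonneg _) hσ0).symm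
      _ ≤ _ := by
          refine ENNReal.ofReal_le_ofReal ?_
          rw [← Finset.sum_mul]
          exact mul_le_mul_of_nonneg_right (hψ.sum_le_tsum _ fun _ _ => abs_nonneg _) hσ0
  · exact (Finset.measurable_sum _ fun j _ => (hε _).const_mul _).aestronglyMeasurable

end Causality

/-! ### Independence of an innovation from the past -/

section Independence

variable {Ω : Type*} [MeasurableSpace Ω] {P : Measure Ω}

/-- Both hypotheses together say that the joint law of (X, Y, Z) is a threefold product; it remains
to reassociate it. -/
lemma indepFun_prodMk_of_indepFun [IsProbabilityMeasure P] {α β γ : Type*} [MeasurableSpace α]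
    [MeasurableSpace β] [MeasurableSpace γ] {X : Ω → α} {Y : Ω → β} {Z : Ω → γ}
    (hX : Measurable X) (hY : Measurable Y) (hZ : Measurable Z) (h1 : IndepFun X Y P)
    (h2 : IndepFun (fun ω => (X ω, Y ω)) Z P) : IndepFun X (fun ω => (Y ω, Z ω)) P := by
  have h3 : IndepFun Y Z P := h2.comp measurable_snd measurable_id
  rw [indepFun_iff_map_prod_eq_prod_map_map hX.aemeasurable (hY.prodMk hZ).aemeasurable]
  rw [indepFun_iff_map_prod_eq_prod_map_map hX.aemeasurable hY.aemeasurable] at h1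
  rw [indepFun_iff_map_prod_eq_prod_map_map (hX.prodMk hY).aemeasurable hZ.aemeasurable, h1] at h2
  rw [indepFun_iff_map_prod_eq_prod_map_map hY.aemeasurable hZ.aemeasurable] at h3
  have := Measure.isProbabilityMeasure_map (μ := P) hX.aemeasurable
  have := Measure.isProbabilityMeasure_map (μ := P) hY.aemeasurable
  have := Measure.isProbabilityMeasure_map (μ := P) hZ.aemeasurable
  rw [h3, ← Measure.prodAssoc_prod, ← h2,
    Measure.map_map MeasurableEquiv.prodAssoc.measurable ((hX.prodMk hY).prodMk hZ)]
  rfl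

lemma iIndepFun.indepFun_past {ε : ℤ → Ω → ℝ} (hε : ∀ t, Measurable (ε t)) (h : iIndepFun ε P)
    (t : ℤ) : IndepFun (ε t) (fun ω (s : Set.Iio t) => ε s ω) P := by
  rw [IndepFun_iff_Indep]
  have h1 := indep_iSup_of_disjoint (m := fun s => MeasurableSpace.comap (ε s) inferInstance)
    (fun s => (hε s).comap_le) h.iIndep (S := {t}) (T := Set.Iio t) (by simp)
  refine indep_of_indep_of_le h1 (by simp) ?_
  rw [MeasurableSpace.pi, MeasurableSpace.comap_iSup]
  refine iSup_le fun s => ?_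
  rw [MeasurableSpace.comap_comp]
  exact le_iSup₂_of_le (s : ℤ) s.2 le_rfl

end Independence

/-! ### Reduction of the model to the properties used in the asymptotics -/

section Regular

variable {Ω : Type*} [MeasurableSpace Ω] {P : Measure Ω}

/-- The consequences of the model that the asymptotic analysis uses.  The process `u` is a
modification of the centred solution, `𝓕 t` contains the innovations before time `t` and both
outlier sequences, and `κ` bounds the `L²` norm of `u t`. -/
structure IsRegularModel (P : Measure Ω) {p : ℕ} (β : Fin p → ℝ) (L Q : Measure ℝ) (q κ : ℝ)
    (𝓕 : ℤ → MeasurableSpace Ω) (ε u z ξ : ℤ → Ω → ℝ) : Prop where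
  innov_meas : ∀ t, Measurable (ε t)
  sol_meas : ∀ t, Measurable (u t)
  bern_meas : ∀ t, Measurable (z t)
  outlier_meas : ∀ t, Measurable (ξ t)
  filt_le : ∀ t, 𝓕 t ≤ inferInstanceAs (MeasurableSpace Ω)
  innov_past : ∀ s t, s < t → Measurable[𝓕 t] (ε s)
  sol_past : ∀ s t, s < t → Measurable[𝓕 t] (u s)
  bern_past : ∀ s t, Measurable[𝓕 t] (z s)
  outlier_past : ∀ s t, Measurable[𝓕 t] (ξ s)
  innov_indep : ∀ t, Indep (MeasurableSpace.comap (ε t) inferInstance) (𝓕 t) P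
  innov_law : ∀ t, P.map (ε t) = L
  innov_pair : ∀ s t, s ≠ t → IndepFun (ε s) (ε t) P
  bern_zero_one : ∀ᵐ ω ∂P, ∀ t, z t ω = 0 ∨ z t ω = 1
  sol_norm : ∀ t, eLpNorm (u t) 2 P ≤ ENNReal.ofReal κ
  equation : ∀ᵐ ω ∂P, ∀ t, u t ω = ∑ j : Fin p, β j * u (t - ((j : ℕ) + 1)) ω + ε t ω
  bern_integral : ∀ t, ∫ ω, z t ω ∂P = q
  bern_pair : ∀ s t, s ≠ t → ∫ ω, z s ω * z t ω ∂P = q ^ 2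
  bern_abs_sol : ∀ s t, ∫ ω, z s ω * |u t ω| ∂P = q * ∫ ω, |u t ω| ∂P
  bern_outlier : ∀ φ : ℝ → ℝ, Measurable φ → ∀ t,
    ∫ ω, z t ω * φ (ξ t ω) ∂P = q * ∫ x, φ x ∂Q
  bern_outlier_pair : ∀ φ : ℝ → ℝ, Measurable φ → ∀ s t, s ≠ t →
    ∫ ω, (z s ω * φ (ξ s ω)) * (z t ω * φ (ξ t ω)) ∂P = (q * ∫ x, φ x ∂Q) ^ 2

namespace IsContaminatedAR

variable {p : ℕ} {β : Fin p → ℝ} {ν : ℝ} {F : ℝ → ℝ} {q : ℝ} {Q : Measure ℝ}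
  {ε v z ξ : ℤ → Ω → ℝ}

lemma bern_zero_one [IsProbabilityMeasure P] (h : IsContaminatedAR P β ν F q Q ε v z ξ)
    (hq0 : 0 ≤ q) (hq1 : q ≤ 1) (t : ℤ) : ∀ᵐ ω ∂P, z t ω = 0 ∨ z t ω = 1 := by
  have m1 : MeasurableSet {ω | z t ω = 1} := h.bern_measurable t (measurableSet_singleton 1)
  have m0 : MeasurableSet {ω | z t ω = 0} := h.bern_measurable t (measurableSet_singleton 0)
  have hd : Disjoint {ω | z t ω = 0} {ω | z t ω = 1} := by
    rw [Set.disjoint_left]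
    intro ω h0 h1
    simp only [Set.mem_ofPred_eq] at h0 h1
    rw [h0] at h1
    exact zero_ne_one h1
  have h1 : P ({ω | z t ω = 0} ∪ {ω | z t ω = 1}) = 1 := by
    rw [measure_union hd m1, h.bern_zero, h.bern_one, ← ENNReal.ofReal_add (by linarith) hq0]
    simp
  have := (mem_ae_iff_prob_eq_one (m0.union m1)).2 h1
  filter_upwards [this] with ω hω using hω

lemma bern_integral [IsProbabilityMeasure P] (h : IsContaminatedAR P β ν F q Q ε v z ξ)
    (hq0 : 0 ≤ q) (hq1 : q ≤ 1) (t : ℤ) : ∫ ω, z t ω ∂P = q := by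
  have m1 : MeasurableSet {ω | z t ω = 1} := h.bern_measurable t (measurableSet_singleton 1)
  have h1 : z t =ᵐ[P] {ω | z t ω = 1}.indicator (fun _ => (1 : ℝ)) := by
    filter_upwards [h.bern_zero_one hq0 hq1 t] with ω hω
    rcases hω with h0 | h0 <;> simp [Set.indicator, h0]
  rw [integral_congr_ae h1, integral_indicator_const _ m1, Measure.real, h.bern_one,
    ENNReal.toReal_ofReal hq0]
  simp

lemma map_innov [IsProbabilityMeasure P] (h : IsContaminatedAR P β ν F q Q ε v z ξ)
    (L : Measure ℝ) [IsProbabilityMeasure L] (hL : ∀ x, cdf L x = F x) (t : ℤ) :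
    P.map (ε t) = L := by
  have := Measure.isProbabilityMeasure_map (μ := P) (h.innov_measurable t).aemeasurable
  apply Measure.eq_of_cdf
  ext x
  rw [h.innov_cdf, hL]

lemma measurable_seq (h : IsContaminatedAR P β ν F q Q ε v z ξ) :
    Measurable (fun ω t => v t ω) ∧ Measurable (fun ω t => z t ω) ∧
      Measurable (fun ω t => ξ t ω) :=
  ⟨measurable_pi_lambda _ h.solution.measurable, measurable_pi_lambda _ h.bern_measurable,
    measurable_pi_lambda _ h.outlier_measurable⟩

lemma indepFun_solution (h : IsContaminatedAR P β ν F q Q ε v z ξ) :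
    IndepFun (fun ω t => v t ω) (fun ω => ((fun t => z t ω), (fun t => ξ t ω))) P := by
  obtain ⟨hv, hz, hξ⟩ := h.measurable_seq
  have hm : ∀ i : Fin 3, Measurable ((![fun ω t => v t ω, fun ω t => z t ω, fun ω t => ξ t ω] :
      Fin 3 → Ω → ℤ → ℝ) i) := by
    intro i
    fin_cases i
    · exact hv
    · exact hz
    · exact hξ
  have := h.sequences_indep.indepFun_prodMk hm 1 2 0 (by decide) (by decide)
  exact this.symm

lemma indepFun_bern_outlier (h : IsContaminatedAR P β ν F q Q ε v z ξ) :
    IndepFun (fun ω t => z t ω) (fun ω t => ξ t ω) P :=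
  h.sequences_indep.indepFun (show (1 : Fin 3) ≠ 2 by decide)

/-- The model postulates independence of v, z, ξ only; the equation recovers ε almost surely as a
measurable function of v. -/
lemma indepFun_innov (h : IsContaminatedAR P β ν F q Q ε v z ξ) :
    IndepFun (fun ω t => ε t ω) (fun ω => ((fun t => z t ω), (fun t => ξ t ω))) P := by
  have hΦ : Measurable fun (w : ℤ → ℝ) (t : ℤ) =>
      w t - ∑ j : Fin p, β j * w (t - ((j : ℕ) + 1)) - ν := by
    refine measurable_pi_lambda _ fun t => ?_
    have h1 : ∀ s : ℤ, Measurable fun w : ℤ → ℝ => w s := fun s => measurable_pi_apply s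
    exact ((h1 t).sub (Finset.measurable_sum _ fun j _ => (h1 _).const_mul _)).sub_const _
  refine (h.indepFun_solution.comp hΦ measurable_id).congr ?_ (ae_eq_refl _)
  filter_upwards [ae_all_iff.2 h.solution.equation] with ω hω
  funext t
  change v t ω - ∑ j : Fin p, β j * v (t - ((j : ℕ) + 1)) ω - ν = ε t ω
  rw [hω t]
  ring

lemma map_solution (h : IsContaminatedAR P β ν F q Q ε v z ξ) (t : ℤ) :
    P.map (v t) = P.map (v 0) := by
  have h1 := congrArg (fun m => m.map fun w : ℤ → ℝ => w 0) (h.solution.stationary t)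
  beta_reduce at h1
  rw [Measure.map_map (measurable_pi_apply _) (measurable_pi_lambda _ fun s =>
    h.solution.measurable _), Measure.map_map (measurable_pi_apply _) (measurable_pi_lambda _
    fun s => h.solution.measurable _)] at h1
  have h2 : (fun w : ℤ → ℝ => w 0) ∘ (fun ω (s : ℤ) => v (s + t) ω) = v t := by
    funext ω; simp
  have h3 : (fun w : ℤ → ℝ => w 0) ∘ (fun ω (s : ℤ) => v s ω) = v 0 := by
    funext ω; simp
  rwa [h2, h3] at h1

/-- The model satisfies the regularity properties, with a bound on the second moments that depends
on the coefficients and on the second moment of the innovations only. -/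
lemma exists_isRegularModel [IsProbabilityMeasure P] (h : IsContaminatedAR P β ν F q Q ε v z ξ)
    (hq0 : 0 ≤ q) (hq1 : q ≤ 1) {μ : ℝ} (hμ : ν = (1 - ∑ j, β j) * μ) {ψ ρ : ℕ → ℝ}
    (hψs : Summable fun i => |ψ i|) (hρ : Tendsto ρ atTop (𝓝 0))
    (hψ : ∀ u e : ℤ → ℝ, (∀ t, u t = ∑ j : Fin p, β j * u (t - ((j : ℕ) + 1)) + e t) →
      ∀ t : ℤ, ∀ k : ℕ, 1 ≤ k →
        |u t - ∑ i ∈ Finset.range k, ψ i * e (t - i)| ≤ ρ k * ∑ j : Fin p, |u (t - k - (j : ℕ))|)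
    (L : Measure ℝ) [IsProbabilityMeasure L] (hL : ∀ x, cdf L x = F x) {σ : ℝ} (hσ0 : 0 ≤ σ)
    (hσ : eLpNorm (fun x : ℝ => x) 2 L ≤ ENNReal.ofReal σ) :
    ∃ (𝓕 : ℤ → MeasurableSpace Ω) (u : ℤ → Ω → ℝ),
      IsRegularModel P β L Q q ((∑' i, |ψ i|) * σ) 𝓕 ε u z ξ ∧
        ∀ᵐ ω ∂P, ∀ t, v t ω = u t ω + μ := by
  have hlaw := h.map_innov L hL
  -- Since ν = (1 - Σβ_j)μ, subtracting μ removes the intercept.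
  set u₀ : ℤ → Ω → ℝ := fun t ω => v t ω - μ with hu₀
  have hu₀m : ∀ t, Measurable (u₀ t) := fun t => (h.solution.measurable t).sub_const μ
  have hu₀law : ∀ t, P.map (u₀ t) = P.map (u₀ 0) := by
    intro t
    have h1 : ∀ s, P.map (u₀ s) = (P.map (v s)).map fun x => x - μ := fun s => by
      rw [Measure.map_map (measurable_id'.sub_const μ) (h.solution.measurable s)]
      rfl
    rw [h1, h1, h.map_solution]
  have hu₀eq : ∀ t, ∀ᵐ ω ∂P,
      u₀ t ω = ∑ j : Fin p, β j * u₀ (t - ((j : ℕ) + 1)) ω + ε t ω := by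
    intro t
    filter_upwards [h.solution.equation t] with ω hω
    simp only [hu₀]
    rw [hω, hμ]
    simp only [mul_sub, Finset.sum_sub_distrib, ← Finset.sum_mul]
    ring
  have hlim := tendstoInMeasure_movingAverage hρ hψ hu₀m hu₀law hu₀eq
  have hεnorm : ∀ t, eLpNorm (ε t) 2 P ≤ ENNReal.ofReal σ := by
    intro t
    rw [← hlaw t, eLpNorm_map_measure measurable_id'.aestronglyMeasurable
      (h.innov_measurable t).aemeasurable] at hσ
    exact hσ
  choose u hum hue using fun t => exists_measurable_modification (hlim t)
  have hall : ∀ᵐ ω ∂P, ∀ t, u t ω = u₀ t ω := ae_all_iff.2 hue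
  obtain ⟨hv, hz, hξ⟩ := h.measurable_seq
  have humeas : ∀ t, Measurable (u t) := fun t => hum t _ fun s _ => h.innov_measurable s
  -- The σ-algebra at time t is generated by the innovations strictly before t and by both outlier
  -- sequences at all times, future included; this is harmless because the outliers are independent
  -- of the innovations.
  set W : ∀ t : ℤ, Ω → ((Set.Iio t → ℝ) × ((ℤ → ℝ) × (ℤ → ℝ))) := fun t ω =>
    ((fun s : Set.Iio t => ε s ω), ((fun s => z s ω), (fun s => ξ s ω))) with hW
  have hpastm : ∀ t : ℤ, Measurable fun ω (s : Set.Iio t) => ε s ω := fun t =>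
    measurable_pi_iff.2 fun s => h.innov_measurable _
  have hWm : ∀ t, Measurable (W t) := fun t => (hpastm t).prodMk (hz.prodMk hξ)
  have hWind : ∀ t, IndepFun (ε t) (W t) P := by
    intro t
    refine indepFun_prodMk_of_indepFun (h.innov_measurable t) (hpastm t) (hz.prodMk hξ)
      (iIndepFun.indepFun_past h.innov_measurable h.innov_indep t) ?_
    have hΦ : Measurable fun w : ℤ → ℝ => (w t, fun s : Set.Iio t => w s) :=
      (measurable_pi_apply t).prodMk (measurable_pi_lambda _ fun s => measurable_pi_apply _)
    exact h.indepFun_innov.comp hΦ measurable_id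
  have hεpast : ∀ s t, s < t → Measurable[MeasurableSpace.comap (W t) inferInstance] (ε s) := by
    intro s t hst
    have hg : Measurable fun w : ((Set.Iio t → ℝ) × ((ℤ → ℝ) × (ℤ → ℝ))) => w.1 ⟨s, hst⟩ :=
      (measurable_pi_apply _).comp measurable_fst
    exact hg.comp (comap_measurable (W t))
  refine ⟨fun t => MeasurableSpace.comap (W t) inferInstance, u, ?_, ?_⟩
  swap
  · filter_upwards [hall] with ω hω t
    rw [hω t]
    simp [hu₀]
  have hz01 := ae_all_iff.2 fun t => h.bern_zero_one hq0 hq1 t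
  have hzq := fun t => h.bern_integral hq0 hq1 t
  have hξint : ∀ φ : ℝ → ℝ, Measurable φ → ∀ t, ∫ ω, φ (ξ t ω) ∂P = ∫ x, φ x ∂Q := by
    intro φ hφ t
    rw [← h.outlier_law t, integral_map (h.outlier_measurable t).aemeasurable
      hφ.aestronglyMeasurable]
  have hzz : ∀ s t, s ≠ t → ∫ ω, z s ω * z t ω ∂P = q ^ 2 := by
    intro s t hst
    have := (h.bern_indep.indepFun hst).integral_fun_mul_eq_mul_integral
      (h.bern_measurable s).aestronglyMeasurable (h.bern_measurable t).aestronglyMeasurable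
    rw [this, hzq, hzq, sq]
  exact
    { innov_meas := h.innov_measurable
      sol_meas := humeas
      bern_meas := h.bern_measurable
      outlier_meas := h.outlier_measurable
      filt_le := fun t => (hWm t).comap_le
      innov_past := hεpast
      sol_past := fun s t hst => hum s _ fun r hr => hεpast r t (by omega)
      bern_past := fun s t => by
        have hg : Measurable fun w : ((Set.Iio t → ℝ) × ((ℤ → ℝ) × (ℤ → ℝ))) => w.2.1 s :=
          (measurable_pi_apply _).comp (measurable_fst.comp measurable_snd)
        exact hg.comp (comap_measurable (W t))
      outlier_past := fun s t => by
        have hg : Measurable fun w : ((Set.Iio t → ℝ) × ((ℤ → ℝ) × (ℤ → ℝ))) => w.2.2 s :=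
          (measurable_pi_apply _).comp (measurable_snd.comp measurable_snd)
        exact hg.comp (comap_measurable (W t))
      innov_indep := fun t => (IndepFun_iff_Indep _ _ _).1 (hWind t)
      innov_law := hlaw
      innov_pair := fun s t hst => h.innov_indep.indepFun hst
      bern_zero_one := hz01
      sol_norm := fun t => by
        rw [eLpNorm_congr_ae (hue t)]
        exact eLpNorm_movingAverage_limit_le hψs h.innov_measurable hσ0 hεnorm (hlim t)
      equation := by
        filter_upwards [hall, ae_all_iff.2 hu₀eq] with ω h1 h2 t
        simp only [h1]
        exact h2 t
      bern_integral := hzq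
      bern_pair := hzz
      bern_abs_sol := fun s t => by
        have h1 : IndepFun (fun ω => z s ω) (fun ω => |u t ω|) P := by
          have h3 : Measurable fun w : ℤ → ℝ => |w t - μ| :=
            ((measurable_pi_apply (X := fun _ : ℤ => ℝ) t).sub_const μ).abs
          have h4 : Measurable fun w : (ℤ → ℝ) × (ℤ → ℝ) => w.1 s :=
            (measurable_pi_apply s).comp measurable_fst
          have h2 := h.indepFun_solution.symm.comp h4 h3
          refine h2.congr (ae_eq_refl _) ?_
          filter_upwards [hall] with ω hω
          simp [hω t, hu₀]
        rw [h1.integral_fun_mul_eq_mul_integral (h.bern_measurable s).aestronglyMeasurable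
          (humeas t).abs.aestronglyMeasurable, hzq]
      bern_outlier := fun φ hφ t => by
        have h1 : IndepFun (fun ω => z t ω) (fun ω => φ (ξ t ω)) P :=
          h.indepFun_bern_outlier.comp (φ := fun w : ℤ → ℝ => w t) (ψ := fun w : ℤ → ℝ => φ (w t))
            (measurable_pi_apply t) (hφ.comp (measurable_pi_apply t))
        rw [h1.integral_fun_mul_eq_mul_integral (h.bern_measurable t).aestronglyMeasurable
          (hφ.comp (h.outlier_measurable t)).aestronglyMeasurable, hzq, hξint φ hφ]
      bern_outlier_pair := fun φ hφ s t hst => by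
        have h1 : IndepFun (fun ω => z s ω * z t ω) (fun ω => φ (ξ s ω) * φ (ξ t ω)) P :=
          h.indepFun_bern_outlier.comp (φ := fun w : ℤ → ℝ => w s * w t)
            (ψ := fun w : ℤ → ℝ => φ (w s) * φ (w t))
            ((measurable_pi_apply s).mul (measurable_pi_apply t))
            ((hφ.comp (measurable_pi_apply s)).mul (hφ.comp (measurable_pi_apply t)))
        have h2 : IndepFun (fun ω => φ (ξ s ω)) (fun ω => φ (ξ t ω)) P :=
          (h.outlier_indep.indepFun hst).comp hφ hφ
        have hm := fun r => (hφ.comp (h.outlier_measurable r)).aestronglyMeasurable (μ := P)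
        calc ∫ ω, (z s ω * φ (ξ s ω)) * (z t ω * φ (ξ t ω)) ∂P
            = ∫ ω, (z s ω * z t ω) * (φ (ξ s ω) * φ (ξ t ω)) ∂P := by
              congr 1; funext ω; ring
          _ = (∫ ω, z s ω * z t ω ∂P) * ∫ ω, φ (ξ s ω) * φ (ξ t ω) ∂P :=
              h1.integral_fun_mul_eq_mul_integral
                ((h.bern_measurable s).mul (h.bern_measurable t)).aestronglyMeasurable
                ((hm s).mul (hm t))
          _ = q ^ 2 * ((∫ x, φ x ∂Q) * ∫ x, φ x ∂Q) := by
              rw [hzz s t hst, h2.integral_fun_mul_eq_mul_integral (hm s) (hm t), hξint φ hφ,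
                hξint φ hφ]
          _ = _ := by ring }

end IsContaminatedAR

end Regular

/-! ### First order expansion of a distribution function under contamination -/

section Smooth

/-- `F` is a distribution function, `C`-Lipschitz, with the first order expansion at `x` given by
the slope `g`. -/
structure HasExpansion (F : ℝ → ℝ) (C x g : ℝ) : Prop where
  nonneg : 0 ≤ C
  range : ∀ a b, |F a - F b| ≤ 1
  lip : ∀ a b, |F a - F b| ≤ C * |a - b|
  slope : |g| ≤ C
  expand : ∀ a, |F (x + a) - F x - g * a| ≤ C * a ^ 2

lemma abs_cdf_sub_le (Q : Measure ℝ) (a b : ℝ) : |cdf Q a - cdf Q b| ≤ 1 := by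
  rw [abs_le]
  constructor <;> linarith [cdf_nonneg Q a, cdf_nonneg Q b, cdf_le_one Q a, cdf_le_one Q b]

/-- The bound M on the second derivative gives the quadratic remainder. It also bounds the density:
the expansion with increment 1 and |F(x+1) - F(x)| ≤ 1 give |F'| ≤ M + 1. One constant serves all x.
-/
lemma IsSmoothCenteredLaw.exists_hasExpansion {Q : Measure ℝ} (h : IsSmoothCenteredLaw Q) :
    ∃ C : ℝ, ∀ x, HasExpansion (fun y => cdf Q y) C x (deriv (fun y => cdf Q y) x) := by
  obtain ⟨M, hM⟩ := h.bounded_second_deriv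
  set F : ℝ → ℝ := fun y => cdf Q y with hF
  have hM0 : 0 ≤ M := (abs_nonneg _).trans (hM 0)
  have hlip' : ∀ a b, |deriv F a - deriv F b| ≤ M * |a - b| := fun a b =>
    Convex.norm_image_sub_le_of_norm_deriv_le (s := Set.univ) (f := deriv F)
      (fun x _ => h.differentiable_density x) (fun x _ => hM x) convex_univ
      (Set.mem_univ b) (Set.mem_univ a)
  have hexp : ∀ x a, |F (x + a) - F x - deriv F x * a| ≤ M * a ^ 2 := by
    intro x a
    have hd : ∀ y, HasDerivAt (fun y => F y - deriv F x * y) (deriv F y - deriv F x * 1) y :=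
      fun y => (h.differentiable_cdf y).hasDerivAt.sub ((hasDerivAt_id y).const_mul _)
    have hb : ∀ y ∈ Metric.closedBall x |a|,
        ‖deriv (fun y => F y - deriv F x * y) y‖ ≤ M * |a| := by
      intro y hy
      rw [(hd y).deriv, mul_one, Real.norm_eq_abs]
      refine (hlip' y x).trans (mul_le_mul_of_nonneg_left ?_ hM0)
      simpa [Real.dist_eq] using hy
    have := Convex.norm_image_sub_le_of_norm_deriv_le (fun y _ => (hd y).differentiableAt) hb
      (convex_closedBall x |a|) (x := x) (y := x + a) (by simp) (by simp)
    rw [Real.norm_eq_abs, Real.norm_eq_abs] at this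
    calc |F (x + a) - F x - deriv F x * a|
        = |F (x + a) - deriv F x * (x + a) - (F x - deriv F x * x)| := by congr 1; ring
      _ ≤ M * |a| * |x + a - x| := this
      _ = M * a ^ 2 := by rw [add_sub_cancel_left, mul_assoc, ← sq, sq_abs]
  have hslope : ∀ x, |deriv F x| ≤ M + 1 := by
    intro x
    have h1 := hexp x 1
    have h2 := abs_cdf_sub_le Q (x + 1) x
    rw [mul_one, one_pow, mul_one] at h1
    have h3 : deriv F x = (F (x + 1) - F x) - (F (x + 1) - F x - deriv F x) := by ring
    rw [h3]
    refine (abs_sub _ _).trans ?_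
    linarith
  refine ⟨M + 1, fun x => ⟨by linarith, abs_cdf_sub_le Q, fun a b => ?_, hslope x, fun a => ?_⟩⟩
  · exact Convex.norm_image_sub_le_of_norm_deriv_le (s := Set.univ) (f := F)
      (fun x _ => h.differentiable_cdf x) (fun x _ => hslope x) convex_univ
      (Set.mem_univ b) (Set.mem_univ a)
  · exact (hexp x a).trans (mul_le_mul_of_nonneg_right (by linarith) (sq_nonneg a))

/-- Differentiate F(-x) = 1 - F(x). Evenness of the density is what later cancels the effect of
estimating the mean. -/
lemma deriv_neg_of_symmetric {Q : Measure ℝ} (hs : IsSymmetricCdf Q)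
    (hd : Differentiable ℝ fun y => cdf Q y) (x : ℝ) :
    deriv (fun y => cdf Q y) (-x) = deriv (fun y => cdf Q y) x := by
  have h1 : HasDerivAt (fun y => cdf Q (-y)) (deriv (fun y => cdf Q y) (-x) * (-1)) x :=
    ((hd (-x)).hasDerivAt).comp x (hasDerivAt_neg x)
  have h2 : HasDerivAt (fun y => 1 - cdf Q y) (-deriv (fun y => cdf Q y) x) x :=
    (hd x).hasDerivAt.const_sub 1
  have h3 : (fun y => cdf Q (-y)) = fun y => 1 - cdf Q y := funext hs
  rw [h3] at h1
  have := h1.unique h2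
  linarith

/-- The increment of `F` is, up to a remainder, the sum of the linear drift and of the effects of
the single outliers. -/
lemma HasExpansion.abs_increment_sub_le {ι : Type*} [Fintype ι] {F : ℝ → ℝ}
    {C x g : ℝ} (hF : HasExpansion F C x g) {z y b : ι → ℝ} (hz : ∀ i, z i = 0 ∨ z i = 1)
    {T a A R : ℝ} (hR : 0 ≤ R) (ha : |a| ≤ A)
    (hT : |T - ∑ i, b i * (z i * y i)| ≤ A + R * ∑ i, z i * |y i|) (hT0 : (∀ i, z i = 0) → T = a) :
    |F (x + T) - F x - g * a - ∑ i, z i * (F (x + b i * y i) - F x)| ≤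
      C * A ^ 2 + 2 * C * A * (∑ i, z i) + ∑ i, z i * min 1 (C * R * |y i|)
        + 2 * ((∑ i, z i) ^ 2 - ∑ i, z i) := by
  classical
  have hA : 0 ≤ A := (abs_nonneg _).trans ha
  have hC := hF.nonneg
  have hga : |g * a| ≤ C * A := by
    rw [abs_mul]; exact mul_le_mul hF.slope ha (abs_nonneg _) hC
  obtain ⟨S, hS⟩ : ∃ S : Finset ι, ∀ i, z i = if i ∈ S then 1 else 0 := by
    refine ⟨Finset.univ.filter fun i => z i = 1, fun i => ?_⟩
    rcases hz i with h | h <;> simp [h]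
  have hsum : ∀ f : ι → ℝ, ∑ i, z i * f i = ∑ i ∈ S, f i := by
    intro f
    simp [hS]
  have hN : ∑ i, z i = (S.card : ℝ) := by
    simpa using hsum fun _ => 1
  have hmin0 : ∀ i, 0 ≤ min 1 (C * R * |y i|) := fun i =>
    le_min zero_le_one (mul_nonneg (mul_nonneg hC hR) (abs_nonneg _))
  have hcomm : ∑ i, b i * (z i * y i) = ∑ i ∈ S, b i * y i := by
    rw [← hsum]; exact Finset.sum_congr rfl fun i _ => by ring
  rw [hcomm] at hT
  rw [hsum] at hT ⊢
  rw [hsum, hN]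
  -- S is the set of outliers present, N its size. N = 0: Taylor expansion at T = a. N = 1: T is
  -- within A + R|y_i| of b_i y_i, so use the Lipschitz bound, or the bound 1 when C R|y_i| ≥ 1. N ≥
  -- 2: trivial bounds give 1 + CA + N, which 2CA·N + 2(N² - N) dominates.
  rcases Nat.lt_or_ge S.card 2 with hlt | hge
  · interval_cases hc : S.card
    · rw [Finset.card_eq_zero] at hc
      have h0 : T = a := hT0 fun i => by simp [hS, hc]
      subst hc
      subst h0
      simp only [Finset.sum_empty, sub_zero, Nat.cast_zero]
      have h1 := hF.expand T
      have h2 : T ^ 2 ≤ A ^ 2 := by rw [← sq_abs T]; gcongr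
      have h3 := mul_le_mul_of_nonneg_left h2 hC
      linarith
    · obtain ⟨i, rfl⟩ := Finset.card_eq_one.1 hc
      simp only [Finset.sum_singleton] at hT ⊢
      have h1 : |F (x + T) - F (x + b i * y i)| ≤ C * A + min 1 (C * R * |y i|) := by
        rcases le_total 1 (C * R * |y i|) with h | h
        · rw [min_eq_left h]
          have := hF.range (x + T) (x + b i * y i)
          have := mul_nonneg hC hA
          linarith
        · rw [min_eq_right h]
          refine (hF.lip _ _).trans ?_
          rw [add_sub_add_left_eq_sub]
          refine (mul_le_mul_of_nonneg_left hT hC).trans (le_of_eq ?_)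
          ring
      have h2 : F (x + T) - F x - g * a - (F (x + b i * y i) - F x)
          = (F (x + T) - F (x + b i * y i)) - g * a := by ring
      rw [h2]
      refine (abs_sub _ _).trans ?_
      have h3 : 0 ≤ C * A ^ 2 := by positivity
      push_cast
      linarith
  · have hge' : (2 : ℝ) ≤ S.card := by exact_mod_cast hge
    have h1 : |∑ i ∈ S, (F (x + b i * y i) - F x)| ≤ S.card := by
      refine (Finset.abs_sum_le_sum_abs _ _).trans ?_
      refine (Finset.sum_le_card_nsmul S _ 1 fun i _ => hF.range _ _).trans ?_
      simp
    have h2 := hF.range (x + T) x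
    have h3 : 0 ≤ ∑ i ∈ S, min 1 (C * R * |y i|) := Finset.sum_nonneg fun i _ => hmin0 i
    have h4 : 0 ≤ C * A ^ 2 := by positivity
    have h5 : C * A ≤ 2 * C * A * S.card := by
      have := mul_nonneg hC hA
      nlinarith
    calc |F (x + T) - F x - g * a - ∑ i ∈ S, (F (x + b i * y i) - F x)|
        ≤ |F (x + T) - F x| + |g * a| + |∑ i ∈ S, (F (x + b i * y i) - F x)| := by
          refine (abs_sub _ _).trans ?_
          gcongr
          exact abs_sub _ _
      _ ≤ 1 + C * A + S.card := by gcongr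
      _ ≤ _ := by nlinarith

end Smooth

/-! ### Calculus of bounds in mean -/

section Mean

variable {Ω : Type*} [MeasurableSpace Ω] {P : Measure Ω}

/-- `X` is integrable and `E |X| ≤ b`. -/
def BoundedInMean (P : Measure Ω) (X : Ω → ℝ) (b : ℝ) : Prop :=
  Integrable X P ∧ ∫ ω, |X ω| ∂P ≤ b

namespace BoundedInMean

lemma congr {X Y : Ω → ℝ} {a : ℝ} (h : BoundedInMean P X a) (hXY : X =ᵐ[P] Y) :
    BoundedInMean P Y a := by
  refine ⟨h.1.congr hXY, le_trans (le_of_eq (integral_congr_ae ?_)) h.2⟩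
  filter_upwards [hXY] with ω hω
  rw [hω]

lemma mono {X : Ω → ℝ} {a b : ℝ} (h : BoundedInMean P X a) (hab : a ≤ b) : BoundedInMean P X b :=
  ⟨h.1, h.2.trans hab⟩

lemma add {X Y : Ω → ℝ} {a b : ℝ} (hX : BoundedInMean P X a) (hY : BoundedInMean P Y b) :
    BoundedInMean P (fun ω => X ω + Y ω) (a + b) := by
  refine ⟨hX.1.add hY.1, ?_⟩
  calc ∫ ω, |X ω + Y ω| ∂P ≤ ∫ ω, (|X ω| + |Y ω|) ∂P :=
        integral_mono (hX.1.add hY.1).abs (hX.1.abs.add hY.1.abs) fun ω => abs_add_le _ _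
    _ = ∫ ω, |X ω| ∂P + ∫ ω, |Y ω| ∂P := integral_add hX.1.abs hY.1.abs
    _ ≤ a + b := add_le_add hX.2 hY.2

lemma const_mul {X : Ω → ℝ} {a : ℝ} (hX : BoundedInMean P X a) (c : ℝ) :
    BoundedInMean P (fun ω => c * X ω) (|c| * a) := by
  refine ⟨hX.1.const_mul c, ?_⟩
  simp only [abs_mul]
  rw [integral_const_mul]
  exact mul_le_mul_of_nonneg_left hX.2 (abs_nonneg _)

lemma neg {X : Ω → ℝ} {a : ℝ} (hX : BoundedInMean P X a) :
    BoundedInMean P (fun ω => -X ω) a := by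
  refine ⟨hX.1.neg, ?_⟩
  simpa using hX.2

lemma abs {X : Ω → ℝ} {a : ℝ} (hX : BoundedInMean P X a) :
    BoundedInMean P (fun ω => |X ω|) a := by
  refine ⟨hX.1.abs, ?_⟩
  simpa using hX.2

lemma sum {ι : Type*} {s : Finset ι} {X : ι → Ω → ℝ} {a : ι → ℝ}
    (h : ∀ i ∈ s, BoundedInMean P (X i) (a i)) :
    BoundedInMean P (fun ω => ∑ i ∈ s, X i ω) (∑ i ∈ s, a i) := by
  classical
  induction s using Finset.induction_on with
  | empty => exact ⟨by simp, by simp⟩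
  | insert i s hi ih =>
    simp only [Finset.sum_insert hi]
    exact (h i (Finset.mem_insert_self _ _)).add
      (ih fun j hj => h j (Finset.mem_insert_of_mem hj))

lemma const [IsProbabilityMeasure P] (c : ℝ) : BoundedInMean P (fun _ => c) |c| :=
  ⟨integrable_const c, by simp⟩

lemma of_abs_le {X Y : Ω → ℝ} {a : ℝ} (hY : BoundedInMean P Y a) (hX : AEStronglyMeasurable X P)
    (h : ∀ᵐ ω ∂P, |X ω| ≤ Y ω) : BoundedInMean P X a := by
  refine ⟨hY.1.mono' hX h, le_trans ?_ hY.2⟩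
  refine integral_mono_ae (hY.1.mono' hX h).abs hY.1.abs ?_
  filter_upwards [h] with ω hω
  exact hω.trans (le_abs_self _)

lemma of_nonneg {X : Ω → ℝ} {a : ℝ} (hX : Integrable X P) (h0 : ∀ᵐ ω ∂P, 0 ≤ X ω)
    (h : ∫ ω, X ω ∂P ≤ a) : BoundedInMean P X a := by
  refine ⟨hX, le_trans (le_of_eq (integral_congr_ae ?_)) h⟩
  filter_upwards [h0] with ω hω
  exact abs_of_nonneg hω

/-- (E|X|)² ≤ E X² is nonnegativity of the variance of |X|. -/
lemma of_sq [IsProbabilityMeasure P] {X : Ω → ℝ} {a : ℝ} (hX : MemLp X 2 P)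
    (h : ∫ ω, X ω ^ 2 ∂P ≤ a) : BoundedInMean P X √a := by
  refine ⟨hX.integrable (by norm_num), ?_⟩
  apply Real.le_sqrt_of_sq_le
  refine le_trans ?_ h
  have h1 := variance_nonneg (fun ω => |X ω|) P
  rw [variance_eq_sub (X := fun ω => |X ω|) hX.abs] at h1
  simpa using h1

/-- Markov's inequality. -/
lemma measure_lt_le {X : Ω → ℝ} {a δ : ℝ} (hX : BoundedInMean P X a) (hδ : 0 < δ) :
    P {ω | δ < |X ω|} ≤ ENNReal.ofReal (a / δ) := by
  have h1 := mul_meas_ge_le_lintegral₀ (μ := P) (f := fun ω => ENNReal.ofReal |X ω|)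
    hX.1.abs.aestronglyMeasurable.aemeasurable.ennreal_ofReal (ENNReal.ofReal δ)
  rw [← ofReal_integral_eq_lintegral_ofReal hX.1.abs (Eventually.of_forall fun _ => abs_nonneg _)]
    at h1
  have h2 : P {ω | δ < |X ω|} ≤ P {ω | ENNReal.ofReal δ ≤ ENNReal.ofReal |X ω|} := by
    refine measure_mono fun ω hω => ?_
    exact ENNReal.ofReal_le_ofReal (le_of_lt hω)
  rw [ENNReal.ofReal_div_of_pos hδ, ENNReal.le_div_iff_mul_le (by simp [hδ]) (by simp), mul_comm]
  exact (mul_le_mul_right h2 _).trans (h1.trans (ENNReal.ofReal_le_ofReal hX.2))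

end BoundedInMean

lemma memLp_sum_of_memLp {ι : Type*} {s : Finset ι} {f : ι → Ω → ℝ}
    (h : ∀ i ∈ s, MemLp (f i) 2 P) : MemLp (fun ω => ∑ i ∈ s, f i ω) 2 P :=
  memLp_finsetSum s h

lemma integral_sq_sum_le_of_orthogonal {ι : Type*} {s : Finset ι} {f : ι → Ω → ℝ} {b : ℝ}
    (hf : ∀ i ∈ s, MemLp (f i) 2 P)
    (ho : ∀ i ∈ s, ∀ j ∈ s, i ≠ j → ∫ ω, f i ω * f j ω ∂P = 0)
    (hb : ∀ i ∈ s, ∫ ω, f i ω ^ 2 ∂P ≤ b) :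
    ∫ ω, (∑ i ∈ s, f i ω) ^ 2 ∂P ≤ s.card * b := by
  classical
  have hint : ∀ i ∈ s, ∀ j ∈ s, Integrable (fun ω => f i ω * f j ω) P := fun i hi j hj =>
    (hf i hi).integrable_mul (hf j hj)
  calc ∫ ω, (∑ i ∈ s, f i ω) ^ 2 ∂P = ∫ ω, ∑ i ∈ s, ∑ j ∈ s, f i ω * f j ω ∂P := by
        congr 1; funext ω; rw [sq, Finset.sum_mul_sum]
    _ = ∑ i ∈ s, ∑ j ∈ s, ∫ ω, f i ω * f j ω ∂P := by
        rw [integral_finsetSum _ fun i hi => integrable_finsetSum _ fun j hj => hint i hi j hj]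
        exact Finset.sum_congr rfl fun i hi => integral_finsetSum _ fun j hj => hint i hi j hj
    _ = ∑ i ∈ s, ∫ ω, f i ω ^ 2 ∂P := by
        refine Finset.sum_congr rfl fun i hi => ?_
        rw [Finset.sum_eq_single i (fun j hj hne => ho i hi j hj hne.symm) (fun h => absurd hi h)]
        simp only [sq]
    _ ≤ s.card * b := by
        rw [← nsmul_eq_mul]
        exact Finset.sum_le_card_nsmul _ _ _ hb

lemma integral_sq_le_of_eLpNorm_le {X : Ω → ℝ} {κ : ℝ} (hκ : 0 ≤ κ) (hX : AEStronglyMeasurable X P)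
    (h : eLpNorm X 2 P ≤ ENNReal.ofReal κ) : MemLp X 2 P ∧ ∫ ω, X ω ^ 2 ∂P ≤ κ ^ 2 := by
  have hm : MemLp X 2 P := ⟨hX, h.trans_lt ENNReal.ofReal_lt_top⟩
  refine ⟨hm, ?_⟩
  rw [hm.eLpNorm_eq_integral_rpow_norm (by norm_num) (by norm_num),
    ENNReal.ofReal_le_ofReal_iff hκ] at h
  simp only [ENNReal.toReal_ofNat, Real.rpow_ofNat, Real.norm_eq_abs, sq_abs] at h
  have h0 : 0 ≤ ∫ ω, X ω ^ 2 ∂P := integral_nonneg fun _ => sq_nonneg _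
  have h1 := pow_le_pow_left₀ (Real.rpow_nonneg h0 _) h 2
  rw [← Real.rpow_natCast, ← Real.rpow_mul h0] at h1
  norm_num at h1
  exact h1

/-- Integrating out an innovation that is independent of the threshold. -/
lemma integral_mul_indicator_of_indep {Ω : Type*} {m m₀ : MeasurableSpace Ω} {P : Measure Ω}
    [IsProbabilityMeasure P]
    {X T M : Ω → ℝ} {L : Measure ℝ} [IsProbabilityMeasure L] (hX : Measurable X)
    (hL : P.map X = L) (hm : m ≤ m₀)
    (hi : Indep (MeasurableSpace.comap X inferInstance) m P) (hT : Measurable[m] T)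
    (hM : Measurable[m] M) {c : ℝ} (hMb : ∀ ω, |M ω| ≤ c) :
    ∫ ω, M ω * (Set.Iic (T ω)).indicator (fun _ => (1 : ℝ)) (X ω) ∂P
      = ∫ ω, M ω * cdf L (T ω) ∂P := by
  have hT' : Measurable T := hT.mono hm le_rfl
  have hM' : Measurable M := hM.mono hm le_rfl
  have hY : Measurable[m] fun ω => (T ω, M ω) := hT.prodMk hM
  have hY' : Measurable fun ω => (T ω, M ω) := hT'.prodMk hM'
  have hind : IndepFun X (fun ω => (T ω, M ω)) P := by
    rw [IndepFun_iff_Indep]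
    exact indep_of_indep_of_le_right hi hY.comap_le
  rw [indepFun_iff_map_prod_eq_prod_map_map hX.aemeasurable hY'.aemeasurable, hL] at hind
  have := Measure.isProbabilityMeasure_map (μ := P) hY'.aemeasurable
  set N := P.map fun ω => (T ω, M ω) with hN
  have hS : MeasurableSet {w : ℝ × (ℝ × ℝ) | w.1 ≤ w.2.1} :=
    measurableSet_le measurable_fst (measurable_fst.comp measurable_snd)
  set f : ℝ × (ℝ × ℝ) → ℝ := fun w => w.2.2 * (Set.Iic w.2.1).indicator (fun _ => (1 : ℝ)) w.1
    with hf
  have hind1 : ∀ w : ℝ × (ℝ × ℝ), (Set.Iic w.2.1).indicator (fun _ => (1 : ℝ)) w.1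
      = {w : ℝ × (ℝ × ℝ) | w.1 ≤ w.2.1}.indicator (fun _ => (1 : ℝ)) w := fun w => by
    simp [Set.indicator]
  have hfm : Measurable f := by
    simp only [hf, hind1]
    exact (measurable_snd.comp measurable_snd).mul (measurable_const.indicator hS)
  have hfi : Integrable f (L.prod N) := by
    rw [← hind]
    refine (integrable_map_measure hfm.aestronglyMeasurable
      (hX.prodMk hY').aemeasurable).2 ?_
    refine Integrable.of_bound (hfm.comp (hX.prodMk hY')).aestronglyMeasurable c
      (Eventually.of_forall fun ω => ?_)
    have h0 : (0 : ℝ) ≤ c := (abs_nonneg _).trans (hMb ω)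
    by_cases h : X ω ≤ T ω
    · simpa [hf, h] using hMb ω
    · simp [hf, h, h0]
  calc ∫ ω, M ω * (Set.Iic (T ω)).indicator (fun _ => (1 : ℝ)) (X ω) ∂P
      = ∫ w, f w ∂(P.map fun ω => (X ω, (T ω, M ω))) :=
        (integral_map (hX.prodMk hY').aemeasurable hfm.aestronglyMeasurable).symm
    -- Fubini with the innovation innermost: for a fixed threshold the inner integral is the value
    -- of the distribution function there.
    _ = ∫ y, ∫ e, f (e, y) ∂L ∂N := by rw [hind, integral_prod_symm f hfi]
    _ = ∫ y : ℝ × ℝ, y.2 * cdf L y.1 ∂N := by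
        congr 1
        funext y
        simp only [hf]
        rw [integral_const_mul, integral_indicator_const _ measurableSet_Iic, cdf_eq_real]
        simp
    _ = ∫ ω, M ω * cdf L (T ω) ∂P := by
        rw [hN, integral_map hY'.aemeasurable]
        exact (measurable_snd.mul
          ((monotone_cdf L).measurable.comp measurable_fst)).aestronglyMeasurable

end Mean

/-! ### Random thresholds and their pathwise bounds -/

section Thresholds

variable {p : ℕ}

/-- The total effect of the outliers `w` on the residual at time `t`, with the sign reversed. -/
def contamination (β : Fin p → ℝ) (w : ℤ → ℝ) (t : ℤ) : ℝ :=
  ∑ i : Fin (p + 1), Matrix.vecCons (-1) β i * w (t - (i : ℕ))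

/-- `1 + |y_{t-1}| + ⋯ + |y_{t-p}|`. -/
def lagAbs (p : ℕ) (y : ℤ → ℝ) (t : ℤ) : ℝ := 1 + ∑ j : Fin p, |y (t - ((j : ℕ) + 1))|

/-- The effect of an estimation error `ϑ`, widened by the multiple `s` of the size of the
regressors. -/
def perturbation (ϑ : ℝ × (Fin p → ℝ)) (s : ℝ) (y : ℤ → ℝ) (t : ℤ) : ℝ :=
  ϑ.1 + ∑ j : Fin p, ϑ.2 j * y (t - ((j : ℕ) + 1)) + s * lagAbs p y t

/-- The shift of the threshold for the innovation at time `t`. -/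
def threshold (β : Fin p → ℝ) (ϑ : ℝ × (Fin p → ℝ)) (s r : ℝ) (u w : ℤ → ℝ) (t : ℤ) : ℝ :=
  contamination β w t + r * perturbation ϑ s (fun t => u t + w t) t

/-- The increment of the indicator of `e ≤ ·` from `x` to `x + a`. -/
def stepIncrement (x a e : ℝ) : ℝ :=
  (Set.Iic (x + a)).indicator (fun _ => (1 : ℝ)) e - (Set.Iic x).indicator (fun _ => (1 : ℝ)) e

lemma one_le_lagAbs (y : ℤ → ℝ) (t : ℤ) : 1 ≤ lagAbs p y t :=
  le_add_of_nonneg_right (Finset.sum_nonneg fun _ _ => abs_nonneg _)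

lemma abs_perturbation_le (ϑ : ℝ × (Fin p → ℝ)) (s : ℝ) (y : ℤ → ℝ) (t : ℤ) :
    |perturbation ϑ s y t| ≤ (‖ϑ‖ + |s|) * lagAbs p y t := by
  have h1 : |ϑ.1| ≤ ‖ϑ‖ := norm_fst_le ϑ
  have h2 : ∀ j, |ϑ.2 j| ≤ ‖ϑ‖ := fun j => (norm_le_pi_norm ϑ.2 j).trans (norm_snd_le ϑ)
  have h3 : |∑ j : Fin p, ϑ.2 j * y (t - ((j : ℕ) + 1))|
      ≤ ‖ϑ‖ * ∑ j : Fin p, |y (t - ((j : ℕ) + 1))| := by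
    refine (Finset.abs_sum_le_sum_abs _ _).trans ?_
    rw [Finset.mul_sum]
    refine Finset.sum_le_sum fun j _ => ?_
    rw [abs_mul]
    exact mul_le_mul_of_nonneg_right (h2 j) (abs_nonneg _)
  have h4 : |s * lagAbs p y t| = |s| * lagAbs p y t := by
    rw [abs_mul, abs_of_nonneg (zero_le_one.trans (one_le_lagAbs y t))]
  calc |perturbation ϑ s y t|
      ≤ |ϑ.1| + |∑ j : Fin p, ϑ.2 j * y (t - ((j : ℕ) + 1))| + |s * lagAbs p y t| :=
        abs_add_three _ _ _
    _ ≤ ‖ϑ‖ + ‖ϑ‖ * ∑ j : Fin p, |y (t - ((j : ℕ) + 1))| + |s| * lagAbs p y t := by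
        rw [h4]; gcongr
    _ = _ := by rw [lagAbs]; ring

/-- The sum on the right includes the superfluous index 0 so that it runs over the same p + 1 lags
as `contamination`. -/
lemma lagAbs_add_le (u w : ℤ → ℝ) (t : ℤ) :
    lagAbs p (fun t => u t + w t) t ≤ lagAbs p u t + ∑ i : Fin (p + 1), |w (t - (i : ℕ))| := by
  rw [lagAbs, lagAbs, Fin.sum_univ_succ]
  have h1 : ∑ j : Fin p, |u (t - ((j : ℕ) + 1)) + w (t - ((j : ℕ) + 1))|
      ≤ ∑ j : Fin p, |u (t - ((j : ℕ) + 1))| + ∑ j : Fin p, |w (t - ((j : ℕ) + 1))| := by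
    rw [← Finset.sum_add_distrib]
    exact Finset.sum_le_sum fun j _ => abs_add_le _ _
  have h2 : ∑ j : Fin p, |w (t - ((j.succ : Fin (p + 1)) : ℕ))|
      = ∑ j : Fin p, |w (t - ((j : ℕ) + 1))| := by
    simp
  rw [h2]
  have := abs_nonneg (w (t - ((0 : Fin (p + 1)) : ℕ)))
  linarith

lemma threshold_of_no_outlier (β : Fin p → ℝ) (ϑ : ℝ × (Fin p → ℝ)) (s r : ℝ) (u w : ℤ → ℝ)
    (t : ℤ) (h : ∀ i : Fin (p + 1), w (t - (i : ℕ)) = 0) :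
    threshold β ϑ s r u w t = r * perturbation ϑ s u t := by
  have h1 : ∀ j : Fin p, w (t - ((j : ℕ) + 1)) = 0 := fun j => by simpa using h j.succ
  simp [threshold, contamination, perturbation, lagAbs, h, h1]

/-- The pathwise expansion of the drift. -/
lemma abs_drift_sub_le {F : ℝ → ℝ} {C x g : ℝ} (hF : HasExpansion F C x g) (β : Fin p → ℝ)
    (ϑ : ℝ × (Fin p → ℝ)) (s : ℝ) {r : ℝ} (hr : 0 ≤ r) (u z ξ : ℤ → ℝ)
    (hz : ∀ t, z t = 0 ∨ z t = 1) (t : ℤ) :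
    |F (x + threshold β ϑ s r u (fun t => z t * ξ t) t) - F x - g * (r * perturbation ϑ s u t)
        - ∑ i : Fin (p + 1), z (t - (i : ℕ)) *
            (F (x + Matrix.vecCons (-1) β i * ξ (t - (i : ℕ))) - F x)| ≤
      C * (r * ((‖ϑ‖ + |s|) * lagAbs p u t)) ^ 2
        + 2 * C * (r * ((‖ϑ‖ + |s|) * lagAbs p u t)) * (∑ i : Fin (p + 1), z (t - (i : ℕ)))
        + ∑ i : Fin (p + 1), z (t - (i : ℕ)) *
            min 1 (C * (r * (‖ϑ‖ + |s|)) * |ξ (t - (i : ℕ))|)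
        + 2 * ((∑ i : Fin (p + 1), z (t - (i : ℕ))) ^ 2 - ∑ i : Fin (p + 1), z (t - (i : ℕ))) := by
  have hK : 0 ≤ ‖ϑ‖ + |s| := by positivity
  -- The abstract bound is applied with a the drift computed from the clean process u, R = r(‖ϑ‖ +
  -- |s|) and A = R · `lagAbs p u t`.
  refine hF.abs_increment_sub_le (fun i => hz _) (mul_nonneg hr hK) ?_ ?_ ?_
  · rw [abs_mul, abs_of_nonneg hr]
    exact mul_le_mul_of_nonneg_left (abs_perturbation_le ϑ s u t) hr
  · rw [threshold, contamination, add_sub_cancel_left, abs_mul, abs_of_nonneg hr]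
    have h1 := (abs_perturbation_le ϑ s (fun t => u t + z t * ξ t) t).trans
      (mul_le_mul_of_nonneg_left (lagAbs_add_le u (fun t => z t * ξ t) t) hK)
    refine (mul_le_mul_of_nonneg_left h1 hr).trans (le_of_eq ?_)
    have h2 : ∑ i : Fin (p + 1), |z (t - (i : ℕ)) * ξ (t - (i : ℕ))|
        = ∑ i : Fin (p + 1), z (t - (i : ℕ)) * |ξ (t - (i : ℕ))| := by
      refine Finset.sum_congr rfl fun i _ => ?_
      rw [abs_mul]
      rcases hz (t - (i : ℕ)) with h | h <;> simp [h]
    rw [h2]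
    ring
  · intro h
    exact threshold_of_no_outlier β ϑ s r u _ t fun i => by simp [h i]

/-- Without outliers this is the Lipschitz bound; with at least one, the number of outliers is at
least 1 and dominates any increment of a distribution function. -/
lemma abs_increment_threshold_le {F : ℝ → ℝ} {C x g : ℝ} (hF : HasExpansion F C x g)
    (β : Fin p → ℝ) (ϑ : ℝ × (Fin p → ℝ)) (s : ℝ) {r : ℝ} (hr : 0 ≤ r) (u z ξ : ℤ → ℝ)
    (hz : ∀ t, z t = 0 ∨ z t = 1) (t : ℤ) :
    |F (x + threshold β ϑ s r u (fun t => z t * ξ t) t) - F x| ≤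
      C * (r * ((‖ϑ‖ + |s|) * lagAbs p u t)) + ∑ i : Fin (p + 1), z (t - (i : ℕ)) := by
  have hz0 : ∀ t, 0 ≤ z t := fun t => by rcases hz t with h | h <;> simp [h]
  have hl := zero_le_one.trans (one_le_lagAbs (p := p) u t)
  have hC := hF.nonneg
  by_cases h : ∀ i : Fin (p + 1), z (t - (i : ℕ)) = 0
  · rw [threshold_of_no_outlier β ϑ s r u _ t fun i => by simp [h i]]
    refine (hF.lip _ _).trans ?_
    rw [add_sub_cancel_left, abs_mul, abs_of_nonneg hr]
    have := mul_le_mul_of_nonneg_left (mul_le_mul_of_nonneg_left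
      (abs_perturbation_le ϑ s u t) hr) hC
    simpa [h] using this
  · push Not at h
    obtain ⟨i, hi⟩ := h
    have h1 : z (t - (i : ℕ)) = 1 := (hz _).resolve_left hi
    have h2 : 1 ≤ ∑ i : Fin (p + 1), z (t - (i : ℕ)) := by
      rw [← h1]
      exact Finset.single_le_sum (f := fun i : Fin (p + 1) => z (t - (i : ℕ)))
        (fun _ _ => hz0 _) (Finset.mem_univ i)
    have h3 : 0 ≤ C * (r * ((‖ϑ‖ + |s|) * lagAbs p u t)) := by positivity
    linarith [hF.range (x + threshold β ϑ s r u (fun t => z t * ξ t) t) x]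

end Thresholds

/-! ### Moments of the terms in the pathwise bounds -/

section Moments

variable {Ω : Type*} [MeasurableSpace Ω] {P : Measure Ω}

namespace IsRegularModel

variable {p : ℕ} {β : Fin p → ℝ} {L Q : Measure ℝ} {q κ : ℝ}
  {𝓕 : ℤ → MeasurableSpace Ω} {ε u z ξ : ℤ → Ω → ℝ}

lemma memLp_sol (h : IsRegularModel P β L Q q κ 𝓕 ε u z ξ) (hκ : 0 ≤ κ) (t : ℤ) :
    MemLp (u t) 2 P ∧ ∫ ω, u t ω ^ 2 ∂P ≤ κ ^ 2 :=
  integral_sq_le_of_eLpNorm_le hκ (h.sol_meas t).aestronglyMeasurable (h.sol_norm t)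

lemma bounded_sol [IsProbabilityMeasure P] (h : IsRegularModel P β L Q q κ 𝓕 ε u z ξ)
    (hκ : 0 ≤ κ) (t : ℤ) : BoundedInMean P (u t) κ := by
  have := BoundedInMean.of_sq (h.memLp_sol hκ t).1 (h.memLp_sol hκ t).2
  rwa [Real.sqrt_sq hκ] at this

lemma bounded_lagAbs [IsProbabilityMeasure P] (h : IsRegularModel P β L Q q κ 𝓕 ε u z ξ)
    (hκ : 0 ≤ κ) (t : ℤ) : BoundedInMean P (fun ω => lagAbs p (fun t => u t ω) t) (1 + p * κ) := by
  have h1 := (BoundedInMean.const (P := P) 1).add (BoundedInMean.sum (s := Finset.univ)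
    fun (j : Fin p) _ => (h.bounded_sol hκ (t - ((j : ℕ) + 1))).abs)
  simpa [lagAbs] using h1

lemma memLp_lagAbs [IsProbabilityMeasure P] (h : IsRegularModel P β L Q q κ 𝓕 ε u z ξ)
    (hκ : 0 ≤ κ) (t : ℤ) : MemLp (fun ω => lagAbs p (fun t => u t ω) t) 2 P := by
  have h1 : MemLp (fun ω => ∑ j : Fin p, |u (t - ((j : ℕ) + 1)) ω|) 2 P :=
    memLp_sum_of_memLp fun j _ => (h.memLp_sol hκ (t - ((j : ℕ) + 1))).1.abs
  exact (memLp_const (μ := P) (p := 2) (1 : ℝ)).add h1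

/-- The constant comes from (1 + S)² ≤ 2 + 2S² and, by Cauchy–Schwarz, S² ≤ pΣu². -/
lemma bounded_sq_lagAbs [IsProbabilityMeasure P] (h : IsRegularModel P β L Q q κ 𝓕 ε u z ξ)
    (hκ : 0 ≤ κ) (t : ℤ) :
    BoundedInMean P (fun ω => lagAbs p (fun t => u t ω) t ^ 2) (2 + 2 * (p * (p * κ ^ 2))) := by
  have h1 : ∀ s : ℤ, BoundedInMean P (fun ω => u s ω ^ 2) (κ ^ 2) := fun s =>
    BoundedInMean.of_nonneg (h.memLp_sol hκ s).1.integrable_sq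
      (Eventually.of_forall fun _ => sq_nonneg _) (h.memLp_sol hκ s).2
  have h2 := (BoundedInMean.const (P := P) 2).add (((BoundedInMean.sum (s := Finset.univ)
    fun (j : Fin p) _ => h1 (t - ((j : ℕ) + 1))).const_mul p).const_mul 2)
  simp only [Finset.sum_const, Finset.card_univ, Fintype.card_fin, nsmul_eq_mul, Nat.abs_ofNat,
    Nat.abs_cast] at h2
  have h4 : AEStronglyMeasurable (fun ω => lagAbs p (fun t => u t ω) t ^ 2) P :=
    (h.memLp_lagAbs hκ t).1.pow 2
  refine h2.of_abs_le h4 (Eventually.of_forall fun ω => ?_)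
  rw [abs_of_nonneg (sq_nonneg _), lagAbs]
  have h3 := sq_sum_le_card_mul_sum_sq (s := (Finset.univ : Finset (Fin p)))
    (f := fun j : Fin p => |u (t - ((j : ℕ) + 1)) ω|)
  simp only [sq_abs, Finset.card_univ, Fintype.card_fin] at h3
  nlinarith [sq_nonneg (1 - ∑ j : Fin p, |u (t - ((j : ℕ) + 1)) ω|)]

lemma bern_abs_le (h : IsRegularModel P β L Q q κ 𝓕 ε u z ξ) :
    ∀ᵐ ω ∂P, ∀ t, 0 ≤ z t ω ∧ |z t ω| ≤ 1 := by
  filter_upwards [h.bern_zero_one] with ω hω t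
  rcases hω t with h | h <;> simp [h]

lemma bounded_bern [IsProbabilityMeasure P] (h : IsRegularModel P β L Q q κ 𝓕 ε u z ξ) (t : ℤ) :
    BoundedInMean P (z t) q := by
  refine BoundedInMean.of_nonneg (Integrable.of_bound (h.bern_meas t).aestronglyMeasurable 1 ?_)
    ?_ (h.bern_integral t).le
  · filter_upwards [h.bern_abs_le] with ω hω using (hω t).2
  · filter_upwards [h.bern_abs_le] with ω hω using (hω t).1

lemma integrable_bern_mul (h : IsRegularModel P β L Q q κ 𝓕 ε u z ξ) (t : ℤ) {X : Ω → ℝ}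
    (hX : Integrable X P) : Integrable (fun ω => z t ω * X ω) P :=
  hX.bdd_mul (c := 1) (h.bern_meas t).aestronglyMeasurable (by
    filter_upwards [h.bern_abs_le] with ω hω using (hω t).2)

/-- Outlier indicators are independent of the clean process, even at equal times, so the product
gains a full factor q, of order n^{-1/2}. -/
lemma bounded_bern_mul_lagAbs [IsProbabilityMeasure P]
    (h : IsRegularModel P β L Q q κ 𝓕 ε u z ξ) (hκ : 0 ≤ κ) (hq : 0 ≤ q) (t : ℤ) :
    BoundedInMean P (fun ω => lagAbs p (fun t => u t ω) t *
      ∑ i : Fin (p + 1), z (t - (i : ℕ)) ω) ((p + 1) * (q * (1 + p * κ))) := by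
  have h1 : ∀ s r : ℤ, BoundedInMean P (fun ω => z s ω * |u r ω|) (q * κ) := by
    intro s r
    refine BoundedInMean.of_nonneg (h.integrable_bern_mul s (h.bounded_sol hκ r).1.abs) ?_ ?_
    · filter_upwards [h.bern_abs_le] with ω hω using mul_nonneg (hω s).1 (abs_nonneg _)
    · rw [h.bern_abs_sol]
      exact mul_le_mul_of_nonneg_left (h.bounded_sol hκ r).2 hq
  have h2 := BoundedInMean.sum (s := Finset.univ) fun (i : Fin (p + 1)) _ =>
    (h.bounded_bern (t - (i : ℕ))).add (BoundedInMean.sum (s := Finset.univ)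
      fun (j : Fin p) _ => h1 (t - (i : ℕ)) (t - ((j : ℕ) + 1)))
  refine (h2.congr (Eventually.of_forall fun ω => ?_)).mono (le_of_eq ?_)
  · simp only [lagAbs]
    rw [Finset.mul_sum]
    refine Finset.sum_congr rfl fun i _ => ?_
    rw [← Finset.mul_sum]
    ring
  · simp only [Finset.sum_const, Finset.card_univ, Fintype.card_fin, nsmul_eq_mul]
    push_cast
    ring

/-- Because z² = z, the diagonal of the squared sum cancels and only pairs at distinct times remain,
each of mean q². The bound counts all (p+1)² index pairs for simplicity. -/
lemma bounded_bern_pairs [IsProbabilityMeasure P]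
    (h : IsRegularModel P β L Q q κ 𝓕 ε u z ξ) (t : ℤ) :
    BoundedInMean P (fun ω => (∑ i : Fin (p + 1), z (t - (i : ℕ)) ω) ^ 2
      - ∑ i : Fin (p + 1), z (t - (i : ℕ)) ω) ((p + 1) * ((p + 1) * q ^ 2)) := by
  have h1 : ∀ i j : Fin (p + 1), BoundedInMean P
      (fun ω => if i = j then 0 else z (t - (i : ℕ)) ω * z (t - (j : ℕ)) ω) (q ^ 2) := by
    intro i j
    by_cases hij : i = j
    · simp only [hij, if_true]
      exact ⟨by simp, by simpa using sq_nonneg q⟩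
    · simp only [hij, if_false]
      refine BoundedInMean.of_nonneg (h.integrable_bern_mul _ (h.bounded_bern _).1) ?_
        (h.bern_pair _ _ ?_).le
      · filter_upwards [h.bern_abs_le] with ω hω using mul_nonneg (hω _).1 (hω _).1
      · intro heq
        apply hij
        ext
        omega
  have h2 := BoundedInMean.sum (s := Finset.univ) fun (i : Fin (p + 1)) _ =>
    BoundedInMean.sum (s := Finset.univ) fun (j : Fin (p + 1)) _ => h1 i j
  refine (h2.congr ?_).mono (le_of_eq ?_)
  · filter_upwards [h.bern_zero_one] with ω hω
    rw [sq, Finset.sum_mul_sum, ← Finset.sum_sub_distrib]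
    refine Finset.sum_congr rfl fun i _ => ?_
    rw [← Finset.add_sum_erase _ _ (Finset.mem_univ i),
      ← Finset.add_sum_erase _ _ (Finset.mem_univ i)]
    have h3 : z (t - (i : ℕ)) ω * z (t - (i : ℕ)) ω = z (t - (i : ℕ)) ω := by
      rcases hω (t - (i : ℕ)) with h | h <;> simp [h]
    rw [h3, if_pos rfl, zero_add, add_sub_cancel_left]
    refine Finset.sum_congr rfl fun j hj => ?_
    rw [if_neg (Finset.ne_of_mem_erase hj).symm]
  · simp

/-- Truncation at 1 replaces any moment assumption on the outlier law. -/
lemma bounded_bern_min [IsProbabilityMeasure P]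
    (h : IsRegularModel P β L Q q κ 𝓕 ε u z ξ) {c : ℝ} (hc : 0 ≤ c) (t : ℤ) :
    BoundedInMean P (fun ω => ∑ i : Fin (p + 1), z (t - (i : ℕ)) ω *
      min 1 (c * |ξ (t - (i : ℕ)) ω|)) ((p + 1) * (q * ∫ x, min 1 (c * |x|) ∂Q)) := by
  have hm : Measurable fun x : ℝ => min 1 (c * |x|) := by fun_prop
  have h0 : ∀ x : ℝ, 0 ≤ min 1 (c * |x|) := fun x => le_min zero_le_one (by positivity)
  have h1 := BoundedInMean.sum (P := P) (s := Finset.univ) (X := fun (i : Fin (p + 1)) ω =>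
    z (t - (i : ℕ)) ω * min 1 (c * |ξ (t - (i : ℕ)) ω|))
    (a := fun _ => q * ∫ x, min 1 (c * |x|) ∂Q) fun i _ => by
    refine BoundedInMean.of_nonneg (h.integrable_bern_mul _ (Integrable.of_bound
      (hm.comp (h.outlier_meas _)).aestronglyMeasurable 1 (Eventually.of_forall fun ω => ?_))) ?_
      (h.bern_outlier _ hm _).le
    · rw [Real.norm_eq_abs, abs_of_nonneg (h0 _)]
      exact min_le_left _ _
    · filter_upwards [h.bern_abs_le] with ω hω using mul_nonneg (hω _).1 (h0 _)
  refine h1.mono (le_of_eq ?_)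
  simp

end IsRegularModel

end Moments

/-! ### Increments of indicators -/

section Steps

lemma abs_stepIncrement_le (x a e : ℝ) : |stepIncrement x a e| ≤ 1 := by
  unfold stepIncrement
  by_cases h1 : e ≤ x + a <;> by_cases h2 : e ≤ x <;> simp [Set.indicator, h1, h2]

/-- As a difference of two indicators with measurable thresholds, the absolute increment too can be
integrated over the innovation. -/
lemma abs_stepIncrement_eq (x a e : ℝ) : |stepIncrement x a e| =
    (Set.Iic (x + max a 0)).indicator (fun _ => (1 : ℝ)) e
      - (Set.Iic (x + min a 0)).indicator (fun _ => (1 : ℝ)) e := by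
  unfold stepIncrement
  rcases le_total a 0 with h | h
  · rw [max_eq_right h, min_eq_left h, add_zero, abs_sub_comm, abs_of_nonneg]
    by_cases h1 : e ≤ x + a
    · have h2 : e ≤ x := by linarith
      simp [Set.indicator, h1, h2]
    · by_cases h2 : e ≤ x <;> simp [Set.indicator, h1, h2]
  · rw [max_eq_left h, min_eq_right h, add_zero, abs_of_nonneg]
    by_cases h1 : e ≤ x
    · have h2 : e ≤ x + a := by linarith
      simp [Set.indicator, h1, h2]
    · by_cases h2 : e ≤ x + a <;> simp [Set.indicator, h1, h2]

lemma measurable_indicator_Iic {α : Type*} {m : MeasurableSpace α} {X T : α → ℝ}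
    (hX : Measurable X) (hT : Measurable T) :
    Measurable fun ω => (Set.Iic (T ω)).indicator (fun _ => (1 : ℝ)) (X ω) := by
  have h1 : (fun ω => (Set.Iic (T ω)).indicator (fun _ => (1 : ℝ)) (X ω))
      = {ω | X ω ≤ T ω}.indicator fun _ => (1 : ℝ) := by
    funext ω
    simp [Set.indicator]
  rw [h1]
  exact measurable_const.indicator (measurableSet_le hX hT)

lemma measurable_stepIncrement {α : Type*} {m : MeasurableSpace α} {X T : α → ℝ} (x : ℝ)
    (hX : Measurable X) (hT : Measurable T) : Measurable fun ω => stepIncrement x (T ω) (X ω) :=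
  (measurable_indicator_Iic hX (hT.const_add x)).sub (measurable_indicator_Iic hX measurable_const)

/-- Predictability: the process u enters only at times strictly before t, whereas the outliers also
enter at time t itself. -/
lemma measurable_threshold {α : Type*} {m : MeasurableSpace α} {p : ℕ} (β : Fin p → ℝ)
    (ϑ : ℝ × (Fin p → ℝ)) (s r : ℝ) {u w : ℤ → α → ℝ} (t : ℤ)
    (hu : ∀ t' < t, Measurable (u t')) (hw : ∀ t', Measurable (w t')) :
    Measurable fun ω => threshold β ϑ s r (fun t => u t ω) (fun t => w t ω) t := by
  have h1 : ∀ j : Fin p, Measurable fun ω =>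
      u (t - ((j : ℕ) + 1)) ω + w (t - ((j : ℕ) + 1)) ω := fun j =>
    (hu _ (by omega)).add (hw _)
  unfold threshold contamination perturbation lagAbs
  refine (Finset.measurable_sum _ fun i _ => (hw _).const_mul _).add (Measurable.const_mul ?_ _)
  refine ((measurable_const).add (Finset.measurable_sum _ fun j _ => (h1 j).const_mul _)).add
    (Measurable.const_mul ?_ _)
  exact measurable_const.add (Finset.measurable_sum _ fun j _ => (h1 j).abs)

end Steps

/-! ### Martingale part and fluctuation of the outlier effects -/

section Martingale

variable {Ω : Type*} [MeasurableSpace Ω] {P : Measure Ω}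

/-- The increment of the indicator at a random threshold, centred conditionally on the
threshold. -/
def centredStep (L : Measure ℝ) (x a e : ℝ) : ℝ :=
  stepIncrement x a e - (cdf L (x + a) - cdf L x)

lemma abs_centredStep_le (L : Measure ℝ) (x a e : ℝ) : |centredStep L x a e| ≤ 2 := by
  refine (abs_sub _ _).trans ?_
  linarith [abs_stepIncrement_le x a e, abs_cdf_sub_le L (x + a) x]

lemma measurable_centredStep {α : Type*} {m : MeasurableSpace α} {X T : α → ℝ} (L : Measure ℝ)
    (x : ℝ) (hX : Measurable X) (hT : Measurable T) :
    Measurable fun ω => centredStep L x (T ω) (X ω) :=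
  (measurable_stepIncrement x hX hT).sub
    (((monotone_cdf L).measurable.comp (hT.const_add x)).sub measurable_const)

lemma integral_mul_stepIncrement {Ω : Type*} {m m₀ : MeasurableSpace Ω} {P : Measure Ω}
    [IsProbabilityMeasure P] {X T T' M : Ω → ℝ} {L : Measure ℝ} [IsProbabilityMeasure L]
    (hX : Measurable X) (hL : P.map X = L) (hm : m ≤ m₀)
    (hi : Indep (MeasurableSpace.comap X inferInstance) m P) (hT : Measurable[m] T)
    (hT' : Measurable[m] T') (hM : Measurable[m] M) {c : ℝ} (hMb : ∀ ω, |M ω| ≤ c) :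
    ∫ ω, M ω * ((Set.Iic (T ω)).indicator (fun _ => (1 : ℝ)) (X ω)
        - (Set.Iic (T' ω)).indicator (fun _ => (1 : ℝ)) (X ω)) ∂P
      = ∫ ω, M ω * (cdf L (T ω) - cdf L (T' ω)) ∂P := by
  have hM0 : Measurable M := hM.mono hm le_rfl
  have hT0 : Measurable T := hT.mono hm le_rfl
  have hT0' : Measurable T' := hT'.mono hm le_rfl
  have hMi : Integrable M P := Integrable.of_bound hM0.aestronglyMeasurable c
    (Eventually.of_forall hMb)
  have h1 : ∀ S : Ω → ℝ, Measurable S →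
      Integrable (fun ω => M ω * (Set.Iic (S ω)).indicator (fun _ => (1 : ℝ)) (X ω)) P := by
    intro S hS
    refine hMi.mul_bdd (c := 1) (measurable_indicator_Iic hX hS).aestronglyMeasurable
      (Eventually.of_forall fun ω => ?_)
    by_cases h : X ω ≤ S ω <;> simp [Set.indicator, h]
  have h2 : ∀ S : Ω → ℝ, Measurable S → Integrable (fun ω => M ω * cdf L (S ω)) P := by
    intro S hS
    refine hMi.mul_bdd (c := 1) ((monotone_cdf L).measurable.comp hS).aestronglyMeasurable
      (Eventually.of_forall fun ω => ?_)
    rw [Real.norm_eq_abs, abs_of_nonneg (cdf_nonneg _ _)]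
    exact cdf_le_one _ _
  simp only [mul_sub]
  rw [integral_sub (h1 T hT0) (h1 T' hT0'), integral_sub (h2 T hT0) (h2 T' hT0'),
    integral_mul_indicator_of_indep hX hL hm hi hT hM hMb,
    integral_mul_indicator_of_indep hX hL hm hi hT' hM hMb]

namespace IsRegularModel

variable {p : ℕ} {β : Fin p → ℝ} {L Q : Measure ℝ} {q κ : ℝ}
  {𝓕 : ℤ → MeasurableSpace Ω} {ε u z ξ : ℤ → Ω → ℝ}

/-- The martingale difference property, tested against bounded past-measurable M: given the
threshold, the increment has conditional mean F(x + T) - F(x). -/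
lemma integral_mul_centredStep [IsProbabilityMeasure P] [IsProbabilityMeasure L]
    (h : IsRegularModel P β L Q q κ 𝓕 ε u z ξ) (x : ℝ) {t : ℤ} {T M : Ω → ℝ}
    (hT : Measurable[𝓕 t] T) (hM : Measurable[𝓕 t] M) {c : ℝ} (hMb : ∀ ω, |M ω| ≤ c) :
    ∫ ω, M ω * centredStep L x (T ω) (ε t ω) ∂P = 0 := by
  have hM0 : Measurable M := hM.mono (h.filt_le t) le_rfl
  have hT0 : Measurable T := hT.mono (h.filt_le t) le_rfl
  have hxT : Measurable[𝓕 t] fun ω => x + T ω := by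
    have := hT.const_add x
    exact this
  have hMi : Integrable M P := Integrable.of_bound hM0.aestronglyMeasurable c
    (Eventually.of_forall hMb)
  have h1 := integral_mul_stepIncrement (h.innov_meas t) (h.innov_law t) (h.filt_le t)
    (h.innov_indep t) hxT (T' := fun _ => x) measurable_const hM hMb
  have h2 : Integrable (fun ω => M ω * stepIncrement x (T ω) (ε t ω)) P :=
    hMi.mul_bdd (c := 1) (measurable_stepIncrement x (h.innov_meas t) hT0).aestronglyMeasurable
      (Eventually.of_forall fun ω => abs_stepIncrement_le _ _ _)
  have h3 : Integrable (fun ω => M ω * (cdf L (x + T ω) - cdf L x)) P :=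
    hMi.mul_bdd (c := 1) (((monotone_cdf L).measurable.comp
      (hT0.const_add x)).sub measurable_const).aestronglyMeasurable
      (Eventually.of_forall fun ω => abs_cdf_sub_le _ _ _)
  have h4 : ∀ ω, M ω * centredStep L x (T ω) (ε t ω)
      = M ω * stepIncrement x (T ω) (ε t ω) - M ω * (cdf L (x + T ω) - cdf L x) := fun ω => by
    rw [centredStep, mul_sub]
  simp only [h4]
  rw [integral_sub h2 h3, ← h1, sub_eq_zero]
  rfl

/-- Write the centred step as a - b with |a|, |b| ≤ 1; then (a - b)² ≤ 2|a| + 2|b|. Integrating out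
the innovation gives E|a| = E|b|, hence the factor 4. -/
lemma integral_sq_centredStep_le [IsProbabilityMeasure P] [IsProbabilityMeasure L]
    (h : IsRegularModel P β L Q q κ 𝓕 ε u z ξ) (x : ℝ) {t : ℤ} {T : Ω → ℝ}
    (hT : Measurable[𝓕 t] T) {b : ℝ} (hb : ∫ ω, |cdf L (x + T ω) - cdf L x| ∂P ≤ b) :
    ∫ ω, centredStep L x (T ω) (ε t ω) ^ 2 ∂P ≤ 4 * b := by
  have hT0 : Measurable T := hT.mono (h.filt_le t) le_rfl
  have hmax : Measurable[𝓕 t] fun ω => x + max (T ω) 0 :=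
    Measurable.const_add (Measurable.max hT measurable_const) x
  have hmin : Measurable[𝓕 t] fun ω => x + min (T ω) 0 :=
    Measurable.const_add (Measurable.min hT measurable_const) x
  have h1 := integral_mul_stepIncrement (h.innov_meas t) (h.innov_law t) (h.filt_le t)
    (h.innov_indep t) hmax hmin (M := fun _ => 1) measurable_const (c := 1) (by simp)
  simp only [one_mul, ← abs_stepIncrement_eq] at h1
  have h2 : ∀ a, cdf L (x + max a 0) - cdf L (x + min a 0) = |cdf L (x + a) - cdf L x| := by
    intro a
    rcases le_total a 0 with ha | ha
    · rw [max_eq_right ha, min_eq_left ha, add_zero, abs_sub_comm, abs_of_nonneg]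
      exact sub_nonneg.2 (monotone_cdf L (by linarith))
    · rw [max_eq_left ha, min_eq_right ha, add_zero, abs_of_nonneg]
      exact sub_nonneg.2 (monotone_cdf L (by linarith))
  simp only [h2] at h1
  have hsm := measurable_stepIncrement x (h.innov_meas t) hT0
  have hcm : Measurable fun ω => cdf L (x + T ω) - cdf L x :=
    ((monotone_cdf L).measurable.comp (hT0.const_add x)).sub measurable_const
  have hi1 : Integrable (fun ω => |stepIncrement x (T ω) (ε t ω)|) P :=
    (Integrable.of_bound hsm.aestronglyMeasurable 1
      (Eventually.of_forall fun ω => abs_stepIncrement_le _ _ _)).abs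
  have hi2 : Integrable (fun ω => |cdf L (x + T ω) - cdf L x|) P :=
    (Integrable.of_bound hcm.aestronglyMeasurable 1
      (Eventually.of_forall fun ω => abs_cdf_sub_le _ _ _)).abs
  have hi3 : Integrable (fun ω => centredStep L x (T ω) (ε t ω) ^ 2) P := by
    refine Integrable.of_bound ((measurable_centredStep L x (h.innov_meas t) hT0).pow_const
      2).aestronglyMeasurable 4 (Eventually.of_forall fun ω => ?_)
    rw [norm_pow, Real.norm_eq_abs]
    have := abs_centredStep_le L x (T ω) (ε t ω)
    have h0 := abs_nonneg (centredStep L x (T ω) (ε t ω))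
    nlinarith
  calc ∫ ω, centredStep L x (T ω) (ε t ω) ^ 2 ∂P
      ≤ ∫ ω, (2 * |stepIncrement x (T ω) (ε t ω)| + 2 * |cdf L (x + T ω) - cdf L x|) ∂P := by
        refine integral_mono hi3 ((hi1.const_mul 2).add (hi2.const_mul 2)) fun ω => ?_
        simp only [centredStep]
        have e1 := abs_stepIncrement_le x (T ω) (ε t ω)
        have e2 := abs_cdf_sub_le L (x + T ω) x
        have e3 := abs_nonneg (stepIncrement x (T ω) (ε t ω))
        have e4 := abs_nonneg (cdf L (x + T ω) - cdf L x)
        have e5 := sq_abs (stepIncrement x (T ω) (ε t ω))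
        have e6 := sq_abs (cdf L (x + T ω) - cdf L x)
        nlinarith [sq_nonneg (stepIncrement x (T ω) (ε t ω) + (cdf L (x + T ω) - cdf L x))]
    _ = 4 * ∫ ω, |cdf L (x + T ω) - cdf L x| ∂P := by
        rw [integral_add (hi1.const_mul 2) (hi2.const_mul 2), integral_const_mul,
          integral_const_mul, h1]
        ring
    _ ≤ 4 * b := by linarith

/-- The centred part of the residual empirical process is small in mean. -/
lemma bounded_sum_centredStep [IsProbabilityMeasure P] [IsProbabilityMeasure L]
    (h : IsRegularModel P β L Q q κ 𝓕 ε u z ξ) (x : ℝ) {T : ℤ → Ω → ℝ}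
    (hT : ∀ s t, s ≤ t → Measurable[𝓕 t] (T s)) {b : ℝ}
    (hb : ∀ t, ∫ ω, |cdf L (x + T t ω) - cdf L x| ∂P ≤ b) {n : ℕ} {r : ℝ}
    (hr : r ^ 2 * n = 1) :
    BoundedInMean P (fun ω => r * ∑ t ∈ Finset.Icc (1 : ℤ) n,
      centredStep L x (T t ω) (ε t ω)) √(4 * b) := by
  have hT0 : ∀ t, Measurable (T t) := fun t => (hT t t le_rfl).mono (h.filt_le t) le_rfl
  have hcm : ∀ t, Measurable fun ω => centredStep L x (T t ω) (ε t ω) := fun t =>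
    measurable_centredStep L x (h.innov_meas t) (hT0 t)
  have hLp : ∀ t, MemLp (fun ω => centredStep L x (T t ω) (ε t ω)) 2 P := fun t =>
    MemLp.of_bound (hcm t).aestronglyMeasurable 2
      (Eventually.of_forall fun ω => abs_centredStep_le _ _ _ _)
  -- The earlier centred step is itself a bounded function of the past of the later one and serves
  -- as the multiplier M.
  have horth : ∀ s t, s < t → ∫ ω, centredStep L x (T s ω) (ε s ω)
      * centredStep L x (T t ω) (ε t ω) ∂P = 0 := fun s t hst =>
    h.integral_mul_centredStep x (hT t t le_rfl) (measurable_centredStep L x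
      (h.innov_past s t hst) (hT s t hst.le)) fun ω => abs_centredStep_le _ _ _ _
  have h1 := integral_sq_sum_le_of_orthogonal (P := P) (s := Finset.Icc (1 : ℤ) n)
    (fun t _ => hLp t) (fun s _ t _ hst => by
      rcases lt_or_gt_of_ne hst with hlt | hlt
      · exact horth s t hlt
      · simp only [mul_comm (centredStep L x (T s _) _)]
        exact horth t s hlt) fun t _ => h.integral_sq_centredStep_le x (hT t t le_rfl) (hb t)
  refine BoundedInMean.of_sq ((memLp_sum_of_memLp fun t _ => hLp t).const_mul r) ?_
  simp only [mul_pow]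
  rw [integral_const_mul]
  refine (mul_le_mul_of_nonneg_left h1 (sq_nonneg r)).trans (le_of_eq ?_)
  have hcard : ((Finset.Icc (1 : ℤ) n).card : ℝ) = n := by simp
  rw [hcard, ← mul_assoc, hr, one_mul]

/-- The fluctuation of the sum of the effects of the outliers is small in mean. -/
lemma bounded_sum_outlier [IsProbabilityMeasure P] [IsProbabilityMeasure Q]
    (h : IsRegularModel P β L Q q κ 𝓕 ε u z ξ) {φ : ℝ → ℝ} (hφ : Measurable φ)
    (hφ1 : ∀ x, |φ x| ≤ 1) (l : ℤ) {n : ℕ} {r : ℝ} (hr : r ^ 2 * n = 1) :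
    BoundedInMean P (fun ω => r * ∑ t ∈ Finset.Icc (1 : ℤ) n,
      (z (t - l) ω * φ (ξ (t - l) ω) - q * ∫ x, φ x ∂Q)) √q := by
  have hm : ∀ t, Measurable fun ω => z t ω * φ (ξ t ω) := fun t =>
    (h.bern_meas t).mul (hφ.comp (h.outlier_meas t))
  have hLp : ∀ t, MemLp (fun ω => z t ω * φ (ξ t ω)) 2 P := by
    intro t
    refine MemLp.of_bound (hm t).aestronglyMeasurable 1 ?_
    filter_upwards [h.bern_abs_le] with ω hω
    rw [norm_mul]
    exact mul_le_one₀ (hω t).2 (norm_nonneg _) (hφ1 _)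
  have hint := fun t => h.bern_outlier φ hφ t
  set c := q * ∫ x, φ x ∂Q with hc
  have hLp' : ∀ t, MemLp (fun ω => z t ω * φ (ξ t ω) - c) 2 P := fun t =>
    (hLp t).sub (memLp_const c)
  have hI : ∀ t, Integrable (fun ω => z t ω * φ (ξ t ω)) P := fun t =>
    (hLp t).integrable (by norm_num)
  have hexp : ∀ s t, ∫ ω, (z s ω * φ (ξ s ω) - c) * (z t ω * φ (ξ t ω) - c) ∂P
      = ∫ ω, (z s ω * φ (ξ s ω)) * (z t ω * φ (ξ t ω)) ∂P - c ^ 2 := by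
    intro s t
    have e1 : ∀ ω, (z s ω * φ (ξ s ω) - c) * (z t ω * φ (ξ t ω) - c)
        = (z s ω * φ (ξ s ω)) * (z t ω * φ (ξ t ω))
          - (c * (z s ω * φ (ξ s ω)) + c * (z t ω * φ (ξ t ω)) - c ^ 2) := fun ω => by ring
    simp only [e1]
    have i1 : Integrable (fun ω => (z s ω * φ (ξ s ω)) * (z t ω * φ (ξ t ω))) P :=
      (hLp s).integrable_mul (hLp t)
    have i2 : Integrable (fun ω => c * (z s ω * φ (ξ s ω)) + c * (z t ω * φ (ξ t ω))) P :=
      ((hI s).const_mul c).add ((hI t).const_mul c)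
    have i3 : Integrable (fun ω => c * (z s ω * φ (ξ s ω)) + c * (z t ω * φ (ξ t ω)) - c ^ 2) P :=
      i2.sub (integrable_const _)
    rw [integral_sub i1 i3, integral_sub i2 (integrable_const _), integral_add ((hI s).const_mul c) ((hI t).const_mul c), integral_const_mul,
      integral_const_mul, hint, hint]
    simp
    ring
  have h1 := integral_sq_sum_le_of_orthogonal (P := P) (s := Finset.Icc (1 : ℤ) n)
    (f := fun t ω => z (t - l) ω * φ (ξ (t - l) ω) - c) (b := q)
    (fun t _ => hLp' (t - l)) (fun s _ t _ hst => by
      rw [hexp, h.bern_outlier_pair φ hφ _ _ (by omega), sub_self]) fun t _ => by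
      simp only [sq]
      rw [hexp]
      -- The variance is at most E(zφ)², and z² = z with |φ| ≤ 1 bounds this by E z = q.
      refine (sub_le_self _ (sq_nonneg c)).trans ?_
      rw [← h.bern_integral (t - l)]
      refine integral_mono_ae ((hLp _).integrable_mul (hLp _)) (h.bounded_bern _).1 ?_
      filter_upwards [h.bern_zero_one] with ω hω
      rcases hω (t - l) with h0 | h0
      · simp [h0]
      · simp only [h0, one_mul]
        have := hφ1 (ξ (t - l) ω)
        have h3 := sq_abs (φ (ξ (t - l) ω))
        have h4 := abs_nonneg (φ (ξ (t - l) ω))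
        nlinarith
  refine BoundedInMean.of_sq ((memLp_sum_of_memLp fun t _ => hLp' (t - l)).const_mul r) ?_
  simp only [mul_pow]
  rw [integral_const_mul]
  refine (mul_le_mul_of_nonneg_left h1 (sq_nonneg r)).trans (le_of_eq ?_)
  have hcard : ((Finset.Icc (1 : ℤ) n).card : ℝ) = n := by simp
  rw [hcard, ← mul_assoc, hr, one_mul]

end IsRegularModel

end Martingale

/-! ### Sums of the centred solution -/

section LawOfLargeNumbers

/-- One more lag changes a window sum by its two boundary terms only, so lagged sums differ by an
amount bounded in n. -/
lemma sum_Icc_shift_succ (f : ℤ → ℝ) (n l : ℕ) :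
    ∑ t ∈ Finset.Icc (1 : ℤ) n, f (t - ((l : ℕ) + 1)) =
      ∑ t ∈ Finset.Icc (1 : ℤ) n, f (t - (l : ℕ)) + (f (-(l : ℤ)) - f (n - (l : ℤ))) := by
  induction n with
  | zero => simp
  | succ n ih =>
    have h1 : Finset.Icc (1 : ℤ) ((n + 1 : ℕ) : ℤ) = insert ((n : ℤ) + 1) (Finset.Icc (1 : ℤ) n) := by
      ext a
      simp only [Finset.mem_insert, Finset.mem_Icc]
      omega
    have h2 : ((n : ℤ) + 1) ∉ Finset.Icc (1 : ℤ) n := by simp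
    rw [h1, Finset.sum_insert h2, Finset.sum_insert h2, ih]
    push_cast
    rw [show (n : ℤ) + 1 - ((l : ℤ) + 1) = n - l by ring]
    ring

variable {Ω : Type*} [MeasurableSpace Ω] {P : Measure Ω}

namespace IsRegularModel

variable {p : ℕ} {β : Fin p → ℝ} {L Q : Measure ℝ} {q κ : ℝ}
  {𝓕 : ℤ → MeasurableSpace Ω} {ε u z ξ : ℤ → Ω → ℝ}

lemma bounded_sum_shift_sub [IsProbabilityMeasure P] (h : IsRegularModel P β L Q q κ 𝓕 ε u z ξ)
    (hκ : 0 ≤ κ) (n l : ℕ) :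
    BoundedInMean P (fun ω => ∑ t ∈ Finset.Icc (1 : ℤ) n, u (t - (l : ℕ)) ω
      - ∑ t ∈ Finset.Icc (1 : ℤ) n, u t ω) (l * (2 * κ)) := by
  induction l with
  | zero => exact ⟨by simp, by simp⟩
  | succ l ih =>
    have h1 := ih.add ((h.bounded_sol hκ (-(l : ℤ))).add (h.bounded_sol hκ (n - (l : ℤ))).neg)
    refine (h1.congr (Eventually.of_forall fun ω => ?_)).mono (le_of_eq ?_)
    · have := sum_Icc_shift_succ (fun t => u t ω) n l
      push_cast
      rw [this]
      ring
    · push_cast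
      ring

/-- The sums of the solution are of the order of `√n`. -/
lemma bounded_sum_sol [IsProbabilityMeasure P] (h : IsRegularModel P β L Q q κ 𝓕 ε u z ξ)
    (hκ : 0 ≤ κ) (hβ : 1 - ∑ j, β j ≠ 0) {σ : ℝ} (hL : MemLp (fun x : ℝ => x) 2 L)
    (hL0 : ∫ x, x ∂L = 0) (hLσ : ∫ x, x ^ 2 ∂L ≤ σ) (n l : ℕ) :
    BoundedInMean P (fun ω => ∑ t ∈ Finset.Icc (1 : ℤ) n, u (t - (l : ℕ)) ω)
      (|(1 - ∑ j, β j)⁻¹| * (∑ j : Fin p, |β j| * (((j : ℕ) + 1) * (2 * κ)) + √(n * σ))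
        + l * (2 * κ)) := by
  have hεLp : ∀ t, MemLp (ε t) 2 P := by
    intro t
    rw [← h.innov_law t] at hL
    exact (memLp_map_measure_iff measurable_id'.aestronglyMeasurable
      (h.innov_meas t).aemeasurable).1 hL
  have hε0 : ∀ t, ∫ ω, ε t ω ∂P = 0 := by
    intro t
    rw [← h.innov_law t, integral_map (h.innov_meas t).aemeasurable
      measurable_id'.aestronglyMeasurable] at hL0
    exact hL0
  have hε2 : ∀ t, ∫ ω, ε t ω ^ 2 ∂P ≤ σ := by
    intro t
    rw [← h.innov_law t, integral_map (h.innov_meas t).aemeasurable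
      (measurable_id'.pow_const 2).aestronglyMeasurable] at hLσ
    exact hLσ
  have h1 := integral_sq_sum_le_of_orthogonal (P := P) (s := Finset.Icc (1 : ℤ) n)
    (f := ε) (b := σ) (fun t _ => hεLp t) (fun s _ t _ hst => by
      rw [(h.innov_pair s t hst).integral_fun_mul_eq_mul_integral
        (hεLp s).1 (hεLp t).1, hε0, zero_mul]) fun t _ => hε2 t
  have hcard : ((Finset.Icc (1 : ℤ) n).card : ℝ) = n := by simp
  rw [hcard] at h1
  have h2 := BoundedInMean.of_sq (memLp_sum_of_memLp fun t _ => hεLp t) h1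
  have h3 := ((BoundedInMean.sum (s := Finset.univ) fun (j : Fin p) _ =>
    (h.bounded_sum_shift_sub hκ n ((j : ℕ) + 1)).const_mul (β j)).add h2).const_mul
      (1 - ∑ j, β j)⁻¹
  -- Summing the equation over t gives (1 - Σβ_j)Σu_t = Σβ_j(lagged sum - sum) + Σε_t: a bounded
  -- boundary contribution plus innovations of order √n.
  have h4 := h3.congr (Y := fun ω => ∑ t ∈ Finset.Icc (1 : ℤ) n, u t ω) (by
    filter_upwards [h.equation] with ω hω
    have e1 : ∑ t ∈ Finset.Icc (1 : ℤ) n, u t ω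
        = ∑ j : Fin p, β j * ∑ t ∈ Finset.Icc (1 : ℤ) n, u (t - ((j : ℕ) + 1)) ω
          + ∑ t ∈ Finset.Icc (1 : ℤ) n, ε t ω := by
      calc ∑ t ∈ Finset.Icc (1 : ℤ) n, u t ω = ∑ t ∈ Finset.Icc (1 : ℤ) n,
            (∑ j : Fin p, β j * u (t - ((j : ℕ) + 1)) ω + ε t ω) :=
            Finset.sum_congr rfl fun t _ => hω t
        _ = _ := by
            rw [Finset.sum_add_distrib, Finset.sum_comm]
            simp only [Finset.mul_sum]
    rw [inv_mul_eq_iff_eq_mul₀ hβ]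
    push_cast
    simp only [mul_sub, Finset.sum_sub_distrib, ← Finset.sum_mul]
    linear_combination -e1)
  have h5 := h4.add (h.bounded_sum_shift_sub hκ n l)
  refine (h5.congr (Eventually.of_forall fun ω => ?_)).mono (le_of_eq ?_)
  · simp
  · push_cast
    rfl

end IsRegularModel

end LawOfLargeNumbers

/-! ### The error of the expansion as a function of r = n^{-1/2} -/

section ErrorBound

/-- The bound for the mean error of the first order expansion of the residual empirical process,
as a function of `r = n^{-1/2}`. -/
def errorBound {p : ℕ} (β : Fin p → ℝ) (Q : Measure ℝ) (C K κ σ Γ r : ℝ) : ℝ :=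
  √(4 * (C * (r * (K * (1 + p * κ))) + (p + 1) * (Γ * r)))
    + (r * (C * (K ^ 2 * (2 + 2 * (p * (p * κ ^ 2)))) + 2 * C * K * ((p + 1) * (Γ * (1 + p * κ)))
        + 2 * ((p + 1) * ((p + 1) * Γ ^ 2)))
      + (p + 1) * (Γ * ∫ x, min 1 (C * (r * K) * |x|) ∂Q))
    + C * (p * (K * (r ^ 2 * (|(1 - ∑ j, β j)⁻¹| * (∑ j : Fin p, |β j| * (((j : ℕ) + 1) * (2 * κ)))
        + p * (2 * κ)) + r * (|(1 - ∑ j, β j)⁻¹| * √σ))))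
    + (p + 1) * √(Γ * r)

/-- Dominated convergence with dominating constant 1; the limit is taken through r ≥ 0, where the
integrand lies between 0 and 1. -/
lemma tendsto_integral_min (Q : Measure ℝ) [IsProbabilityMeasure Q] {C K : ℝ} (hC : 0 ≤ C)
    (hK : 0 ≤ K) :
    Tendsto (fun r : ℝ => ∫ x, min 1 (C * (r * K) * |x|) ∂Q) (𝓝[≥] 0) (𝓝 0) := by
  have h : Tendsto (fun r : ℝ => ∫ x, min 1 (C * (r * K) * |x|) ∂Q) (𝓝[≥] 0)
      (𝓝 (∫ x : ℝ, min (1 : ℝ) (C * (0 * K) * |x|) ∂Q)) := by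
    refine tendsto_integral_filter_of_dominated_convergence (fun _ => 1)
      (Eventually.of_forall fun r => ?_) ?_ (integrable_const _) (Eventually.of_forall fun x => ?_)
    · exact Measurable.aestronglyMeasurable (by fun_prop)
    · filter_upwards [self_mem_nhdsWithin] with r hr
      have hr' : 0 ≤ r := hr
      refine Eventually.of_forall fun x => ?_
      rw [Real.norm_eq_abs, abs_of_nonneg (le_min zero_le_one (by positivity))]
      exact min_le_left _ _
    · have hc : Continuous fun r : ℝ => min 1 (C * (r * K) * |x|) := by fun_prop
      exact (hc.tendsto 0).mono_left nhdsWithin_le_nhds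
  simpa using h

/-- Apart from the truncated integral, the bound is continuous in r and zero at r = 0. -/
lemma tendsto_errorBound {p : ℕ} (β : Fin p → ℝ) (Q : Measure ℝ) [IsProbabilityMeasure Q]
    {C K : ℝ} (hC : 0 ≤ C) (hK : 0 ≤ K) (κ σ Γ : ℝ) :
    Tendsto (errorBound β Q C K κ σ Γ) (𝓝[≥] 0) (𝓝 0) := by
  have hI := tendsto_integral_min Q hC hK
  have h1 : Tendsto (fun r => errorBound β Q C K κ σ Γ r
      - (p + 1) * (Γ * ∫ x, min 1 (C * (r * K) * |x|) ∂Q)) (𝓝[≥] 0) (𝓝 0) := by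
    have hc : Continuous fun r => errorBound β Q C K κ σ Γ r
        - (p + 1) * (Γ * ∫ x, min 1 (C * (r * K) * |x|) ∂Q) := by
      have : (fun r => errorBound β Q C K κ σ Γ r
        - (p + 1) * (Γ * ∫ x, min 1 (C * (r * K) * |x|) ∂Q)) = fun r =>
          √(4 * (C * (r * (K * (1 + p * κ))) + (p + 1) * (Γ * r)))
    + (r * (C * (K ^ 2 * (2 + 2 * (p * (p * κ ^ 2)))) + 2 * C * K * ((p + 1) * (Γ * (1 + p * κ)))
        + 2 * ((p + 1) * ((p + 1) * Γ ^ 2))))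
    + C * (p * (K * (r ^ 2 * (|(1 - ∑ j, β j)⁻¹| * (∑ j : Fin p, |β j| * (((j : ℕ) + 1) * (2 * κ)))
        + p * (2 * κ)) + r * (|(1 - ∑ j, β j)⁻¹| * √σ))))
    + (p + 1) * √(Γ * r) := by
        funext r
        rw [errorBound]
        ring
      rw [this]
      fun_prop
    have h2 := (hc.tendsto 0).mono_left (nhdsWithin_le_nhds (s := Set.Ici 0))
    simpa [errorBound] using h2
  have h2 := h1.add ((hI.const_mul Γ).const_mul (p + 1 : ℝ))
  simpa using h2

end ErrorBound

/-! ### Expansion at a deterministic estimation error -/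

section FixedParameter

variable {Ω : Type*} [MeasurableSpace Ω] {P : Measure Ω}

/-- The normalized change `n^{-1/2} ∑ (1(e_t ≤ x + a_t) - 1(e_t ≤ x))`, with `r = n^{-1/2}`. -/
def changeSum (n : ℕ) (r x : ℝ) (a e : ℤ → ℝ) : ℝ :=
  r * ∑ t ∈ Finset.Icc (1 : ℤ) n, stepIncrement x (a t) (e t)

namespace IsRegularModel

variable {p : ℕ} {β : Fin p → ℝ} {L Q : Measure ℝ} {q κ : ℝ}
  {𝓕 : ℤ → MeasurableSpace Ω} {ε u z ξ : ℤ → Ω → ℝ}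

lemma measurable_threshold_filt (h : IsRegularModel P β L Q q κ 𝓕 ε u z ξ)
    (ϑ : ℝ × (Fin p → ℝ)) (s r : ℝ) {t t' : ℤ} (ht : t ≤ t') :
    Measurable[𝓕 t'] fun ω =>
      threshold β ϑ s r (fun t => u t ω) (fun t => z t ω * ξ t ω) t :=
  measurable_threshold (m := 𝓕 t') β ϑ s r (u := u) (w := fun t ω => z t ω * ξ t ω) t
    (fun t'' h'' => h.sol_past t'' t' (by omega))
    (fun t'' => (h.bern_past t'' t').mul (h.outlier_past t'' t'))

lemma bounded_centred_part [IsProbabilityMeasure P] [IsProbabilityMeasure L]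
    (h : IsRegularModel P β L Q q κ 𝓕 ε u z ξ) (hκ : 0 ≤ κ) {C x g : ℝ}
    (hF : HasExpansion (fun y => cdf L y) C x g) (ϑ : ℝ × (Fin p → ℝ)) (s : ℝ) {n : ℕ} {r : ℝ}
    (hr : 0 ≤ r) (hrn : r ^ 2 * n = 1) :
    BoundedInMean P (fun ω => r * ∑ t ∈ Finset.Icc (1 : ℤ) n, centredStep L x
        (threshold β ϑ s r (fun t => u t ω) (fun t => z t ω * ξ t ω) t) (ε t ω))
      √(4 * (C * (r * ((‖ϑ‖ + |s|) * (1 + p * κ))) + (p + 1) * q)) := by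
  have hC := hF.nonneg
  refine h.bounded_sum_centredStep x (T := fun t ω =>
    threshold β ϑ s r (fun t => u t ω) (fun t => z t ω * ξ t ω) t)
    (fun t t' ht => h.measurable_threshold_filt ϑ s r ht) (fun t => ?_) hrn
  have h1 := (((h.bounded_lagAbs hκ t).const_mul (‖ϑ‖ + |s|)).const_mul r).const_mul C
  have h2 := BoundedInMean.sum (s := Finset.univ) fun (i : Fin (p + 1)) _ =>
    h.bounded_bern (t - (i : ℕ))
  have h3 := h1.add h2
  rw [abs_of_nonneg hC, abs_of_nonneg hr, abs_of_nonneg (by positivity : 0 ≤ ‖ϑ‖ + |s|)] at h3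
  refine (h3.of_abs_le (X := fun ω => cdf L (x +
    threshold β ϑ s r (fun t => u t ω) (fun t => z t ω * ξ t ω) t) - cdf L x) ?_ ?_).2.trans
    (le_of_eq ?_)
  · have hm := (h.measurable_threshold_filt ϑ s r (le_refl t)).mono (h.filt_le t) le_rfl
    exact (((monotone_cdf L).measurable.comp (hm.const_add x)).sub
      measurable_const).aestronglyMeasurable
  · filter_upwards [h.bern_zero_one] with ω hω
    exact abs_increment_threshold_le hF β ϑ s hr (fun t => u t ω) (fun t => z t ω)
      (fun t => ξ t ω) hω t
  · simp

/-- When q = O(r), the four summands are of order r², r², r·o(1) and r², so n of them multiplied by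
n^{-1/2} still tend to zero. -/
lemma bounded_drift_remainder [IsProbabilityMeasure P] [IsProbabilityMeasure L]
    (h : IsRegularModel P β L Q q κ 𝓕 ε u z ξ) (hκ : 0 ≤ κ) (hq : 0 ≤ q) {C x g : ℝ}
    (hF : HasExpansion (fun y => cdf L y) C x g) (ϑ : ℝ × (Fin p → ℝ)) (s : ℝ) {r : ℝ}
    (hr : 0 ≤ r) (t : ℤ) :
    BoundedInMean P (fun ω =>
        cdf L (x + threshold β ϑ s r (fun t => u t ω) (fun t => z t ω * ξ t ω) t) - cdf L x
          - g * (r * perturbation ϑ s (fun t => u t ω) t)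
          - ∑ i : Fin (p + 1), z (t - (i : ℕ)) ω *
            (cdf L (x + Matrix.vecCons (-1) β i * ξ (t - (i : ℕ)) ω) - cdf L x))
      (C * (r * (‖ϑ‖ + |s|)) ^ 2 * (2 + 2 * (p * (p * κ ^ 2)))
        + 2 * C * (r * (‖ϑ‖ + |s|)) * ((p + 1) * (q * (1 + p * κ)))
        + (p + 1) * (q * ∫ x, min 1 (C * (r * (‖ϑ‖ + |s|)) * |x|) ∂Q)
        + 2 * ((p + 1) * ((p + 1) * q ^ 2))) := by
  have hC := hF.nonneg
  have hK : 0 ≤ ‖ϑ‖ + |s| := by positivity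
  have e1 : 0 ≤ C * (r * (‖ϑ‖ + |s|)) ^ 2 := by positivity
  have e2 : 0 ≤ 2 * C * (r * (‖ϑ‖ + |s|)) := by positivity
  have e3 : 0 ≤ C * (r * (‖ϑ‖ + |s|)) := by positivity
  have h1 := (h.bounded_sq_lagAbs hκ t).const_mul (C * (r * (‖ϑ‖ + |s|)) ^ 2)
  have h2 := (h.bounded_bern_mul_lagAbs hκ hq t).const_mul (2 * C * (r * (‖ϑ‖ + |s|)))
  have h3 := h.bounded_bern_min e3 t
  have h4 := (h.bounded_bern_pairs t).const_mul 2
  rw [abs_of_nonneg e1] at h1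
  rw [abs_of_nonneg e2] at h2
  rw [abs_of_nonneg (zero_le_two : (0 : ℝ) ≤ 2)] at h4
  refine (((h1.add h2).add h3).add h4).of_abs_le ?_ ?_
  · have hm := (h.measurable_threshold_filt ϑ s r (le_refl t)).mono (h.filt_le t) le_rfl
    have hp : Measurable fun ω => perturbation ϑ s (fun t => u t ω) t := by
      unfold perturbation lagAbs
      have hu := h.sol_meas
      fun_prop
    refine Measurable.aestronglyMeasurable ?_
    refine ((((monotone_cdf L).measurable.comp (hm.const_add x)).sub
      measurable_const).sub ((hp.const_mul r).const_mul g)).sub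
      (Finset.measurable_sum _ fun i _ => (h.bern_meas _).mul
        (((monotone_cdf L).measurable.comp (((h.outlier_meas _).const_mul _).const_add x)).sub
          measurable_const))
  · filter_upwards [h.bern_zero_one] with ω hω
    refine (abs_drift_sub_le hF β ϑ s hr (fun t => u t ω) (fun t => z t ω)
      (fun t => ξ t ω) hω t).trans (le_of_eq ?_)
    ring

/-- The first order expansion of the residual empirical process at a fixed estimation error. -/
lemma bounded_changeSum_sub [IsProbabilityMeasure P] [IsProbabilityMeasure L]
    [IsProbabilityMeasure Q] (h : IsRegularModel P β L Q q κ 𝓕 ε u z ξ) (hκ : 0 ≤ κ)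
    (hq : 0 ≤ q) (hβ : 1 - ∑ j, β j ≠ 0) {σ : ℝ} (hL : MemLp (fun x : ℝ => x) 2 L)
    (hL0 : ∫ x, x ∂L = 0) (hLσ : ∫ x, x ^ 2 ∂L ≤ σ) {C x g : ℝ}
    (hF : HasExpansion (fun y => cdf L y) C x g) (ϑ : ℝ × (Fin p → ℝ)) (s : ℝ) {Γ : ℝ}
    {n : ℕ} {r : ℝ} (hr : 0 ≤ r) (hrn : r * √n = 1) (hqr : q ≤ Γ * r) :
    BoundedInMean P (fun ω => changeSum n r x
        (threshold β ϑ s r (fun t => u t ω) (fun t => z t ω * ξ t ω)) (fun t => ε t ω)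
          - g * (ϑ.1 + s * (r ^ 2 * ∑ t ∈ Finset.Icc (1 : ℤ) n, lagAbs p (fun t => u t ω) t))
          - √n * q * shift β (fun y => cdf L y) Q x)
      (errorBound β Q C (‖ϑ‖ + |s|) κ σ Γ r) := by
  have hC := hF.nonneg
  have hσ : 0 ≤ σ := (integral_nonneg fun _ => sq_nonneg _).trans hLσ
  have hn : √(n : ℝ) ^ 2 = n := Real.sq_sqrt n.cast_nonneg
  have hrn2 : r ^ 2 * n = 1 := by rw [← hn, ← mul_pow, hrn, one_pow]
  have hrn1 : r * n = √n := by
    rw [← one_mul √(n : ℝ), ← hrn, mul_assoc, Real.mul_self_sqrt n.cast_nonneg]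
  set K := ‖ϑ‖ + |s| with hKdef
  have hK : 0 ≤ K := by positivity
  have hcard : ((Finset.Icc (1 : ℤ) n).card : ℝ) = n := by simp
  set φ : Fin (p + 1) → ℝ → ℝ := fun i y =>
    cdf L (x + Matrix.vecCons (-1) β i * y) - cdf L x with hφ
  have hφm : ∀ i, Measurable (φ i) := fun i =>
    ((monotone_cdf L).measurable.comp ((measurable_id.const_mul _).const_add x)).sub
      measurable_const
  have hφ1 : ∀ i y, |φ i y| ≤ 1 := fun i y => abs_cdf_sub_le L _ _
  have hφI : ∀ i, ∫ y, φ i y ∂Q = ∫ y, cdf L (x + Matrix.vecCons (-1) β i * y) ∂Q - cdf L x := by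
    intro i
    have hi : Integrable (fun y => cdf L (x + Matrix.vecCons (-1) β i * y)) Q := by
      refine Integrable.of_bound ((monotone_cdf L).measurable.comp
        ((measurable_id.const_mul _).const_add x)).aestronglyMeasurable 1
        (Eventually.of_forall fun y => ?_)
      rw [Real.norm_eq_abs, abs_of_nonneg (cdf_nonneg _ _)]
      exact cdf_le_one _ _
    rw [integral_sub hi (integrable_const _)]
    simp
  -- The error has four sources, matching the summands of `errorBound`: the martingale part (b1),
  -- the drift remainder (b2), the lagged sums of u multiplied by ϑ.2 (b3), and the fluctuation of
  -- the outlier effects (b4).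
  have b1 := h.bounded_centred_part hκ hF ϑ s hr hrn2
  have b2 := (BoundedInMean.sum (s := Finset.Icc (1 : ℤ) n) fun t _ =>
    h.bounded_drift_remainder hκ hq hF ϑ s hr t).const_mul r
  have b3 := (BoundedInMean.sum (s := Finset.univ) fun (j : Fin p) _ =>
    ((h.bounded_sum_sol hκ hβ hL hL0 hLσ n ((j : ℕ) + 1)).const_mul (r ^ 2)).const_mul
      (ϑ.2 j)).const_mul g
  have b4 := BoundedInMean.sum (s := Finset.univ) fun (i : Fin (p + 1)) _ =>
    h.bounded_sum_outlier (hφm i) (hφ1 i) (i : ℕ) hrn2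
  refine ((((b1.add b2).add b3).add b4).congr (Eventually.of_forall fun ω => ?_)).mono ?_
  · have hshift : shift β (fun y => cdf L y) Q x = ∑ i, ∫ y, φ i y ∂Q := by
      rw [shift]
      exact Finset.sum_congr rfl fun i _ => (hφI i).symm
    have e1 : ∑ i : Fin (p + 1), r * ∑ t ∈ Finset.Icc (1 : ℤ) n,
        (z (t - (i : ℕ)) ω * φ i (ξ (t - (i : ℕ)) ω) - q * ∫ y, φ i y ∂Q)
        = r * ∑ t ∈ Finset.Icc (1 : ℤ) n, ∑ i : Fin (p + 1),
          z (t - (i : ℕ)) ω * φ i (ξ (t - (i : ℕ)) ω)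
          - √n * q * shift β (fun y => cdf L y) Q x := by
      rw [hshift, ← Finset.mul_sum, Finset.sum_comm]
      simp only [Finset.sum_sub_distrib, Finset.sum_const, nsmul_eq_mul, hcard,
        ← Finset.mul_sum]
      rw [← hrn1]
      ring
    have e2 : ∑ t ∈ Finset.Icc (1 : ℤ) n, perturbation ϑ s (fun t => u t ω) t
        = n * ϑ.1 + ∑ j : Fin p, ϑ.2 j * ∑ t ∈ Finset.Icc (1 : ℤ) n, u (t - (((j : ℕ) + 1 : ℕ) : ℤ)) ω
          + s * ∑ t ∈ Finset.Icc (1 : ℤ) n, lagAbs p (fun t => u t ω) t := by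
      simp only [perturbation, Finset.sum_add_distrib, Finset.sum_const, nsmul_eq_mul, hcard]
      rw [Finset.sum_comm]
      simp only [← Finset.mul_sum]
      push_cast
      rfl
    have e3 : ∑ j : Fin p, ϑ.2 j * (r ^ 2 *
          ∑ t ∈ Finset.Icc (1 : ℤ) n, u (t - (((j : ℕ) + 1 : ℕ) : ℤ)) ω)
        = r ^ 2 * ∑ j : Fin p, ϑ.2 j *
          ∑ t ∈ Finset.Icc (1 : ℤ) n, u (t - (((j : ℕ) + 1 : ℕ) : ℤ)) ω := by
      rw [Finset.mul_sum]
      exact Finset.sum_congr rfl fun j _ => by ring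
    simp only [changeSum, centredStep]
    rw [e1, e3]
    simp only [Finset.sum_sub_distrib, ← Finset.mul_sum]
    rw [e2]
    simp only [hφ]
    -- The constant ϑ.1 appears n times with weight r², and r²n = 1.
    linear_combination (-(g * ϑ.1)) * hrn2
  · rw [errorBound, abs_of_nonneg hr]
    have hlln : ∀ j : Fin p, |ϑ.2 j| * (|r ^ 2| * (|(1 - ∑ j, β j)⁻¹| *
        (∑ j : Fin p, |β j| * (((j : ℕ) + 1) * (2 * κ)) + √(n * σ))
          + (((j : ℕ) + 1 : ℕ) : ℝ) * (2 * κ))) ≤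
        K * (r ^ 2 * (|(1 - ∑ j, β j)⁻¹| * (∑ j : Fin p, |β j| * (((j : ℕ) + 1) * (2 * κ)))
        + p * (2 * κ)) + r * (|(1 - ∑ j, β j)⁻¹| * √σ)) := by
      intro j
      have f1 : |ϑ.2 j| ≤ K := ((norm_le_pi_norm ϑ.2 j).trans (norm_snd_le ϑ)).trans
        (le_add_of_nonneg_right (abs_nonneg _))
      have f2 : (((j : ℕ) + 1 : ℕ) : ℝ) ≤ p := by exact_mod_cast j.2
      have f3 : √((n : ℝ) * σ) = √n * √σ := Real.sqrt_mul n.cast_nonneg σ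
      rw [abs_of_nonneg (sq_nonneg r), f3]
      have f4 : r ^ 2 * (|(1 - ∑ j, β j)⁻¹| *
        (∑ j : Fin p, |β j| * (((j : ℕ) + 1) * (2 * κ)) + √n * √σ)
          + (((j : ℕ) + 1 : ℕ) : ℝ) * (2 * κ)) ≤ r ^ 2 * (|(1 - ∑ j, β j)⁻¹| *
        (∑ j : Fin p, |β j| * (((j : ℕ) + 1) * (2 * κ)) + √n * √σ) + p * (2 * κ)) := by
        gcongr
      have f5 : r ^ 2 * (|(1 - ∑ j, β j)⁻¹| *
        (∑ j : Fin p, |β j| * (((j : ℕ) + 1) * (2 * κ)) + √n * √σ) + p * (2 * κ)) =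
        r ^ 2 * (|(1 - ∑ j, β j)⁻¹| * (∑ j : Fin p, |β j| * (((j : ℕ) + 1) * (2 * κ)))
        + p * (2 * κ)) + r * (|(1 - ∑ j, β j)⁻¹| * √σ) := by
        linear_combination (r * |(1 - ∑ j, β j)⁻¹| * √σ) * hrn
      rw [← f5]
      exact mul_le_mul f1 f4 (by positivity) hK
    have hω0 : 0 ≤ ∫ x, min 1 (C * (r * K) * |x|) ∂Q :=
      integral_nonneg fun x => le_min zero_le_one (by positivity)
    refine add_le_add (add_le_add (add_le_add ?_ ?_) ?_) ?_
    · gcongr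
    · rw [Finset.sum_const, nsmul_eq_mul, hcard]
      set ω₀ := ∫ x, min 1 (C * (r * K) * |x|) ∂Q
      have q2 : q ^ 2 ≤ (Γ * r) ^ 2 := pow_le_pow_left₀ hq hqr 2
      -- Replacing q by Γr leaves a factor r² in each summand, which together with n cancels.
      calc r * (n * (C * (r * K) ^ 2 * (2 + 2 * (p * (p * κ ^ 2)))
            + 2 * C * (r * K) * ((p + 1) * (q * (1 + p * κ))) + (p + 1) * (q * ω₀)
            + 2 * ((p + 1) * ((p + 1) * q ^ 2))))
          ≤ r * (n * (C * (r * K) ^ 2 * (2 + 2 * (p * (p * κ ^ 2)))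
            + 2 * C * (r * K) * ((p + 1) * (Γ * r * (1 + p * κ))) + (p + 1) * (Γ * r * ω₀)
            + 2 * ((p + 1) * ((p + 1) * (Γ * r) ^ 2)))) := by gcongr
        _ = r ^ 2 * n * (r * (C * (K ^ 2 * (2 + 2 * (p * (p * κ ^ 2))))
            + 2 * C * K * ((p + 1) * (Γ * (1 + p * κ)))
            + 2 * ((p + 1) * ((p + 1) * Γ ^ 2))) + (p + 1) * (Γ * ω₀)) := by ring
        _ = _ := by rw [hrn2, one_mul]
    · refine mul_le_mul hF.slope ?_ ?_ hC
      · refine (Finset.sum_le_sum fun j _ => hlln j).trans (le_of_eq ?_)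
        simp
      · exact Finset.sum_nonneg fun j _ => by positivity
    · simp only [Finset.sum_const, Finset.card_univ, Fintype.card_fin, nsmul_eq_mul]
      push_cast
      gcongr

end IsRegularModel

end FixedParameter

/-! ### Mixtures of innovation laws -/

section Mixture

/-- The mixture `(1 - r) Q₀ + r Q₁`. -/
def mixtureLaw (Q₀ Q₁ : Measure ℝ) (r : ℝ) : Measure ℝ :=
  ENNReal.ofReal (1 - r) • Q₀ + ENNReal.ofReal r • Q₁

variable {Q₀ Q₁ : Measure ℝ} [IsProbabilityMeasure Q₀] [IsProbabilityMeasure Q₁] {r : ℝ}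

lemma isProbabilityMeasure_mixtureLaw (h0 : 0 ≤ r) (h1 : r ≤ 1) :
    IsProbabilityMeasure (mixtureLaw Q₀ Q₁ r) := by
  constructor
  simp only [mixtureLaw, Measure.add_apply, Measure.smul_apply, measure_univ, smul_eq_mul, mul_one]
  rw [← ENNReal.ofReal_add (by linarith) h0]
  simp

lemma integral_mixtureLaw {Q₀ Q₁ : Measure ℝ} {r : ℝ} (h0 : 0 ≤ r) (h1 : r ≤ 1) {f : ℝ → ℝ} (hf0 : Integrable f Q₀)
    (hf1 : Integrable f Q₁) :
    ∫ x, f x ∂(mixtureLaw Q₀ Q₁ r) = (1 - r) * ∫ x, f x ∂Q₀ + r * ∫ x, f x ∂Q₁ := by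
  rw [mixtureLaw, integral_add_measure (hf0.smul_measure ENNReal.ofReal_ne_top)
    (hf1.smul_measure ENNReal.ofReal_ne_top), integral_smul_measure, integral_smul_measure,
    ENNReal.toReal_ofReal (by linarith), ENNReal.toReal_ofReal h0]
  rfl

lemma cdf_mixtureLaw (h0 : 0 ≤ r) (h1 : r ≤ 1) (x : ℝ) :
    cdf (mixtureLaw Q₀ Q₁ r) x = (1 - r) * cdf Q₀ x + r * cdf Q₁ x := by
  have := isProbabilityMeasure_mixtureLaw (Q₀ := Q₀) (Q₁ := Q₁) h0 h1
  have h2 := integral_mixtureLaw (Q₀ := Q₀) (Q₁ := Q₁) h0 h1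
    (f := (Set.Iic x).indicator fun _ => (1 : ℝ))
    ((integrable_const _).indicator measurableSet_Iic)
    ((integrable_const _).indicator measurableSet_Iic)
  rw [integral_indicator_const _ measurableSet_Iic, integral_indicator_const _ measurableSet_Iic,
    integral_indicator_const _ measurableSet_Iic] at h2
  rw [cdf_eq_real, cdf_eq_real, cdf_eq_real]
  simpa using h2

lemma memLp_mixtureLaw {Q₀ Q₁ : Measure ℝ} {r : ℝ} {f : ℝ → ℝ} (hf : Measurable f)
    (hf0 : MemLp f 2 Q₀) (hf1 : MemLp f 2 Q₁) : MemLp f 2 (mixtureLaw Q₀ Q₁ r) := by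
  rw [memLp_two_iff_integrable_sq hf.aestronglyMeasurable]
  exact (hf0.integrable_sq.smul_measure ENNReal.ofReal_ne_top).add_measure
    (hf1.integrable_sq.smul_measure ENNReal.ofReal_ne_top)

lemma eLpNorm_le_sqrt {Ω : Type*} [MeasurableSpace Ω] {P : Measure Ω} {X : Ω → ℝ} {σ : ℝ}
    (hX : MemLp X 2 P) (h : ∫ ω, X ω ^ 2 ∂P ≤ σ) : eLpNorm X 2 P ≤ ENNReal.ofReal √σ := by
  rw [hX.eLpNorm_eq_integral_rpow_norm (by norm_num) (by norm_num)]
  refine ENNReal.ofReal_le_ofReal ?_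
  simp only [ENNReal.toReal_ofNat, Real.rpow_ofNat, Real.norm_eq_abs, sq_abs]
  rw [Real.sqrt_eq_rpow, one_div]
  exact Real.rpow_le_rpow (integral_nonneg fun _ => sq_nonneg _) h (by norm_num)

/-- The constant C₀ + C₁ is used instead of the convex combination so that it does not depend on r,
hence not on n. -/
lemma HasExpansion.mix {F₀ F₁ F : ℝ → ℝ} {C₀ C₁ x g₀ g₁ : ℝ} (hF₀ : HasExpansion F₀ C₀ x g₀)
    (hF₁ : HasExpansion F₁ C₁ x g₁) (h0 : 0 ≤ r) (h1 : r ≤ 1)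
    (hF : ∀ y, F y = (1 - r) * F₀ y + r * F₁ y) :
    HasExpansion F (C₀ + C₁) x ((1 - r) * g₀ + r * g₁) := by
  have key : ∀ a b A B : ℝ, |a| ≤ A → |b| ≤ B → |(1 - r) * a + r * b| ≤ (1 - r) * A + r * B := by
    intro a b A B ha hb
    refine (abs_add_le _ _).trans ?_
    rw [abs_mul, abs_mul, abs_of_nonneg h0, abs_of_nonneg (sub_nonneg.2 h1)]
    exact add_le_add (mul_le_mul_of_nonneg_left ha (sub_nonneg.2 h1))
      (mul_le_mul_of_nonneg_left hb h0)
  have hle : ∀ y : ℝ, 0 ≤ y → (1 - r) * (C₀ * y) + r * (C₁ * y) ≤ (C₀ + C₁) * y := by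
    intro y hy
    have e1 := mul_nonneg h0 (mul_nonneg hF₀.nonneg hy)
    have e2 := mul_nonneg (sub_nonneg.2 h1) (mul_nonneg hF₁.nonneg hy)
    nlinarith
  refine ⟨add_nonneg hF₀.nonneg hF₁.nonneg, fun a b => ?_, fun a b => ?_, ?_, fun a => ?_⟩
  · have := key _ _ _ _ (hF₀.range a b) (hF₁.range a b)
    rw [hF, hF]
    calc _ = |(1 - r) * (F₀ a - F₀ b) + r * (F₁ a - F₁ b)| := by congr 1; ring
      _ ≤ _ := this
      _ = 1 := by ring
  · have := key _ _ _ _ (hF₀.lip a b) (hF₁.lip a b)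
    rw [hF, hF]
    calc _ = |(1 - r) * (F₀ a - F₀ b) + r * (F₁ a - F₁ b)| := by congr 1; ring
      _ ≤ _ := this
      _ ≤ _ := hle _ (abs_nonneg _)
  · have := (key _ _ _ _ hF₀.slope hF₁.slope).trans (by simpa using hle 1 zero_le_one)
    exact this
  · have := key _ _ _ _ (hF₀.expand a) (hF₁.expand a)
    rw [hF, hF]
    calc _ = |(1 - r) * (F₀ (x + a) - F₀ x - g₀ * a) + r * (F₁ (x + a) - F₁ x - g₁ * a)| := by
          congr 1; ring
      _ ≤ _ := this
      _ ≤ _ := hle _ (sq_nonneg _)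

lemma integrable_cdf_shift (Q : Measure ℝ) [IsProbabilityMeasure Q] (L : Measure ℝ) (x b : ℝ) :
    Integrable (fun y => cdf L (x + b * y)) Q := by
  refine Integrable.of_bound ((monotone_cdf L).measurable.comp
    ((measurable_id.const_mul _).const_add x)).aestronglyMeasurable 1
    (Eventually.of_forall fun y => ?_)
  rw [Real.norm_eq_abs, abs_of_nonneg (cdf_nonneg _ _)]
  exact cdf_le_one _ _

lemma abs_shift_le {p : ℕ} (β : Fin p → ℝ) (L Q : Measure ℝ) [IsProbabilityMeasure Q] (x : ℝ) :
    |shift β (fun y => cdf L y) Q x| ≤ p + 1 := by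
  rw [shift]
  refine (Finset.abs_sum_le_sum_abs _ _).trans ?_
  refine (Finset.sum_le_card_nsmul _ _ 1 fun i _ => ?_).trans (by simp)
  have h1 : 0 ≤ ∫ y, cdf L (x + Matrix.vecCons (-1) β i * y) ∂Q :=
    integral_nonneg fun _ => cdf_nonneg _ _
  have h2 : ∫ y, cdf L (x + Matrix.vecCons (-1) β i * y) ∂Q ≤ 1 := by
    have := integral_mono (integrable_cdf_shift Q L x (Matrix.vecCons (-1) β i))
      (integrable_const (1 : ℝ)) fun y => cdf_le_one L _
    simpa using this
  rw [abs_le]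
  constructor <;> linarith [cdf_nonneg L x, cdf_le_one L x]

lemma shift_mix {p : ℕ} (β : Fin p → ℝ) (Q : Measure ℝ) [IsProbabilityMeasure Q] (x : ℝ)
    (h0 : 0 ≤ r) (h1 : r ≤ 1) :
    shift β (fun y => cdf (mixtureLaw Q₀ Q₁ r) y) Q x
      = (1 - r) * shift β (fun y => cdf Q₀ y) Q x + r * shift β (fun y => cdf Q₁ y) Q x := by
  simp only [shift, cdf_mixtureLaw h0 h1, Finset.mul_sum]
  rw [← Finset.sum_add_distrib]
  refine Finset.sum_congr rfl fun i _ => ?_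
  rw [integral_add ((integrable_cdf_shift Q Q₀ x _).const_mul _)
    ((integrable_cdf_shift Q Q₁ x _).const_mul _), integral_const_mul, integral_const_mul]
  ring

end Mixture

/-! ### Residuals as shifted innovations; monotonicity in the threshold -/

section Residuals

variable {p : ℕ}

/-- An exact identity, with R = √n and no widening. The first coordinate of ϑ carries the estimated
factor 1 - Σb_j, so no quadratic remainder in the estimation errors arises. -/
lemma arResidual_eq {β : Fin p → ℝ} {u w y e : ℤ → ℝ} {μ m r R : ℝ} {b : Fin p → ℝ} {t : ℤ}
    (hrR : r * R = 1) (hy : ∀ s, y s = u s + μ + w s)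
    (hu : u t = ∑ j : Fin p, β j * u (t - ((j : ℕ) + 1)) + e t) :
    arResidual y m b t = e t -
      threshold β (R * (m - μ) * (1 - ∑ j, b j), R • (b - β)) 0 r u w t := by
  have h1 : contamination β w t = -w t + ∑ j : Fin p, β j * w (t - ((j : ℕ) + 1)) := by
    rw [contamination, Fin.sum_univ_succ]
    simp
  have h2 : ∑ j : Fin p, b j * (y (t - ((j : ℕ) + 1)) - m)
      = ∑ j : Fin p, b j * (u (t - ((j : ℕ) + 1)) + w (t - ((j : ℕ) + 1)))
        + (μ - m) * ∑ j, b j := by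
    rw [Finset.mul_sum, ← Finset.sum_add_distrib]
    exact Finset.sum_congr rfl fun j _ => by rw [hy]; ring
  have h3 : ∑ j : Fin p, (R • (b - β)) j * (u (t - ((j : ℕ) + 1)) + w (t - ((j : ℕ) + 1)))
      = R * (∑ j : Fin p, b j * (u (t - ((j : ℕ) + 1)) + w (t - ((j : ℕ) + 1)))
        - ∑ j : Fin p, β j * u (t - ((j : ℕ) + 1)) - ∑ j : Fin p, β j * w (t - ((j : ℕ) + 1))) := by
    rw [← Finset.sum_sub_distrib, ← Finset.sum_sub_distrib, Finset.mul_sum]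
    refine Finset.sum_congr rfl fun j _ => ?_
    simp only [Pi.smul_apply, Pi.sub_apply, smul_eq_mul]
    ring
  rw [arResidual, threshold, perturbation, h1, h2, h3, hy t, hu]
  linear_combination ((m - μ) * (1 - ∑ j, b j)
    + (∑ j : Fin p, b j * (u (t - ((j : ℕ) + 1)) + w (t - ((j : ℕ) + 1)))
        - ∑ j : Fin p, β j * u (t - ((j : ℕ) + 1)) - ∑ j : Fin p, β j * w (t - ((j : ℕ) + 1)))) * hrR

lemma sqrt_mul_edf_sub {n : ℕ} {r x : ℝ} {ρ e a : ℤ → ℝ} (hr : √(n : ℝ) * (n : ℝ)⁻¹ = r)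
    (h : ∀ t, ρ t = e t - a t) :
    √(n : ℝ) * (edf n ρ x - edf n e x) = changeSum n r x a e := by
  rw [edf, edf, changeSum, ← mul_sub, ← mul_assoc, hr, ← Finset.sum_sub_distrib]
  congr 1
  refine Finset.sum_congr rfl fun t _ => ?_
  rw [stepIncrement]
  congr 1
  simp only [Set.indicator, Set.mem_Iic, h t, sub_le_iff_le_add]

lemma changeSum_mono {n : ℕ} {r x : ℝ} (hr : 0 ≤ r) {a b e : ℤ → ℝ} (h : ∀ t, a t ≤ b t) :
    changeSum n r x a e ≤ changeSum n r x b e := by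
  refine mul_le_mul_of_nonneg_left (Finset.sum_le_sum fun t _ => ?_) hr
  rw [stepIncrement, stepIncrement]
  refine sub_le_sub_right ?_ _
  refine Set.indicator_le_indicator_of_subset (Set.Iic_subset_Iic.2 ?_) (fun _ => zero_le_one) _
  linarith [h t]

lemma abs_perturbation_sub_le (ϑ ϑ₀ : ℝ × (Fin p → ℝ)) (y : ℤ → ℝ) (t : ℤ) :
    |perturbation ϑ 0 y t - perturbation ϑ₀ 0 y t| ≤ ‖ϑ - ϑ₀‖ * lagAbs p y t := by
  have h1 := abs_perturbation_le (ϑ - ϑ₀) 0 y t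
  rw [abs_zero, add_zero] at h1
  refine le_trans (le_of_eq ?_) h1
  congr 1
  simp only [perturbation, Prod.fst_sub, Prod.snd_sub, Pi.sub_apply, sub_mul,
    Finset.sum_sub_distrib]
  ring

/-- The difference of the perturbations is linear in ϑ - ϑ₀, hence at most η · `lagAbs`. The
widening uses the contaminated observations, so the sandwich holds on every path, outliers or not.
-/
lemma threshold_sandwich (β : Fin p → ℝ) {ϑ ϑ₀ : ℝ × (Fin p → ℝ)} {η r : ℝ} (hr : 0 ≤ r)
    (h : ‖ϑ - ϑ₀‖ ≤ η) (u w : ℤ → ℝ) (t : ℤ) :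
    threshold β ϑ₀ (-η) r u w t ≤ threshold β ϑ 0 r u w t ∧
      threshold β ϑ 0 r u w t ≤ threshold β ϑ₀ η r u w t := by
  have h1 := (abs_perturbation_sub_le ϑ ϑ₀ (fun t => u t + w t) t).trans
    (mul_le_mul_of_nonneg_right h (zero_le_one.trans (one_le_lagAbs _ _)))
  rw [abs_le] at h1
  have h2 : ∀ s, perturbation ϑ₀ s (fun t => u t + w t) t
      = perturbation ϑ₀ 0 (fun t => u t + w t) t + s * lagAbs p (fun t => u t + w t) t := by
    intro s
    simp [perturbation]
  unfold threshold
  rw [h2 η, h2 (-η)]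
  constructor
  · refine add_le_add_right (mul_le_mul_of_nonneg_left ?_ hr) _
    linarith
  · refine add_le_add_right (mul_le_mul_of_nonneg_left ?_ hr) _
    linarith

end Residuals

/-! ### From the finite net to arbitrary estimation errors -/

section Expansion

variable {Ω : Type*} [MeasurableSpace Ω] {P : Measure Ω} {p : ℕ} {β : Fin p → ℝ}

/-- The error of the first order expansion of the change process at a fixed estimation error. -/
def expansionError (β : Fin p → ℝ) (n : ℕ) (r x g g₀ d : ℝ) (ϑ : ℝ × (Fin p → ℝ)) (s : ℝ)
    (u w e : ℤ → ℝ) : ℝ :=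
  changeSum n r x (threshold β ϑ s r u w) e - g₀ * ϑ.1 - d
    - g * (s * (r ^ 2 * ∑ t ∈ Finset.Icc (1 : ℤ) n, lagAbs p u t))

/-- Monotonicity brackets the sum for ϑ by the two widened sums at a nearby net point; widening and
recentring cost multiples of Cη. The right side sums over the whole net and does not involve ϑ, so
no independence or measurability of ϑ is needed. -/
lemma abs_changeSum_sub_le {n : ℕ} {r x g g₀ d C η : ℝ} (hr : 0 ≤ r) (hC : 0 ≤ C)
    (hg : |g| ≤ C) (hg₀ : |g₀| ≤ C) {ϑ : ℝ × (Fin p → ℝ)} {S : Finset (ℝ × (Fin p → ℝ))}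
    (hS : ∃ ϑ₀ ∈ S, ‖ϑ - ϑ₀‖ ≤ η) (u w e : ℤ → ℝ) :
    |changeSum n r x (threshold β ϑ 0 r u w) e - g₀ * ϑ.1 - d| ≤
      ∑ ϑ₀ ∈ S, (|expansionError β n r x g g₀ d ϑ₀ η u w e|
          + |expansionError β n r x g g₀ d ϑ₀ (-η) u w e|)
        + (C * η * (r ^ 2 * ∑ t ∈ Finset.Icc (1 : ℤ) n, lagAbs p u t) + C * η) := by
  obtain ⟨ϑ₀, hϑ₀, hd⟩ := hS
  have hη : 0 ≤ η := (norm_nonneg _).trans hd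
  set V := r ^ 2 * ∑ t ∈ Finset.Icc (1 : ℤ) n, lagAbs p u t with hV
  have hV0 : 0 ≤ V := mul_nonneg (sq_nonneg r)
    (Finset.sum_nonneg fun t _ => zero_le_one.trans (one_le_lagAbs u t))
  have h1 := changeSum_mono (n := n) (x := x) hr (e := e)
    fun t => (threshold_sandwich β hr hd u w t).1
  have h2 := changeSum_mono (n := n) (x := x) hr (e := e)
    fun t => (threshold_sandwich β hr hd u w t).2
  have h3 := Finset.single_le_sum (f := fun ϑ₀ => |expansionError β n r x g g₀ d ϑ₀ η u w e|
    + |expansionError β n r x g g₀ d ϑ₀ (-η) u w e|) (fun _ _ => by positivity) hϑ₀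
  have h4 : |g₀ * (ϑ.1 - ϑ₀.1)| ≤ C * η := by
    rw [abs_mul]
    exact mul_le_mul hg₀ ((norm_fst_le (ϑ - ϑ₀)).trans hd) (abs_nonneg _) hC
  have h5 : |g * (η * V)| ≤ C * η * V := by
    rw [abs_mul, abs_of_nonneg (mul_nonneg hη hV0), mul_assoc]
    exact mul_le_mul_of_nonneg_right hg (mul_nonneg hη hV0)
  have h6 := le_abs_self (expansionError β n r x g g₀ d ϑ₀ η u w e)
  have h7 := neg_abs_le (expansionError β n r x g g₀ d ϑ₀ (-η) u w e)
  have h8 := abs_nonneg (expansionError β n r x g g₀ d ϑ₀ η u w e)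
  have h9 := abs_nonneg (expansionError β n r x g g₀ d ϑ₀ (-η) u w e)
  have e1 : expansionError β n r x g g₀ d ϑ₀ η u w e
      = changeSum n r x (threshold β ϑ₀ η r u w) e - g₀ * ϑ₀.1 - d - g * (η * V) := rfl
  have e2 : expansionError β n r x g g₀ d ϑ₀ (-η) u w e
      = changeSum n r x (threshold β ϑ₀ (-η) r u w) e - g₀ * ϑ₀.1 - d - g * (-η * V) := rfl
  rw [abs_le] at h4 h5 ⊢
  constructor <;> linarith [h4.1, h4.2, h5.1, h5.2]

namespace IsContaminatedAR

/-- Replaces the n-dependent mixture by G₀ in the leading terms, with u and g fixed before ϑ and s.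
The slope g may depend on n; only the widening term, small with η, retains it. -/
lemma exists_expansion [IsProbabilityMeasure P] (hβ : RootsInUnitDisc β) {ν μ : ℝ}
    (hμ : ν = (1 - ∑ j, β j) * μ) {ψ ρ : ℕ → ℝ}
    (hψs : Summable fun i => |ψ i|) (hρ : Tendsto ρ atTop (𝓝 0))
    (hψ : ∀ u e : ℤ → ℝ, (∀ t, u t = ∑ j : Fin p, β j * u (t - ((j : ℕ) + 1)) + e t) →
      ∀ t : ℤ, ∀ k : ℕ, 1 ≤ k →
        |u t - ∑ i ∈ Finset.range k, ψ i * e (t - i)| ≤ ρ k * ∑ j : Fin p, |u (t - k - (j : ℕ))|)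
    {Q G₀ H : Measure ℝ} [IsProbabilityMeasure Q] [IsProbabilityMeasure G₀]
    [IsProbabilityMeasure H] (hG₀ : IsSmoothCenteredLaw G₀) (hH : IsSmoothCenteredLaw H)
    {n : ℕ} (hn : 1 ≤ n) {γ Γ : ℝ} (hγ : γ ∈ Set.Icc 0 Γ) (hnΓ : Γ ≤ √(n : ℝ))
    {ε v z ξ : ℤ → Ω → ℝ}
    (h : IsContaminatedAR P β ν (mixtureCdf G₀ H n) (contaminationLevel γ n) Q ε v z ξ)
    {C₀ C₁ x g₀ g₁ : ℝ} (hF₀ : HasExpansion (fun y => cdf G₀ y) C₀ x g₀)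
    (hF₁ : HasExpansion (fun y => cdf H y) C₁ x g₁) :
    ∃ (u : ℤ → Ω → ℝ) (g : ℝ), |g| ≤ C₀ + C₁ ∧
      (∀ᵐ ω ∂P, ∀ t, v t ω = u t ω + μ) ∧
      (∀ᵐ ω ∂P, ∀ t, u t ω = ∑ j : Fin p, β j * u (t - ((j : ℕ) + 1)) ω + ε t ω) ∧
      BoundedInMean P (fun ω => (1 / √(n : ℝ)) ^ 2 *
        ∑ t ∈ Finset.Icc (1 : ℤ) n, lagAbs p (fun t => u t ω) t)
        (1 + p * ((∑' i, |ψ i|) * √(∫ x, x ^ 2 ∂G₀ + ∫ x, x ^ 2 ∂H))) ∧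
      ∀ (ϑ : ℝ × (Fin p → ℝ)) (s : ℝ), BoundedInMean P
        (fun ω => expansionError β n (1 / √(n : ℝ)) x g g₀
          (γ * shift β (fun y => cdf G₀ y) Q x) ϑ s (fun t => u t ω) (fun t => z t ω * ξ t ω)
          (fun t => ε t ω))
        (errorBound β Q (C₀ + C₁) (‖ϑ‖ + |s|)
            ((∑' i, |ψ i|) * √(∫ x, x ^ 2 ∂G₀ + ∫ x, x ^ 2 ∂H))
            (∫ x, x ^ 2 ∂G₀ + ∫ x, x ^ 2 ∂H) Γ (1 / √(n : ℝ))
          + 1 / √(n : ℝ) * ((C₀ + C₁) * ‖ϑ‖ + Γ * (2 * (p + 1)))) := by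
  have hn1 : (1 : ℝ) ≤ √(n : ℝ) := Real.one_le_sqrt.2 (by exact_mod_cast hn)
  have hn0 : (0 : ℝ) < √(n : ℝ) := by linarith
  set r := 1 / √(n : ℝ) with hr
  have hr0 : 0 ≤ r := by positivity
  have hr1 : r ≤ 1 := (div_le_one hn0).2 hn1
  have hrn : r * √(n : ℝ) = 1 := one_div_mul_cancel hn0.ne'
  have hrn2 : r ^ 2 * n = 1 := by
    rw [← Real.sq_sqrt (n.cast_nonneg (α := ℝ)), ← mul_pow, hrn, one_pow]
  -- Since γ ≤ Γ ≤ √n, the minimum with 1 is inactive and √n γ_n = γ exactly.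
  have hq : contaminationLevel γ n = γ * r := by
    rw [contaminationLevel, hr, mul_one_div, min_eq_right]
    exact (div_le_one hn0).2 (hγ.2.trans hnΓ)
  have hq0 : 0 ≤ contaminationLevel γ n := by rw [hq]; exact mul_nonneg hγ.1 hr0
  have hq1 : contaminationLevel γ n ≤ 1 := min_le_left _ _
  have hqr : contaminationLevel γ n ≤ Γ * r := by
    rw [hq]; exact mul_le_mul_of_nonneg_right hγ.2 hr0
  set σ := ∫ x, x ^ 2 ∂G₀ + ∫ x, x ^ 2 ∂H with hσ
  have s0 : 0 ≤ ∫ x, x ^ 2 ∂G₀ := integral_nonneg fun _ => sq_nonneg _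
  have s1 : 0 ≤ ∫ x, x ^ 2 ∂H := integral_nonneg fun _ => sq_nonneg _
  set L := mixtureLaw G₀ H r with hLdef
  have hLp : IsProbabilityMeasure L := isProbabilityMeasure_mixtureLaw hr0 hr1
  have hLmem : MemLp (fun x : ℝ => x) 2 L :=
    memLp_mixtureLaw measurable_id' hG₀.finite_variance hH.finite_variance
  have hL0 : ∫ x, x ∂L = 0 := by
    rw [hLdef, integral_mixtureLaw hr0 hr1 (hG₀.finite_variance.integrable (by norm_num))
      (hH.finite_variance.integrable (by norm_num)), hG₀.mean_zero, hH.mean_zero]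
    simp
  have hLσ : ∫ x, x ^ 2 ∂L ≤ σ := by
    rw [hLdef, integral_mixtureLaw hr0 hr1 hG₀.finite_variance.integrable_sq
      hH.finite_variance.integrable_sq]
    have := mul_nonneg hr0 s0
    have := mul_le_mul_of_nonneg_right hr1 s1
    linarith
  have hLcdf : ∀ x, cdf L x = mixtureCdf G₀ H n x := fun x => by
    rw [hLdef, cdf_mixtureLaw hr0 hr1, mixtureCdf]
  have hκ0 : 0 ≤ (∑' i, |ψ i|) * √σ :=
    mul_nonneg (tsum_nonneg fun _ => abs_nonneg _) (Real.sqrt_nonneg _)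
  obtain ⟨𝓕, u, hreg, huv⟩ := h.exists_isRegularModel hq0 hq1 hμ hψs hρ hψ L hLcdf
    (Real.sqrt_nonneg σ) (eLpNorm_le_sqrt hLmem hLσ)
  have hF := hF₀.mix hF₁ hr0 hr1 (F := fun y => cdf L y) fun y => by
    rw [hLdef, cdf_mixtureLaw hr0 hr1]
  refine ⟨u, (1 - r) * g₀ + r * g₁, hF.slope, huv, hreg.equation, ?_, fun ϑ s => ?_⟩
  · have h1 := (BoundedInMean.sum (s := Finset.Icc (1 : ℤ) n) fun t _ =>
      hreg.bounded_lagAbs hκ0 t).const_mul (r ^ 2)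
    refine h1.mono (le_of_eq ?_)
    rw [abs_of_nonneg (sq_nonneg r), Finset.sum_const, nsmul_eq_mul]
    have hcard : ((Finset.Icc (1 : ℤ) n).card : ℝ) = n := by simp
    rw [hcard, ← mul_assoc, hrn2, one_mul]
  · have h1 := hreg.bounded_changeSum_sub hκ0 hq0 (one_sub_sum_ne_zero hβ) hLmem hL0 hLσ hF ϑ s
      hr0 hrn hqr
    -- This constant is exactly the difference between the leading terms for the mixture and for G₀;
    -- it has order r.
    have h2 := h1.add (BoundedInMean.const (P := P) (r * ((g₁ - g₀) * ϑ.1 +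
      γ * (shift β (fun y => cdf H y) Q x - shift β (fun y => cdf G₀ y) Q x))))
    refine (h2.congr (Eventually.of_forall fun ω => ?_)).mono (add_le_add le_rfl ?_)
    · simp only [expansionError]
      rw [hLdef, shift_mix β Q x hr0 hr1, hq]
      linear_combination (-γ * ((1 - r) * shift β (fun y => cdf G₀ y) Q x
        + r * shift β (fun y => cdf H y) Q x)) * hrn
    · rw [abs_mul, abs_of_nonneg hr0]
      refine mul_le_mul_of_nonneg_left ((abs_add_le _ _).trans (add_le_add ?_ ?_)) hr0
      · rw [abs_mul]
        refine mul_le_mul ((abs_sub _ _).trans ?_) (norm_fst_le ϑ) (abs_nonneg _)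
          (add_nonneg hF₀.nonneg hF₁.nonneg)
        linarith [hF₀.slope, hF₁.slope]
      · rw [abs_mul, abs_of_nonneg hγ.1]
        refine mul_le_mul hγ.2 ((abs_sub _ _).trans ?_) (abs_nonneg _) (hγ.1.trans hγ.2)
        linarith [abs_shift_le β H Q x, abs_shift_le β G₀ Q x]

end IsContaminatedAR

end Expansion

/-! ### Uniform expansion for the estimated residuals -/

section Family

/-- The first order expansion of the empirical distribution function of the residuals, uniformly
in the intensity of the contamination. -/
lemma eventually_measure_residual_edf_le {p : ℕ} {β : Fin p → ℝ} (hβ : RootsInUnitDisc β)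
    {ν μ : ℝ} (hμ : ν = (1 - ∑ j, β j) * μ) {Q : Measure ℝ} [IsProbabilityMeasure Q] {Γ : ℝ}
    {Ω : ℕ → ℝ → Type*} [∀ n γ, MeasurableSpace (Ω n γ)]
    {P : ∀ n γ, Measure (Ω n γ)} [∀ n γ, IsProbabilityMeasure (P n γ)]
    {ε v z ξ y : ∀ n γ, ℤ → Ω n γ → ℝ}
    (hy : ∀ n γ t ω, y n γ t ω = v n γ t ω + z n γ t ω * ξ n γ t ω)
    {μhat : ∀ n γ, Ω n γ → ℝ} {βhat : ∀ n γ, Ω n γ → (Fin p → ℝ)}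
    (hμrate : UniformlyBoundedInProb P Γ (fun n γ ω => √(n : ℝ) * (μhat n γ ω - μ)))
    (hβrate : UniformlyBoundedInProb P Γ (fun n γ ω => √(n : ℝ) • (βhat n γ ω - β)))
    {G₀ H : Measure ℝ} [IsProbabilityMeasure G₀] [IsProbabilityMeasure H]
    (hG₀ : IsSmoothCenteredLaw G₀) (hH : IsSmoothCenteredLaw H)
    (hmodel : ∀ n : ℕ, 1 ≤ n → ∀ γ ∈ Set.Icc 0 Γ,
      IsContaminatedAR (P n γ) β ν (mixtureCdf G₀ H n) (contaminationLevel γ n) Q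
        (ε n γ) (v n γ) (z n γ) (ξ n γ)) (x : ℝ) {δ : ℝ} (hδ : 0 < δ) {b : ENNReal} (hb : 0 < b) :
    ∀ᶠ n in atTop, ∀ γ ∈ Set.Icc 0 Γ, P n γ {ω | δ < |√(n : ℝ) *
        (edf n (arResidual (fun t => y n γ t ω) (μhat n γ ω) (βhat n γ ω)) x
          - edf n (fun t => ε n γ t ω) x)
        - deriv (fun y => cdf G₀ y) x *
          (√(n : ℝ) * (μhat n γ ω - μ) * (1 - ∑ j, βhat n γ ω j))
        - γ * shift β (fun y => cdf G₀ y) Q x|} ≤ b := by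
  obtain ⟨ψ, ρ, hψs, hρ, hψ⟩ := exists_movingAverage_approx hβ
  obtain ⟨C₀, hC₀⟩ := hG₀.exists_hasExpansion
  obtain ⟨C₁, hC₁⟩ := hH.exists_hasExpansion
  set C := C₀ + C₁ with hC
  have hCnn : 0 ≤ C := add_nonneg (hC₀ x).nonneg (hC₁ x).nonneg
  set σ := ∫ x, x ^ 2 ∂G₀ + ∫ x, x ^ 2 ∂H with hσ
  set κ := (∑' i, |ψ i|) * √σ with hκ
  have hκ0 : 0 ≤ κ := mul_nonneg (tsum_nonneg fun _ => abs_nonneg _) (Real.sqrt_nonneg _)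
  set g₀ := deriv (fun y => cdf G₀ y) x with hg₀
  have hg₀C : |g₀| ≤ C := (hC₀ x).slope.trans (le_add_of_nonneg_right (hC₁ x).nonneg)
  -- The budget b is split between the two tightness events and the event where the dominating
  -- variable is large; the real number e stands in for b/3, which may be infinite.
  have hb3 : 0 < b / 3 := ENNReal.div_pos hb.ne' (by norm_num)
  obtain ⟨e, he0, heb⟩ : ∃ e : ℝ, 0 < e ∧ ENNReal.ofReal e ≤ b / 3 := by
    obtain ⟨a, ha0, hab⟩ := ENNReal.lt_iff_exists_nnreal_btwn.1 hb3
    exact ⟨a, by exact_mod_cast ha0, by simpa using hab.le⟩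
  obtain ⟨K₁, hK₁⟩ := hμrate (b / 3) hb3
  obtain ⟨K₂, hK₂⟩ := hβrate (b / 3) hb3
  -- The first coordinate of ϑ is bounded through |1 - Σβ̂_j| ≤ |1 - Σβ_j| + pK₂, where |β̂_j - β_j|
  -- ≤ √n|β̂_j - β_j| ≤ K₂.
  set K := max (K₁ * (|1 - ∑ j, β j| + p * K₂)) K₂ with hK
  -- The widening costs Cη(1 + pκ) in mean and the recentring Cη; together they get half of eδ. The
  -- added 1 in the denominator covers C = 0.
  obtain ⟨η, hη0, hη⟩ : ∃ η : ℝ, 0 < η ∧ C * η * (2 + p * κ) ≤ e * δ / 2 := by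
    refine ⟨e * δ / 2 / (C * (2 + p * κ) + 1), by positivity, ?_⟩
    have h1 : 0 < C * (2 + p * κ) + 1 := by positivity
    calc C * (e * δ / 2 / (C * (2 + p * κ) + 1)) * (2 + p * κ)
        = e * δ / 2 * (C * (2 + p * κ) / (C * (2 + p * κ) + 1)) := by ring
      _ ≤ e * δ / 2 * 1 := by
          refine mul_le_mul_of_nonneg_left ((div_le_one h1).2 (by linarith)) (by positivity)
      _ = e * δ / 2 := mul_one _
  obtain ⟨S', -, hS'fin, hS'⟩ :=
    (isCompact_closedBall (0 : ℝ × (Fin p → ℝ)) K).finite_cover_balls hη0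
  set S := hS'fin.toFinset with hS
  -- The net is fixed before n and γ, so a finite sum of null sequences controls all its points at
  -- once.
  set B : ℕ → (ℝ × (Fin p → ℝ)) → ℝ := fun n ϑ =>
    errorBound β Q C (‖ϑ‖ + η) κ σ Γ (1 / √(n : ℝ))
      + 1 / √(n : ℝ) * (C * ‖ϑ‖ + Γ * (2 * (p + 1))) with hB
  have hr : Tendsto (fun n : ℕ => 1 / √(n : ℝ)) atTop (𝓝 0) := by
    have := (Real.tendsto_sqrt_atTop.comp tendsto_natCast_atTop_atTop).inv_tendsto_atTop
    simp only [one_div]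
    exact this
  have hr' : Tendsto (fun n : ℕ => 1 / √(n : ℝ)) atTop (𝓝[≥] 0) :=
    tendsto_nhdsWithin_iff.2 ⟨hr, Eventually.of_forall fun n => by
      simp only [Set.mem_Ici]; positivity⟩
  have hBlim : Tendsto (fun n => ∑ ϑ ∈ S, (B n ϑ + B n ϑ)) atTop (𝓝 0) := by
    have h1 : ∀ ϑ, Tendsto (fun n => B n ϑ) atTop (𝓝 0) := by
      intro ϑ
      have h2 := ((tendsto_errorBound β Q hCnn (K := ‖ϑ‖ + η) (by positivity) κ σ Γ).comp hr').add
        (hr.mul_const (C * ‖ϑ‖ + Γ * (2 * (p + 1))))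
      simpa [hB] using h2
    have h3 := tendsto_finsetSum S fun ϑ _ => (h1 ϑ).add (h1 ϑ)
    simpa using h3
  have hnΓ : ∀ᶠ n : ℕ in atTop, Γ ≤ √(n : ℝ) :=
    (Real.tendsto_sqrt_atTop.comp tendsto_natCast_atTop_atTop).eventually_ge_atTop Γ
  filter_upwards [hK₁, hK₂, eventually_ge_atTop 1, hnΓ,
    hBlim.eventually_le_const (by positivity : 0 < e * δ / 2)] with n h1 h2 hn1 hnΓ hBn γ hγ
  have hμn := (le_iSup₂ (f := fun γ (_ : γ ∈ Set.Icc 0 Γ) => P n γ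
    {ω | K₁ < ‖√(n : ℝ) * (μhat n γ ω - μ)‖}) γ hγ).trans h1
  have hβn := (le_iSup₂ (f := fun γ (_ : γ ∈ Set.Icc 0 Γ) => P n γ
    {ω | K₂ < ‖√(n : ℝ) • (βhat n γ ω - β)‖}) γ hγ).trans h2
  obtain ⟨u, g, hgC, huv, hueq, hV, hE⟩ := (hmodel n hn1 γ hγ).exists_expansion hβ hμ hψs hρ hψ
    hG₀ hH hn1 hγ hnΓ (hC₀ x) (hC₁ x)
  have hs1 : (1 : ℝ) ≤ √(n : ℝ) := Real.one_le_sqrt.2 (by exact_mod_cast hn1)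
  have hs0 : (0 : ℝ) < √(n : ℝ) := by linarith
  set r := 1 / √(n : ℝ) with hrdef
  have hr0 : 0 ≤ r := by positivity
  have hrn : r * √(n : ℝ) = 1 := one_div_mul_cancel hs0.ne'
  have hrinv : √(n : ℝ) * (n : ℝ)⁻¹ = r := by
    rw [hrdef, ← div_eq_mul_inv, Real.sqrt_div_self']
  set d := γ * shift β (fun y => cdf G₀ y) Q x with hd
  have hη1 : ∀ ϑ, BoundedInMean (P n γ) (fun ω => |expansionError β n r x g g₀ d ϑ η
      (fun t => u t ω) (fun t => z n γ t ω * ξ n γ t ω) (fun t => ε n γ t ω)|) (B n ϑ) := fun ϑ => by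
    have := (hE ϑ η).abs
    rwa [abs_of_pos hη0] at this
  have hη2 : ∀ ϑ, BoundedInMean (P n γ) (fun ω => |expansionError β n r x g g₀ d ϑ (-η)
      (fun t => u t ω) (fun t => z n γ t ω * ξ n γ t ω) (fun t => ε n γ t ω)|) (B n ϑ) := fun ϑ => by
    have := (hE ϑ (-η)).abs
    rwa [abs_neg, abs_of_pos hη0] at this
  have hZ := (BoundedInMean.sum (s := S) fun ϑ _ => (hη1 ϑ).add (hη2 ϑ)).add
    ((hV.const_mul (C * η)).add (BoundedInMean.const (P := P n γ) (C * η)))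
  have hCη : 0 ≤ C * η := by positivity
  rw [abs_of_nonneg hCη] at hZ
  -- The mean is at most eδ/2 from the net plus eδ/2 from η, and Markov's inequality divides by δ.
  have hZ' := (hZ.mono (b := e * δ) (by nlinarith)).measure_lt_le hδ
  rw [mul_div_cancel_right₀ _ hδ.ne'] at hZ'
  refine (measure_mono_ae ?_).trans ((measure_union_le _ _).trans ((add_le_add
    ((measure_union_le _ _).trans (add_le_add hμn hβn)) (hZ'.trans heb)).trans
      (le_of_eq (ENNReal.add_thirds b))))
  filter_upwards [huv, hueq] with ω hω1 hω2 hmem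
  by_contra hno
  change ¬ (ω ∈ ({ω | K₁ < ‖√(n : ℝ) * (μhat n γ ω - μ)‖} ∪
    {ω | K₂ < ‖√(n : ℝ) • (βhat n γ ω - β)‖}) ∪ {ω | δ < |_|}) at hno
  simp only [Set.mem_union, Set.mem_ofPred_eq, not_or, not_lt] at hno
  obtain ⟨⟨n1, n2⟩, n3⟩ := hno
  have hmem' : δ < |√(n : ℝ) *
        (edf n (arResidual (fun t => y n γ t ω) (μhat n γ ω) (βhat n γ ω)) x
          - edf n (fun t => ε n γ t ω) x)
        - g₀ * (√(n : ℝ) * (μhat n γ ω - μ) * (1 - ∑ j, βhat n γ ω j)) - d| := hmem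
  set ϑ : ℝ × (Fin p → ℝ) := (√(n : ℝ) * (μhat n γ ω - μ) * (1 - ∑ j, βhat n γ ω j),
    √(n : ℝ) • (βhat n γ ω - β)) with hϑ
  have hres : ∀ t, arResidual (fun t => y n γ t ω) (μhat n γ ω) (βhat n γ ω) t
      = ε n γ t ω - threshold β ϑ 0 r (fun t => u t ω) (fun t => z n γ t ω * ξ n γ t ω) t :=
    fun t => arResidual_eq hrn (e := fun t => ε n γ t ω)
      (fun s => by rw [hy, hω1 s]) (hω2 t)
  rw [sqrt_mul_edf_sub (e := fun t => ε n γ t ω) hrinv hres] at hmem'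
  have hK₂0 : 0 ≤ K₂ := (norm_nonneg _).trans n2
  have hϑK : ‖ϑ‖ ≤ K := by
    rw [hϑ, Prod.norm_def]
    refine max_le_max ?_ n2
    rw [norm_mul]
    refine mul_le_mul n1 ?_ (norm_nonneg _) ((norm_nonneg _).trans n1)
    have e1 : 1 - ∑ j, βhat n γ ω j = (1 - ∑ j, β j) - ∑ j, (βhat n γ ω j - β j) := by
      rw [Finset.sum_sub_distrib]; ring
    rw [e1, Real.norm_eq_abs]
    refine (abs_sub _ _).trans (add_le_add le_rfl ?_)
    refine (Finset.abs_sum_le_sum_abs _ _).trans ?_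
    refine (Finset.sum_le_card_nsmul _ _ K₂ fun j _ => ?_).trans (by simp)
    have e2 := (norm_le_pi_norm (√(n : ℝ) • (βhat n γ ω - β)) j).trans n2
    simp only [Pi.smul_apply, Pi.sub_apply, smul_eq_mul, norm_mul, Real.norm_eq_abs,
      abs_of_pos hs0] at e2
    exact (le_mul_of_one_le_left (abs_nonneg _) hs1).trans e2
  have hcov : ∃ ϑ₀ ∈ S, ‖ϑ - ϑ₀‖ ≤ η := by
    have h3 : ϑ ∈ Metric.closedBall (0 : ℝ × (Fin p → ℝ)) K := by simpa using hϑK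
    obtain ⟨ϑ₀, h4, h5⟩ := Set.mem_iUnion₂.1 (hS' h3)
    refine ⟨ϑ₀, by simpa [hS] using h4, ?_⟩
    rw [← dist_eq_norm]
    exact (Metric.mem_ball.1 h5).le
  have hfin := abs_changeSum_sub_le (β := β) (n := n) (x := x) (d := d) hr0 hCnn hgC hg₀C hcov
    (fun t => u t ω) (fun t => z n γ t ω * ξ n γ t ω) (fun t => ε n γ t ω)
  exact absurd (hmem'.trans_le (hfin.trans ((le_abs_self _).trans n3))) (lt_irrefl _)

end Family

/-! ### Symmetrization and the two situations -/

/-- The symmetrized expansion when the innovations follow the mixture law. -/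
lemma uniformlyTendstoZeroInProb_symmetrize {p : ℕ} {β : Fin p → ℝ} (hβ : RootsInUnitDisc β)
    {ν μ : ℝ} (hμ : ν = (1 - ∑ j, β j) * μ) {Q : Measure ℝ} [IsProbabilityMeasure Q] {Γ : ℝ}
    {Ω : ℕ → ℝ → Type*} [∀ n γ, MeasurableSpace (Ω n γ)]
    {P : ∀ n γ, Measure (Ω n γ)} [∀ n γ, IsProbabilityMeasure (P n γ)]
    {ε v z ξ y : ∀ n γ, ℤ → Ω n γ → ℝ}
    (hy : ∀ n γ t ω, y n γ t ω = v n γ t ω + z n γ t ω * ξ n γ t ω)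
    {μhat : ∀ n γ, Ω n γ → ℝ} {βhat : ∀ n γ, Ω n γ → (Fin p → ℝ)}
    (hμrate : UniformlyBoundedInProb P Γ (fun n γ ω => √(n : ℝ) * (μhat n γ ω - μ)))
    (hβrate : UniformlyBoundedInProb P Γ (fun n γ ω => √(n : ℝ) • (βhat n γ ω - β)))
    {G₀ H : Measure ℝ} [IsProbabilityMeasure G₀] [IsProbabilityMeasure H]
    (hG₀ : IsSmoothCenteredLaw G₀) (hH : IsSmoothCenteredLaw H) (hsym : IsSymmetricCdf G₀)
    (hmodel : ∀ n : ℕ, 1 ≤ n → ∀ γ ∈ Set.Icc 0 Γ,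
      IsContaminatedAR (P n γ) β ν (mixtureCdf G₀ H n) (contaminationLevel γ n) Q
        (ε n γ) (v n γ) (z n γ) (ξ n γ)) (x : ℝ) :
    UniformlyTendstoZeroInProb P Γ (fun n γ ω =>
        √(n : ℝ) *
          (symmetrize (edf n
              (arResidual (fun t => y n γ t ω) (μhat n γ ω) (βhat n γ ω))) x
            - symmetrize (edf n (fun t => ε n γ t ω)) x)
          - γ * symmShift β (fun x => cdf G₀ x) Q x) := by
  intro δ hδ
  rw [ENNReal.tendsto_nhds_zero]
  intro b hb
  have hb2 : 0 < b / 2 := ENNReal.half_pos hb.ne'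
  filter_upwards [eventually_measure_residual_edf_le hβ hμ hy hμrate hβrate hG₀ hH hmodel x hδ
    hb2, eventually_measure_residual_edf_le hβ hμ hy hμrate hβrate hG₀ hH hmodel (-x) hδ hb2]
    with n h1 h2
  refine iSup₂_le fun γ hγ => ?_
  refine le_trans (measure_mono ?_) ((measure_union_le _ _).trans
    ((add_le_add (h1 γ hγ) (h2 γ hγ)).trans (le_of_eq (ENNReal.add_halves b))))
  intro ω hω
  rw [Set.mem_ofPred_eq] at hω
  -- After rewriting the slope at -x as the slope at x, the terms with μ̂ coincide and drop out of
  -- the half difference; two errors of size at most δ give one of size at most δ.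
  rw [Set.mem_union, Set.mem_ofPred_eq, Set.mem_ofPred_eq,
    deriv_neg_of_symmetric hsym hG₀.differentiable_cdf]
  by_contra hno
  rw [not_or, not_lt, not_lt, abs_le, abs_le] at hno
  obtain ⟨⟨a1, a2⟩, a3, a4⟩ := hno
  refine absurd hω (not_lt.2 (abs_le.2 ?_))
  simp only [symmetrize, symmShift]
  constructor <;> linarith

end ResidualAR

end

theorem mainTheorem3 {p : ℕ} (β : Fin p → ℝ) (hβ : ResidualAR.RootsInUnitDisc β)
    (ν μ : ℝ) (hμ : ν = (1 - ∑ j, β j) * μ)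
    (Q : Measure ℝ) [IsProbabilityMeasure Q] (Γ : ℝ) (hΓ : 0 ≤ Γ)
    {Ω : ℕ → ℝ → Type*} [∀ n γ, MeasurableSpace (Ω n γ)]
    (P : ∀ n γ, Measure (Ω n γ)) [∀ n γ, IsProbabilityMeasure (P n γ)]
    (ε v z ξ y : ∀ n γ, ℤ → Ω n γ → ℝ)
    (hy : ∀ n γ t ω, y n γ t ω = v n γ t ω + z n γ t ω * ξ n γ t ω)
    (μhat : ∀ n γ, Ω n γ → ℝ) (hμhat : ∀ n γ, Measurable (μhat n γ))
    (βhat : ∀ n γ, Ω n γ → (Fin p → ℝ)) (hβhat : ∀ n γ, Measurable (βhat n γ))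
    (hμrate : ResidualAR.UniformlyBoundedInProb P Γ
      (fun n γ ω => √(n : ℝ) * (μhat n γ ω - μ)))
    (hβrate : ResidualAR.UniformlyBoundedInProb P Γ
      (fun n γ ω => √(n : ℝ) • (βhat n γ ω - β))) :
    -- first situation: the innovation distribution function `G` does not depend on `n`
    (∀ (G : Measure ℝ) [IsProbabilityMeasure G],
      ResidualAR.IsSmoothCenteredLaw G → ResidualAR.IsSymmetricCdf G →
      (∀ n : ℕ, 1 ≤ n → ∀ γ ∈ Set.Icc 0 Γ,
        ResidualAR.IsContaminatedAR (P n γ) β ν (fun x => cdf G x)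
          (ResidualAR.contaminationLevel γ n) Q (ε n γ) (v n γ) (z n γ) (ξ n γ)) →
      ∀ x : ℝ, ResidualAR.UniformlyTendstoZeroInProb P Γ (fun n γ ω =>
        √(n : ℝ) *
          (ResidualAR.symmetrize (ResidualAR.edf n
              (ResidualAR.arResidual (fun t => y n γ t ω) (μhat n γ ω) (βhat n γ ω))) x
            - ResidualAR.symmetrize (ResidualAR.edf n (fun t => ε n γ t ω)) x)
          - γ * ResidualAR.symmShift β (fun x => cdf G x) Q x)) ∧
    -- second situation: the innovation distribution function is the mixture `A_n` of `G₀`, `H`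
    (∀ (G₀ H : Measure ℝ) [IsProbabilityMeasure G₀] [IsProbabilityMeasure H],
      ResidualAR.IsSmoothCenteredLaw G₀ → ResidualAR.IsSmoothCenteredLaw H →
      ResidualAR.IsSymmetricCdf G₀ →
      (∀ n : ℕ, 1 ≤ n → ∀ γ ∈ Set.Icc 0 Γ,
        ResidualAR.IsContaminatedAR (P n γ) β ν (ResidualAR.mixtureCdf G₀ H n)
          (ResidualAR.contaminationLevel γ n) Q (ε n γ) (v n γ) (z n γ) (ξ n γ)) →
      ∀ x : ℝ, ResidualAR.UniformlyTendstoZeroInProb P Γ (fun n γ ω =>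
        √(n : ℝ) *
          (ResidualAR.symmetrize (ResidualAR.edf n
              (ResidualAR.arResidual (fun t => y n γ t ω) (μhat n γ ω) (βhat n γ ω))) x
            - ResidualAR.symmetrize (ResidualAR.edf n (fun t => ε n γ t ω)) x)
          - γ * ResidualAR.symmShift β (fun x => cdf G₀ x) Q x)) := by
  refine ⟨fun G _ hG hsym hmodel x => ?_, fun G₀ H _ _ hG₀ hH hsym hmodel x => ?_⟩
  -- The first situation is the second with H = G: mixing G with itself gives G.
  · refine ResidualAR.uniformlyTendstoZeroInProb_symmetrize (H := G) hβ hμ hy hμrate hβrate hG hG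
      hsym (fun n hn γ hγ => ?_) x
    have h1 : ResidualAR.mixtureCdf G G n = fun x => cdf G x := by
      funext x
      rw [ResidualAR.mixtureCdf]
      ring
    rw [h1]
    exact hmodel n hn γ hγ
  · exact ResidualAR.uniformlyTendstoZeroInProb_symmetrize hβ hμ hy hμrate hβrate hG₀ hH hsym
      hmodel x
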